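/- Let $n\ge 1$, $\mathbb T=\mathbb R/2\pi\mathbb Z$, and let $\Phi_\mu$ ($\mu\in\mathbb N_0^n$) be the $L^2$-normalized Hermite functions on $\mathbb R^n$. Let $S\subset\mathbb N_0^n\times\mathbb Z$ be a discrete surface (any subset, with counting measure), let $\mathcal E_S:\ell^2(S)\to L^2(\mathbb T\times\mathbb R^n)$, $\mathcal E_S a(t,x)=\sum_{(\mu,\nu)\in S}a(\mu,\nu)\Phi_\mu(x)e^{-i\nu t}$, be its extension operator, and let $T_S=\mathcal E_S\mathcal E_S^*$. Let $\lambda_0>1$ and let $$T_zg(t,x)=\sum_{(\mu,\nu)}\hat g(\mu,\nu)\,G_z(\mu,\nu)\,\Phi_\mu(x)e^{-i\nu t},\qquad \hat g(\mu,\nu)=\int_{\mathbb R^n}\int_{\mathbb T}g(t,x)\Phi_\mu(x)e^{i\nu t}\,dt\,dx,$$ be an analytic family of operators on the strip $-\lambda_0\le\operatorname{Re}z\le0$ with $T_{-1}=T_S$; that is, for each $(\mu,\nu)$ the function $z\mapsto G_z(\mu,\nu)$ is continuous on the closed strip, holomorphic in its interior, and satisfies $|G_z(\mu,\nu)|\le\exp(Be^{c|\operatorname{Im}z|})$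 there for some $c<\pi/\lambda_0$ and $B\in\mathbb R$ (which may depend on $(\mu,\nu)$), and $G_{-1}=\mathbf 1_S$. Suppose that there are real constants $M_0,a$ with $|G_{is}(\mu,\nu)|\le M_0e^{a|s|}$ for all $s\in\mathbb R$ and all $(\mu,\nu)$. Suppose that on the line $z=-\lambda_0+is$ the kernel $$K_z(x,y,t)=\sum_{(\mu,\nu)}\Phi_\mu(x)\Phi_\mu(y)G_z(\mu,\nu)e^{-i\nu t}$$ is bounded, with at most exponential growth in $s$: there are real constants $M_1,b$ such that for each $s\in\mathbb R$ there is a measurable function $K_z$ with $|K_z(x,y,t)|\le M_1e^{b|s|}$ for almost all $(x,y,t)$ which has this Fourier–Hermite series, i.e. $\iiint K_z(x,y,t)\Phi_\mu(x)\Phi_{\mu'}(y)e^{i\nu t}\,dx\,dy\,dt$ equals $2\pi G_z(\mu,\nu)$ if $\mu=\mu'$ and $0$ otherwise. Then $T_S$ is bounded from $L^p(\mathbb T\times\mathbb R^n)$ to $L^{p'}(\mathbb T\times\mathbb R^n)$ for $p=\frac{2\lambda_0}{1+\lambda_0}$, $\frac1p+\frac1{p'}=1$. Moreover there is a constant $C$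 such that for all $W_1,W_2\in L^{2\lambda_0}(\mathbb T\times\mathbb R^n)$ the operator $W_1T_SW_2$ ($W_i$ acting by multiplication) belongs to the Schatten class $\mathfrak G^{2\lambda_0}(L^2(\mathbb T\times\mathbb R^n))$, and $$\|W_1T_SW_2\|_{\mathfrak G^{2\lambda_0}}\le C\,\|W_1\|_{L^{2\lambda_0}}\|W_2\|_{L^{2\lambda_0}}.$$ -/

import Mathlib

open MeasureTheory

noncomputable section

namespace FourierHermite

/-! ### Hermite functions and the Fourier-Hermite system -/

/-- The Hermite polynomial `H_k(x) = (-1)^k (d^k/dx^k e^{-x^2}) e^{x^2}`. -/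
def hermitePoly (k : ℕ) (x : ℝ) : ℝ :=
  (-1) ^ k * iteratedDeriv k (fun u : ℝ => Real.exp (-u ^ 2)) x * Real.exp (x ^ 2)

/-- The normalized Hermite function `h_k(x) = (2^k √π k!)^{-1/2} H_k(x) e^{-x^2/2}`. -/
def hermiteFun (k : ℕ) (x : ℝ) : ℝ :=
  (Real.sqrt (2 ^ k * Real.sqrt Real.pi * (k.factorial : ℝ)))⁻¹ *
    hermitePoly k x * Real.exp (-x ^ 2 / 2)

/-- The `n`-dimensional Hermite function `Φ_μ(x) = ∏ j, h_{μ_j}(x_j)`. -/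
def Phi {n : ℕ} (μ : Fin n → ℕ) (x : EuclideanSpace ℝ (Fin n)) : ℝ :=
  ∏ j, hermiteFun (μ j) (x j)

instance fact_two_pi_pos : Fact (0 < 2 * Real.pi) := ⟨Real.two_pi_pos⟩

/-- The circle `ℝ / 2πℤ`; its `volume` is Lebesgue measure `dt`, of total mass `2π`. -/
abbrev Torus : Type := AddCircle (2 * Real.pi)

/-- The space `𝕋 × ℝⁿ`, with points `(t, x)` and measure `dt dx`. -/
abbrev TX (n : ℕ) : Type := Torus × EuclideanSpace ℝ (Fin n)

/-- The Hilbert space `L²(𝕋 × ℝⁿ)`. -/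
abbrev L2TX (n : ℕ) : Type := Lp ℂ 2 (volume : Measure (TX n))

/-- The function `(t, x) ↦ Φ_μ(x) e^{-iνt}`, for the frequency `s = (μ, ν)`.
On `ℝ / 2πℤ` Mathlib's `fourier m t` is `e^{imt}`. -/
def mode {n : ℕ} (s : (Fin n → ℕ) × ℤ) (q : TX n) : ℂ :=
  (Phi s.1 q.2 : ℂ) * fourier (-s.2) q.1

/-- `E` is the extension operator of `S ⊆ ℕ₀ⁿ × ℤ` (with counting measure), as an operator from
`ℓ²(S)` to `L²(𝕋 × ℝⁿ)`: the bounded operator with `E a = ∑_{(μ,ν) ∈ S} a(μ,ν) Φ_μ(x) e^{-iνt}`.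
By linearity and continuity it is determined by its values on the unit sequences. -/
def IsExtensionOperator {n : ℕ} (S : Set ((Fin n → ℕ) × ℤ))
    (E : lp (fun _ : S => ℂ) 2 →L[ℂ] L2TX n) : Prop :=
  ∀ s : S, (E (lp.single 2 s (1 : ℂ)) : TX n → ℂ) =ᵐ[volume] mode (s : (Fin n → ℕ) × ℤ)

/-! ### Analytic families of Fourier-Hermite multipliers and their kernels -/

/-- Analyticity, on the strip `-lam ≤ Re z ≤ 0`, of the family of Fourier-Hermite multipliers
`T_z g(t,x) = ∑_{(μ,ν)} ĝ(μ,ν) G_z(μ,ν) Φ_μ(x) e^{-iνt}`. As `T_z` is diagonal in the orthogonal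
system of the functions `Φ_μ(x) e^{-iνt}`, Stein's conditions on its matrix coefficients
with respect to this system are conditions on the `G_z(μ,ν)`: each is continuous on the closed
strip, holomorphic in the open strip, and of admissible growth
`log |G_z(μ,ν)| ≤ B e^{c |Im z|}` with `c < π / lam`, where `lam` is the width of the strip.
No uniformity in `(μ,ν)` is asked for. -/
def IsAnalyticFamily {n : ℕ} (lam : ℝ) (G : ℂ → (Fin n → ℕ) × ℤ → ℂ) : Prop :=
  ∀ s : (Fin n → ℕ) × ℤ,
    DiffContOnCl ℂ (fun z => G z s) (Complex.re ⁻¹' Set.Ioo (-lam) 0) ∧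
    ∃ c < Real.pi / lam, ∃ B : ℝ, ∀ z : ℂ, -lam ≤ z.re → z.re ≤ 0 →
      ‖G z s‖ ≤ Real.exp (B * Real.exp (c * |z.im|))

/-- `K` is essentially bounded by `M` and is the convolution kernel of the multiplier `m`, that is,
`K(x,y,t) = ∑_{(μ,ν)} Φ_μ(x) Φ_μ(y) m(μ,ν) e^{-iνt}`, in the sense that `K` is the bounded function
with the coefficients
`∫∫∫ K(x,y,t) Φ_μ(x) Φ_μ'(y) e^{iνt} dx dy dt = 2π m(μ,ν)` for `μ' = μ`, and `0` for `μ' ≠ μ`.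
Then `T g(t,x) = ∫ (K(x,y,·) * g(y,·))(t) dy` for the operator `T` with multiplier `m`. -/
def IsBoundedKernel {n : ℕ} (m : (Fin n → ℕ) × ℤ → ℂ) (M : ℝ)
    (K : EuclideanSpace ℝ (Fin n) × EuclideanSpace ℝ (Fin n) × Torus → ℂ) : Prop :=
  AEStronglyMeasurable K volume ∧
  (∀ᵐ w, ‖K w‖ ≤ M) ∧
  ∀ (μ μ' : Fin n → ℕ) (ν : ℤ),
    ∫ w, K w * ((Phi μ w.1 : ℂ) * (Phi μ' w.2.1 : ℂ) * fourier ν w.2.2) =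
      if μ = μ' then 2 * (Real.pi : ℂ) * m (μ, ν) else 0

/-! ### Schatten classes -/

section Schatten

variable {H : Type*} [NormedAddCommGroup H] [InnerProductSpace ℂ H] [CompleteSpace H]

/-- `∑_n s_n(T)^r`, where the singular values `s_n(T)` are the eigenvalues of `|T| = √(T* T)`
counted according to multiplicity; the sum is taken over the positive eigenvalues `σ`, each
weighted by the dimension of its eigenspace (which is finite if `T` is compact). -/
def schattenSum (r : ℝ) (T : H →L[ℂ] H) : ENNReal :=
  ∑' σ : Set.Ioi (0 : ℝ),
    (Module.finrank ℂ
      (Module.End.eigenspace ((CFC.abs T : H →L[ℂ] H) : H →ₗ[ℂ] H) ((σ : ℝ) : ℂ)) : ENNReal) *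
      ENNReal.ofReal ((σ : ℝ) ^ r)

/-- The Schatten norm `(∑_n s_n(T)^r)^{1/r}`, for compact `T`. -/
def schattenNorm (r : ℝ) (T : H →L[ℂ] H) : ENNReal := schattenSum r T ^ (1 / r)

/-- Membership in the Schatten class `𝔊^r(H)`. -/
def IsSchatten (r : ℝ) (T : H →L[ℂ] H) : Prop :=
  IsCompactOperator T ∧ schattenSum r T < ⊤

end Schatten

/-! ### Boundedness between Lebesgue spaces, and the operators `W₁ T W₂` -/

/-- The operator `T` on `L²(𝕋 × ℝⁿ)` is bounded from `L^p` to `L^q`, that is,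
`‖T f‖_q ≤ C ‖f‖_p` on `L² ∩ L^p`, which is dense in `L^p` for `p < ∞`. -/
def IsBoundedLpLq {n : ℕ} (T : L2TX n →L[ℂ] L2TX n) (p q : ENNReal) : Prop :=
  ∃ C : NNReal, ∀ f : L2TX n, MemLp f p volume →
    eLpNorm (T f) q volume ≤ C * eLpNorm f p volume

/-- The bounded operator `A` on `L²(𝕋 × ℝⁿ)` is `W₁ T W₂`, with the functions `W₁`, `W₂` acting by
multiplication: `A f = W₁ · T (W₂ f)` for all `f ∈ L²` with `W₂ f ∈ L²`. For measurable `W₂` these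
`f` are dense in `L²`, so that there is at most one such `A`. -/
def IsSandwich {n : ℕ} (W₁ : TX n → ℂ) (T : L2TX n →L[ℂ] L2TX n) (W₂ : TX n → ℂ)
    (A : L2TX n →L[ℂ] L2TX n) : Prop :=
  ∀ f g : L2TX n, ((g : TX n → ℂ) =ᵐ[volume] fun q => W₂ q * (f : TX n → ℂ) q) →
    (A f : TX n → ℂ) =ᵐ[volume] fun q => W₁ q * (T g : TX n → ℂ) q

end FourierHermite

end

/-! The proof is Stein interpolation carried out on matrix entries, so that neither trace duality
nor interpolation between Schatten ideals is needed. For orthonormal systems e_k, f_k put a_k =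
⟨f_k, W₁ T_S W₂ e_k⟩, x = ∑ |a_k|^{2λ}, and consider F(z) = ∑ conj(a_k) |a_k|^{z+2λ-1} ⟨f_k,
W₁|W₁|^{-z-1} T_z W₂|W₂|^{-z-1} e_k⟩. Then F(-1) = x. On Re z = 0 the weights have modulus at most 1
and T_z is bounded on L², so |F| ≲ x. On Re z = -λ the weights have modulus |W_i|^λ, which is in L²,
and T_z has a bounded kernel. The weighted operator is therefore Hilbert-Schmidt, and Cauchy-Schwarz
with Bessel's inequality for the tensors f_k ⊗ conj(e_k) gives |F| ≲ √x (‖W₁‖‖W₂‖)^λ. The three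
lines theorem bounds x by these two quantities, and solving for x gives x^{1/(2λ)} ≲ ‖W₁‖‖W₂‖
(`sum_norm_inner_rpow_le`). Such a bound for all finite orthonormal systems yields compactness and
the Schatten norm (`OrthonormalSumBound.isCompactOperator`, `OrthonormalSumBound.schattenSum_le`).

The difficulty is that F needs a meaning. On the left line T_z need not act on L², and inside the
strip nothing is uniform in the frequency. Only sesquilinear forms on the two lines and at -1 are
used, namely (v, u) ↦ ⟨v/w, T_z(u/w)⟩ with w = e^{|x|²/4}. They are bounded on L², on the left line
because K/(w ⊗ w) is square integrable. On the functions w Φ_μ e^{-iνt} their entries are multiples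
of G_z(μ,ν) or zero, hence holomorphic. These functions are total (`dense_span_weightedMode`), and
the maximum principle carries holomorphy over to arbitrary vectors
(`exists_stripBounded_extension`). Beforehand G_z is multiplied by e^{(z+1)²}, which equals 1 at -1
and absorbs the exponential growth (`exists_isRegularFamily`).

The estimate is proved for simple weights supported in cylinders, where w is bounded, and extends by
completeness (`exists_isSandwich_orthonormalSumBound`). The L^p bound follows from the operator norm
of the sandwiches, by factoring f as a weight times an L² function and choosing the other weight as
a power of |T f| (`isBoundedLpLq_of_sandwich`). -/

noncomputable section

namespace FourierHermite

/-! ### Schatten class membership tested on finite orthonormal systems. -/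

section SchattenCriterion

variable {H : Type*} [NormedAddCommGroup H] [InnerProductSpace ℂ H]

theorem isCompactOperator_starProjection (U : Submodule ℂ H) [FiniteDimensional ℂ U] :
    IsCompactOperator (U.starProjection : H → H) := by
  have : ProperSpace U := FiniteDimensional.proper ℂ U
  have h : IsCompactOperator (U.subtypeL : U → H) :=
    isCompactOperator_of_locallyCompactSpace_rng U.subtypeL
  exact h.comp_clm U.orthogonalProjectionOnto

/-- If compressing `A` to the orthogonal complements of finite-dimensional subspaces never brings
its norm down to `ε`, then `A` has arbitrarily many orthogonal singular-type pairs above `ε`. -/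
theorem exists_orthonormal_of_compression_norm_gt (A : H →L[ℂ] H) {ε : ℝ} (hε : 0 < ε)
    (h : ∀ (P Q : Submodule ℂ H) [FiniteDimensional ℂ P] [FiniteDimensional ℂ Q],
      ε < ‖(1 - Q.starProjection) ∘L A ∘L (1 - P.starProjection)‖) (N : ℕ) :
    ∃ e f : Fin N → H, Orthonormal ℂ e ∧ Orthonormal ℂ f ∧
      ∀ k, ε ≤ ‖inner ℂ (f k) (A (e k))‖ := by
  induction N with
  | zero => exact ⟨Fin.elim0, Fin.elim0, ⟨fun k => k.elim0, fun k => k.elim0⟩,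
      ⟨fun k => k.elim0, fun k => k.elim0⟩, fun k => k.elim0⟩
  | succ N ih =>
    obtain ⟨e, f, he, hf, hef⟩ := ih
    let P := Submodule.span ℂ (Set.range e)
    let Q := Submodule.span ℂ (Set.range f)
    have : FiniteDimensional ℂ P := FiniteDimensional.span_of_finite ℂ (Set.finite_range e)
    have : FiniteDimensional ℂ Q := FiniteDimensional.span_of_finite ℂ (Set.finite_range f)
    -- Compress off the spans of the pairs already found. From x one gets x' ⊥ P and y ⊥ Q with ⟨y,
    -- A x'⟩ = ‖y‖², so the normalized pair has entry ‖y‖/‖x'‖ ≥ ε.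
    obtain ⟨x, hx⟩ : ∃ x, ε * ‖x‖ <
        ‖((1 - Q.starProjection) ∘L A ∘L (1 - P.starProjection)) x‖ := by
      by_contra! hcon
      exact absurd (h P Q) (not_lt.2 (ContinuousLinearMap.opNorm_le_bound _ hε.le hcon))
    set x' := x - P.starProjection x with hx'
    set y := A x' - Q.starProjection (A x') with hy
    have hxy : ε * ‖x‖ < ‖y‖ := hx
    have hxo : x' ∈ Pᗮ := P.sub_starProjection_mem_orthogonal x
    have hyo : y ∈ Qᗮ := Q.sub_starProjection_mem_orthogonal (A x')
    have hx'x : ‖x'‖ ≤ ‖x‖ := by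
      have := P.starProjection_orthogonal' ▸ (Pᗮ.norm_starProjection_apply_le x)
      simpa [hx'] using this
    have hy0 : 0 < ‖y‖ := lt_of_le_of_lt (by positivity) hxy
    have hx0 : 0 < ‖x'‖ := by
      rw [norm_pos_iff]
      intro h0
      simp [hy, h0] at hy0
    have hyA : inner ℂ y (A x') = (‖y‖ : ℂ) ^ 2 := by
      have : A x' = y + Q.starProjection (A x') := by simp [hy]
      rw [this, inner_add_right, inner_self_eq_norm_sq_to_K,
        Submodule.inner_left_of_mem_orthogonal (Q.starProjection_apply_mem _) hyo, add_zero]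
      rfl
    refine ⟨Matrix.vecCons ((‖x'‖ : ℂ)⁻¹ • x') e, Matrix.vecCons ((‖y‖ : ℂ)⁻¹ • y) f,
      orthonormal_vecCons_iff.2 ⟨?_, fun i => ?_, he⟩,
      orthonormal_vecCons_iff.2 ⟨?_, fun i => ?_, hf⟩, fun k => ?_⟩
    · simp [norm_smul, hx0.ne']
    · rw [inner_smul_left, Submodule.inner_left_of_mem_orthogonal
        (Submodule.subset_span (Set.mem_range_self i)) hxo, mul_zero]
    · simp [norm_smul, hy0.ne']
    · rw [inner_smul_left, Submodule.inner_left_of_mem_orthogonal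
        (Submodule.subset_span (Set.mem_range_self i)) hyo, mul_zero]
    · refine Fin.cases ?_ (fun k => ?_) k
      · simp only [Matrix.cons_val_zero, map_smul, inner_smul_left, inner_smul_right, hyA]
        simp only [norm_mul, map_inv₀, norm_inv, norm_pow, Complex.conj_ofReal,
          Complex.norm_real, norm_norm]
        have : ε * ‖x'‖ ≤ ‖y‖ := (mul_le_mul_of_nonneg_left hx'x hε.le).trans hxy.le
        rw [show ‖x'‖⁻¹ * (‖y‖⁻¹ * ‖y‖ ^ 2) = ‖y‖ / ‖x'‖ by field_simp]
        rwa [le_div_iff₀ hx0]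
      · simpa using hef k

variable [CompleteSpace H]

/-- Boundedness of all the sums `∑ |⟨f_k, A e_k⟩|^r` over orthonormal systems. -/
def OrthonormalSumBound (r Q : ℝ) (A : H →L[ℂ] H) : Prop :=
  ∀ (N : ℕ) (e f : Fin N → H), Orthonormal ℂ e → Orthonormal ℂ f →
    ∑ k, ‖inner ℂ (f k) (A (e k))‖ ^ r ≤ Q ^ r

/-- If every compression had norm above ε, arbitrarily many pairs with entries at least ε would
exist, contradicting the bound on the sums. Hence some compression has norm at most ε. It differs
from A by a compact operator, and the compact operators are norm closed. -/
theorem OrthonormalSumBound.isCompactOperator {r Q : ℝ} {A : H →L[ℂ] H} (hr : 0 < r)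
    (hA : OrthonormalSumBound r Q A) : IsCompactOperator A := by
  have key : ∀ ε : ℝ, 0 < ε → ∃ B : H →L[ℂ] H, IsCompactOperator B ∧ ‖A - B‖ ≤ ε := by
    intro ε hε
    by_cases h : ∀ (P Q : Submodule ℂ H) [FiniteDimensional ℂ P] [FiniteDimensional ℂ Q],
      ε < ‖(1 - Q.starProjection) ∘L A ∘L (1 - P.starProjection)‖
    · exfalso
      have hp : 0 < ε ^ r := Real.rpow_pos_of_pos hε r
      obtain ⟨N, hN⟩ := exists_nat_gt (Q ^ r / ε ^ r)
      obtain ⟨e, f, he, hf, hef⟩ := exists_orthonormal_of_compression_norm_gt A hε h N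
      have h1 := hA N e f he hf
      have h2 : (N : ℝ) * ε ^ r ≤ ∑ k, ‖inner ℂ (f k) (A (e k))‖ ^ r := by
        calc (N : ℝ) * ε ^ r = ∑ _k : Fin N, ε ^ r := by simp
          _ ≤ _ := Finset.sum_le_sum fun k _ => Real.rpow_le_rpow hε.le (hef k) hr.le
      rw [div_lt_iff₀ hp] at hN
      linarith
    · push Not at h
      obtain ⟨P, Q, hP, hQ, h⟩ := h
      refine ⟨A - (1 - Q.starProjection) ∘L A ∘L (1 - P.starProjection), ?_, by simpa using h⟩
      have hPc := isCompactOperator_starProjection P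
      have hQc := isCompactOperator_starProjection Q
      have h1 : IsCompactOperator (Q.starProjection ∘L A : H →L[ℂ] H) := hQc.comp_clm A
      have h2 : IsCompactOperator (A ∘L P.starProjection : H →L[ℂ] H) := hPc.clm_comp A
      have h3 : IsCompactOperator (Q.starProjection ∘L (A ∘L P.starProjection) : H →L[ℂ] H) :=
        hQc.comp_clm _
      have h4 : A - (1 - Q.starProjection) ∘L A ∘L (1 - P.starProjection) =
          Q.starProjection ∘L A + A ∘L P.starProjection -
            Q.starProjection ∘L (A ∘L P.starProjection) := by
        ext x
        simp
        abel
      rw [h4]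
      exact (h1.add h2).sub h3
  have hmem : A ∈ closure {B : H →L[ℂ] H | IsCompactOperator B} := by
    rw [Metric.mem_closure_iff]
    intro ε hε
    obtain ⟨B, hB, hAB⟩ := key (ε / 2) (half_pos hε)
    exact ⟨B, hB, by rw [dist_eq_norm]; linarith⟩
  have hcl : IsClosed {B : H →L[ℂ] H | IsCompactOperator B} := isClosed_setOfPred_isCompactOperator
  rw [hcl.closure_eq] at hmem
  exact hmem

/-- From |A|² = A*A. Consequently A maps orthonormal eigenvectors of |A| to orthogonal vectors of
length |σ|. -/
theorem inner_map_of_mem_eigenspace_abs (A : H →L[ℂ] H) {σ : ℝ} {x : H} (y : H)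
    (hx : x ∈ Module.End.eigenspace ((CFC.abs A : H →L[ℂ] H) : H →ₗ[ℂ] H) (σ : ℂ)) :
    inner ℂ (A y) (A x) = (σ : ℂ) ^ 2 * inner ℂ y x := by
  have hx' : CFC.abs A x = (σ : ℂ) • x := Module.End.mem_eigenspace_iff.1 hx
  have h : (star A * A) x = (σ : ℂ) ^ 2 • x := by
    rw [← CFC.abs_mul_abs, mul_apply_eq_comp, hx', map_smul, hx', smul_smul, sq]
  rw [← inner_smul_right, ← h, mul_apply_eq_comp, ContinuousLinearMap.star_eq_adjoint,
    ContinuousLinearMap.adjoint_inner_right]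

/-- Take orthonormal bases e_p of finitely many eigenspaces of |A| with σ > 0, and f_p = σ⁻¹ A e_p.
Both systems are orthonormal and ⟨f_p, A e_p⟩ = σ, so the sum tested is exactly a partial sum of the
Schatten series. -/
theorem OrthonormalSumBound.schattenSum_le {r Q : ℝ} {A : H →L[ℂ] H}
    (hA : OrthonormalSumBound r Q A) : schattenSum r A ≤ ENNReal.ofReal (Q ^ r) := by
  rw [schattenSum, ENNReal.tsum_eq_iSup_sum]
  refine iSup_le fun F => ?_
  let T : H →ₗ[ℂ] H := ((CFC.abs A : H →L[ℂ] H) : H →ₗ[ℂ] H)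
  have hT : T.IsSymmetric :=
    ContinuousLinearMap.isSelfAdjoint_iff_isSymmetric.1 (CFC.abs_nonneg A).isSelfAdjoint
  let V : ℂ → Submodule ℂ H := fun μ => Module.End.eigenspace T μ
  have hb : ∀ σ : Set.Ioi (0 : ℝ),
      ∃ b : Fin (Module.finrank ℂ (V (σ : ℝ))) → V ((σ : ℝ) : ℂ), Orthonormal ℂ b := by
    intro σ
    -- An infinite-dimensional eigenspace has `finrank` zero and contributes nothing to the sum, so
    -- the empty family serves.
    by_cases h : FiniteDimensional ℂ (V ((σ : ℝ) : ℂ))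
    · exact ⟨stdOrthonormalBasis ℂ _, (stdOrthonormalBasis ℂ _).orthonormal⟩
    · have h0 : Module.finrank ℂ (V (σ : ℝ)) = 0 := Module.finrank_of_not_finite h
      rw [h0]
      exact ⟨Fin.elim0, ⟨fun k => k.elim0, fun k => k.elim0⟩⟩
  choose b hb using hb
  let ι := Σ σ : F, Fin (Module.finrank ℂ (V ((σ : Set.Ioi (0 : ℝ)) : ℝ)))
  let e : ι → H := fun p => b p.1 p.2
  have heV : ∀ p : ι, e p ∈ V ((p.1 : Set.Ioi (0 : ℝ)) : ℝ) := fun p => (b p.1 p.2).2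
  have he : Orthonormal ℂ e := by
    have hF := hT.orthogonalFamily_eigenspaces.comp
      (γ := F) (f := fun σ => (((σ : Set.Ioi (0 : ℝ)) : ℝ) : ℂ))
      (fun s t h => Subtype.ext (Subtype.ext (Complex.ofReal_injective h)))
    exact hF.orthonormal_sigma_orthonormal (fun σ => hb σ)
  let f : ι → H := fun p => ((((p.1 : Set.Ioi (0 : ℝ)) : ℝ) : ℂ)⁻¹) • A (e p)
  have hpos : ∀ p : ι, 0 < ((p.1 : Set.Ioi (0 : ℝ)) : ℝ) := fun p => (p.1 : Set.Ioi (0 : ℝ)).2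
  have hpos' : ∀ p : ι, (((p.1 : Set.Ioi (0 : ℝ)) : ℝ) : ℂ) ≠ 0 := fun p => by
    exact_mod_cast (hpos p).ne'
  have hf : Orthonormal ℂ f := by
    classical
    rw [orthonormal_iff_ite] at he ⊢
    intro p q
    simp only [f]
    rw [inner_smul_left, inner_smul_right, inner_map_of_mem_eigenspace_abs A (e p) (heV q), he p q]
    split_ifs with h
    · subst h
      rw [map_inv₀, Complex.conj_ofReal]
      field_simp [hpos' p]
    · simp
  have hAe : ∀ p, ‖inner ℂ (f p) (A (e p))‖ = ((p.1 : Set.Ioi (0 : ℝ)) : ℝ) := by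
    intro p
    have h1 : ‖e p‖ = 1 := he.1 p
    simp only [f]
    rw [inner_smul_left, inner_map_of_mem_eigenspace_abs A (e p) (heV p),
      inner_self_eq_norm_sq_to_K, h1]
    rw [map_inv₀, Complex.conj_ofReal]
    simp only [RCLike.ofReal_one, one_pow, mul_one, norm_mul, norm_inv, norm_pow,
      Complex.norm_real, Real.norm_eq_abs, abs_of_pos (hpos p)]
    field_simp [(hpos p).ne']
  have hsum := hA (Fintype.card ι) (e ∘ (Fintype.equivFin ι).symm) (f ∘ (Fintype.equivFin ι).symm)
    (he.comp _ (Equiv.injective _)) (hf.comp _ (Equiv.injective _))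
  have h2 : ∑ k, ‖inner ℂ ((f ∘ (Fintype.equivFin ι).symm) k)
      (A ((e ∘ (Fintype.equivFin ι).symm) k))‖ ^ r =
      ∑ p : ι, ((p.1 : Set.Ioi (0 : ℝ)) : ℝ) ^ r := by
    rw [← Equiv.sum_comp (Fintype.equivFin ι).symm]
    exact Finset.sum_congr rfl fun k _ => by rw [← hAe]; rfl
  rw [h2] at hsum
  refine le_trans (le_of_eq ?_) (ENNReal.ofReal_le_ofReal hsum)
  rw [ENNReal.ofReal_sum_of_nonneg fun p _ => Real.rpow_nonneg (hpos p).le _,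
    Fintype.sum_sigma, ← Finset.sum_coe_sort F]
  refine Finset.sum_congr rfl fun σ _ => ?_
  simp [V, T]

theorem OrthonormalSumBound.isSchatten {r Q : ℝ} {A : H →L[ℂ] H} (hr : 0 < r)
    (hA : OrthonormalSumBound r Q A) : IsSchatten r A :=
  ⟨hA.isCompactOperator hr, hA.schattenSum_le.trans_lt ENNReal.ofReal_lt_top⟩

theorem OrthonormalSumBound.schattenNorm_le {r Q : ℝ} {A : H →L[ℂ] H} (hr : 0 < r) (hQ : 0 ≤ Q)
    (hA : OrthonormalSumBound r Q A) : schattenNorm r A ≤ ENNReal.ofReal Q := by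
  refine (ENNReal.rpow_le_rpow hA.schattenSum_le (by positivity)).trans (le_of_eq ?_)
  rw [← ENNReal.ofReal_rpow_of_nonneg hQ hr.le, ← ENNReal.rpow_mul,
    mul_one_div_cancel hr.ne', ENNReal.rpow_one]

end SchattenCriterion

/-! ### Hermite functions: orthonormality, Gaussian decay, multiplication by coordinates. -/

section HermiteFunctions

/-- The physicists' Hermite polynomials. -/
def hermiteP : ℕ → Polynomial ℝ
  | 0 => 1
  | k + 1 => 2 * Polynomial.X * hermiteP k - Polynomial.derivative (hermiteP k)

theorem hasDerivAt_polynomial_mul_gaussian (p : Polynomial ℝ) (x : ℝ) :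
    HasDerivAt (fun u => p.eval u * Real.exp (-u ^ 2))
      ((Polynomial.derivative p - 2 * Polynomial.X * p).eval x * Real.exp (-x ^ 2)) x := by
  have h1 := p.hasDerivAt x
  have h2 : HasDerivAt (fun u : ℝ => Real.exp (-u ^ 2)) (Real.exp (-x ^ 2) * (-(2 * x))) x := by
    have := ((hasDerivAt_pow 2 x).neg).exp
    simpa using this
  refine (h1.mul h2).congr_deriv ?_
  simp
  ring

theorem iteratedDeriv_gaussian (k : ℕ) :
    iteratedDeriv k (fun u : ℝ => Real.exp (-u ^ 2)) =
      fun x => (-1) ^ k * ((hermiteP k).eval x * Real.exp (-x ^ 2)) := by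
  induction k with
  | zero => ext x; simp [hermiteP]
  | succ k ih =>
    ext x
    rw [iteratedDeriv_succ, ih]
    rw [((hasDerivAt_polynomial_mul_gaussian (hermiteP k) x).const_mul _).deriv]
    simp [hermiteP]
    ring

theorem hermitePoly_eq_eval (k : ℕ) (x : ℝ) : hermitePoly k x = (hermiteP k).eval x := by
  rw [hermitePoly, iteratedDeriv_gaussian]
  have h1 : ((-1 : ℝ)) ^ k * (-1) ^ k = 1 := by rw [← mul_pow]; simp
  have h2 : Real.exp (-x ^ 2) * Real.exp (x ^ 2) = 1 := by rw [← Real.exp_add]; simp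
  linear_combination (hermiteP k).eval x * Real.exp (-x ^ 2) * Real.exp (x ^ 2) * h1 +
    (hermiteP k).eval x * h2

theorem derivative_hermiteP_succ (k : ℕ) :
    Polynomial.derivative (hermiteP (k + 1)) = 2 * (k + 1 : Polynomial ℝ) * hermiteP k := by
  induction k with
  | zero => simp [hermiteP]
  | succ k ih =>
    rw [hermiteP, Polynomial.derivative_sub, Polynomial.derivative_mul, ih]
    have h : Polynomial.derivative (2 * (k + 1 : Polynomial ℝ) * hermiteP k) =
        2 * (k + 1 : Polynomial ℝ) * Polynomial.derivative (hermiteP k) := by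
      rw [Polynomial.derivative_mul]
      simp
    rw [h]
    have h2 : hermiteP (k + 1) = 2 * Polynomial.X * hermiteP k -
      Polynomial.derivative (hermiteP k) := rfl
    have h3 : Polynomial.derivative (2 * Polynomial.X : Polynomial ℝ) = 2 := by simp
    rw [h3]
    push_cast
    linear_combination (-2 * (k + 1 : Polynomial ℝ)) * h2

theorem abs_polynomial_eval_le (p : Polynomial ℝ) {δ : ℝ} (hδ : 0 < δ) :
    ∃ C : ℝ, ∀ x : ℝ, |p.eval x| ≤ C * Real.exp (δ * x ^ 2) := by
  induction p using Polynomial.induction_on' with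
  | add p q hp hq =>
    obtain ⟨C, hC⟩ := hp
    obtain ⟨D, hD⟩ := hq
    refine ⟨C + D, fun x => ?_⟩
    rw [Polynomial.eval_add, add_mul]
    exact (abs_add_le _ _).trans (add_le_add (hC x) (hD x))
  | monomial n a =>
    refine ⟨|a| * (1 + n.factorial / δ ^ n), fun x => ?_⟩
    have h1 := Real.pow_div_factorial_le_exp (δ * x ^ 2) (by positivity) n
    have h2 : (1 : ℝ) ≤ Real.exp (δ * x ^ 2) := Real.one_le_exp (by positivity)
    have h3 : |x| ^ n ≤ 1 + (x ^ 2) ^ n := by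
      rw [← sq_abs, ← pow_mul, mul_comm 2 n, pow_mul]
      nlinarith [sq_nonneg (|x| ^ n - 1)]
    have h4 : (x ^ 2) ^ n ≤ n.factorial / δ ^ n * Real.exp (δ * x ^ 2) := by
      rw [mul_pow, div_le_iff₀ (by positivity)] at h1
      rw [div_mul_eq_mul_div, le_div_iff₀ (by positivity)]
      linarith
    rw [Polynomial.eval_monomial, abs_mul, abs_pow, mul_assoc]
    refine mul_le_mul_of_nonneg_left ?_ (abs_nonneg a)
    linarith

theorem integrable_polynomial_mul_gaussian (p : Polynomial ℝ) :
    Integrable (fun x : ℝ => p.eval x * Real.exp (-x ^ 2)) := by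
  obtain ⟨C, hC⟩ := abs_polynomial_eval_le p (show (0 : ℝ) < 1 / 2 by norm_num)
  refine ((integrable_exp_neg_mul_sq (show (0 : ℝ) < 1 / 2 by norm_num)).const_mul C).mono'
    (by fun_prop) (ae_of_all _ fun x => ?_)
  rw [Real.norm_eq_abs, abs_mul, Real.abs_exp]
  refine (mul_le_mul_of_nonneg_right (hC x) (Real.exp_pos _).le).trans (le_of_eq ?_)
  rw [mul_assoc, ← Real.exp_add]
  ring_nf

/-- Integration by parts: (p H_k e^{-x²})' = (p' H_k - p H_{k+1}) e^{-x²}. -/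
theorem integral_polynomial_mul_hermiteP_succ (p : Polynomial ℝ) (k : ℕ) :
    ∫ x : ℝ, (p * hermiteP (k + 1)).eval x * Real.exp (-x ^ 2) =
      ∫ x : ℝ, (Polynomial.derivative p * hermiteP k).eval x * Real.exp (-x ^ 2) := by
  have h := integral_eq_zero_of_hasDerivAt_of_integrable
    (hasDerivAt_polynomial_mul_gaussian (p * hermiteP k))
    (integrable_polynomial_mul_gaussian _) (integrable_polynomial_mul_gaussian _)
  have h2 : Polynomial.derivative (p * hermiteP k) - 2 * Polynomial.X * (p * hermiteP k) =
      Polynomial.derivative p * hermiteP k - p * hermiteP (k + 1) := by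
    rw [Polynomial.derivative_mul, hermiteP]
    ring
  simp only [h2, Polynomial.eval_sub, sub_mul] at h
  rw [integral_sub (integrable_polynomial_mul_gaussian _)
    (integrable_polynomial_mul_gaussian _)] at h
  linarith

theorem integral_hermiteP_mul (j k : ℕ) :
    ∫ x : ℝ, (hermiteP j * hermiteP k).eval x * Real.exp (-x ^ 2) =
      if j = k then 2 ^ k * Real.sqrt Real.pi * (k.factorial : ℝ) else 0 := by
  induction k generalizing j with
  | zero =>
    cases j with
    | zero =>
      have := integral_gaussian 1
      simpa [hermiteP] using this
    | succ j =>
      rw [mul_comm, integral_polynomial_mul_hermiteP_succ]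
      simp [hermiteP]
  | succ k ih =>
    rw [integral_polynomial_mul_hermiteP_succ]
    cases j with
    | zero => simp [hermiteP]
    | succ j =>
      have h : ∀ x : ℝ, (Polynomial.derivative (hermiteP (j + 1)) * hermiteP k).eval x *
          Real.exp (-x ^ 2) = 2 * (j + 1 : ℝ) *
            ((hermiteP j * hermiteP k).eval x * Real.exp (-x ^ 2)) := by
        intro x
        rw [derivative_hermiteP_succ]
        simp
        ring
      simp only [h, integral_const_mul, ih, add_left_inj]
      split_ifs with hjk
      · subst hjk
        rw [Nat.factorial_succ]
        push_cast
        ring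
      · simp

theorem hermiteFun_eq (k : ℕ) (x : ℝ) : hermiteFun k x =
    (Real.sqrt (2 ^ k * Real.sqrt Real.pi * (k.factorial : ℝ)))⁻¹ *
      (hermiteP k).eval x * Real.exp (-x ^ 2 / 2) := by
  rw [hermiteFun, hermitePoly_eq_eval]

theorem hermiteFun_norm_const_pos (k : ℕ) :
    0 < Real.sqrt (2 ^ k * Real.sqrt Real.pi * (k.factorial : ℝ)) := by
  have := Real.pi_pos
  positivity

theorem continuous_hermiteFun (k : ℕ) : Continuous (hermiteFun k) := by
  have : hermiteFun k = _ := funext (hermiteFun_eq k)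
  rw [this]
  fun_prop

theorem integral_hermiteFun_mul (j k : ℕ) :
    ∫ x : ℝ, hermiteFun j x * hermiteFun k x = if j = k then 1 else 0 := by
  have h : ∀ x, hermiteFun j x * hermiteFun k x =
      (Real.sqrt (2 ^ j * Real.sqrt Real.pi * (j.factorial : ℝ)))⁻¹ *
      (Real.sqrt (2 ^ k * Real.sqrt Real.pi * (k.factorial : ℝ)))⁻¹ *
      ((hermiteP j * hermiteP k).eval x * Real.exp (-x ^ 2)) := by
    intro x
    rw [hermiteFun_eq, hermiteFun_eq, Polynomial.eval_mul,
      show Real.exp (-x ^ 2) = Real.exp (-x ^ 2 / 2) * Real.exp (-x ^ 2 / 2) by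
        rw [← Real.exp_add]; ring_nf]
    ring
  simp only [h, integral_const_mul, integral_hermiteP_mul]
  split_ifs with hjk
  · subst hjk
    have h0 := hermiteFun_norm_const_pos j
    rw [← mul_inv, Real.mul_self_sqrt (by positivity), inv_mul_cancel₀]
    exact (Real.sqrt_pos.1 h0).ne'
  · simp

/-- The polynomial factor costs 1/8 of the exponent 1/2. What matters later is that 3/8 still
exceeds the exponent 1/4 of the weight. -/
theorem abs_hermiteFun_le (k : ℕ) :
    ∃ C : ℝ, 0 ≤ C ∧ ∀ x, |hermiteFun k x| ≤ C * Real.exp (-(3 / 8) * x ^ 2) := by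
  obtain ⟨C, hC⟩ := abs_polynomial_eval_le (hermiteP k) (show (0 : ℝ) < 1 / 8 by norm_num)
  have h0 := hermiteFun_norm_const_pos k
  have hC0 : 0 ≤ C := by simpa using (abs_nonneg _).trans (hC 0)
  refine ⟨(Real.sqrt (2 ^ k * Real.sqrt Real.pi * (k.factorial : ℝ)))⁻¹ * C, by positivity,
    fun x => ?_⟩
  rw [hermiteFun_eq, abs_mul, abs_mul, Real.abs_exp, abs_of_pos (inv_pos.2 h0),
    mul_assoc _ |_|, mul_assoc _ C]
  refine mul_le_mul_of_nonneg_left ?_ (inv_pos.2 h0).le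
  refine (mul_le_mul_of_nonneg_right (hC x) (Real.exp_pos _).le).trans (le_of_eq ?_)
  rw [mul_assoc, ← Real.exp_add]
  ring_nf

/-- The three-term recurrence H_{k+1} = 2x H_k - 2k H_{k-1}, renormalized. For k = 0 the truncated
index k - 1 is harmless because b = 0. -/
theorem exists_mul_hermiteFun_eq (k : ℕ) :
    ∃ a b : ℝ, ∀ x, x * hermiteFun k x = a * hermiteFun (k + 1) x + b * hermiteFun (k - 1) x := by
  have hc := hermiteFun_norm_const_pos
  cases k with
  | zero =>
    refine ⟨(Real.sqrt (2 ^ 0 * Real.sqrt Real.pi * (Nat.factorial 0 : ℝ)))⁻¹ *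
      Real.sqrt (2 ^ 1 * Real.sqrt Real.pi * (Nat.factorial 1 : ℝ)) / 2, 0, fun x => ?_⟩
    have h1 := (hc 1).ne'
    rw [hermiteFun_eq, hermiteFun_eq]
    simp only [hermiteP, zero_add]
    field_simp
    simp [mul_comm]
  | succ k =>
    refine ⟨(Real.sqrt (2 ^ (k + 1) * Real.sqrt Real.pi * (Nat.factorial (k + 1) : ℝ)))⁻¹ *
      Real.sqrt (2 ^ (k + 2) * Real.sqrt Real.pi * (Nat.factorial (k + 2) : ℝ)) / 2,
      (Real.sqrt (2 ^ (k + 1) * Real.sqrt Real.pi * (Nat.factorial (k + 1) : ℝ)))⁻¹ *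
      Real.sqrt (2 ^ k * Real.sqrt Real.pi * (Nat.factorial k : ℝ)) * (k + 1), fun x => ?_⟩
    have h2 := (hc (k + 2)).ne'
    have h0 := (hc k).ne'
    have h1 := (hc (k + 1)).ne'
    rw [hermiteFun_eq, hermiteFun_eq, Nat.add_sub_cancel, hermiteFun_eq]
    have hr : (hermiteP (k + 2)).eval x = 2 * x * (hermiteP (k + 1)).eval x -
        2 * (k + 1) * (hermiteP k).eval x := by
      rw [hermiteP, derivative_hermiteP_succ]
      simp
    rw [hr]
    field_simp
    ring

variable {n : ℕ}

theorem continuous_Phi (μ : Fin n → ℕ) : Continuous (Phi μ) := by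
  unfold Phi
  exact continuous_finsetProd _ fun j _ => (continuous_hermiteFun _).comp (by fun_prop)

theorem abs_Phi_le (μ : Fin n → ℕ) :
    ∃ C : ℝ, 0 ≤ C ∧ ∀ x, |Phi μ x| ≤ C * Real.exp (-(3 / 8) * ‖x‖ ^ 2) := by
  choose C hC0 hC using fun j => abs_hermiteFun_le (μ j)
  refine ⟨∏ j, C j, Finset.prod_nonneg fun j _ => hC0 j, fun x => ?_⟩
  rw [Phi, Finset.abs_prod, EuclideanSpace.real_norm_sq_eq, Finset.mul_sum, Real.exp_sum,
    ← Finset.prod_mul_distrib]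
  exact Finset.prod_le_prod (fun j _ => abs_nonneg _) fun j _ => hC j _

theorem integral_Phi_mul (μ μ' : Fin n → ℕ) :
    ∫ x, Phi μ x * Phi μ' x = if μ = μ' then 1 else 0 := by
  have h1 : ∫ x : Fin n → ℝ, ∏ j, (hermiteFun (μ j) (x j) * hermiteFun (μ' j) (x j)) =
      if μ = μ' then 1 else 0 := by
    rw [volume_pi, integral_fintype_prod_eq_prod
      (fun j (y : ℝ) => hermiteFun (μ j) y * hermiteFun (μ' j) y)]
    simp only [integral_hermiteFun_mul]
    split_ifs with h
    · simp [h]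
    · obtain ⟨j, hj⟩ := Function.ne_iff.1 h
      exact Finset.prod_eq_zero (Finset.mem_univ j) (by simp [hj])
  rw [← h1, ← (EuclideanSpace.volume_preserving_symm_measurableEquiv_toLp (Fin n)).integral_comp
    (MeasurableEquiv.measurableEmbedding _)]
  refine integral_congr_ae (ae_of_all _ fun x => ?_)
  simp [Phi, Finset.prod_mul_distrib]

theorem coord_mul_Phi_mem_span (μ : Fin n → ℕ) (j : Fin n) :
    (fun x : EuclideanSpace ℝ (Fin n) => x j * Phi μ x) ∈
      Submodule.span ℝ (Set.range (Phi (n := n))) := by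
  obtain ⟨a, b, hab⟩ := exists_mul_hermiteFun_eq (μ j)
  have hsplit : ∀ (ν : Fin n → ℕ) (x : EuclideanSpace ℝ (Fin n)), (∀ i ≠ j, ν i = μ i) →
      Phi ν x = hermiteFun (ν j) (x j) * ∏ i ∈ Finset.univ.erase j, hermiteFun (μ i) (x i) := by
    intro ν x h
    rw [Phi, ← Finset.mul_prod_erase _ _ (Finset.mem_univ j)]
    congr 1
    exact Finset.prod_congr rfl fun i hi => by rw [h i (Finset.ne_of_mem_erase hi)]
  have h : (fun x : EuclideanSpace ℝ (Fin n) => x j * Phi μ x) =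
      a • Phi (Function.update μ j (μ j + 1)) + b • Phi (Function.update μ j (μ j - 1)) := by
    ext x
    simp only [Pi.add_apply, Pi.smul_apply, smul_eq_mul]
    rw [hsplit μ x fun _ _ => rfl, hsplit _ x fun i hi => Function.update_of_ne hi _ _,
      hsplit _ x fun i hi => Function.update_of_ne hi _ _]
    simp only [Function.update_self]
    rw [← mul_assoc, hab]
    ring
  rw [h]
  exact add_mem (Submodule.smul_mem _ _ (Submodule.subset_span ⟨_, rfl⟩))
    (Submodule.smul_mem _ _ (Submodule.subset_span ⟨_, rfl⟩))

theorem coord_mul_mem_span_Phi {φ : EuclideanSpace ℝ (Fin n) → ℝ}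
    (hφ : φ ∈ Submodule.span ℝ (Set.range (Phi (n := n)))) (j : Fin n) :
    (fun x => x j * φ x) ∈ Submodule.span ℝ (Set.range (Phi (n := n))) := by
  induction hφ using Submodule.span_induction with
  | mem φ h => obtain ⟨μ, rfl⟩ := h; exact coord_mul_Phi_mem_span μ j
  | zero => simp [← Pi.zero_def]
  | add φ χ _ _ h1 h2 =>
    convert add_mem h1 h2 using 1
    ext x
    simp [mul_add]
  | smul a φ _ h =>
    convert Submodule.smul_mem _ a h using 1
    ext x
    simp
    ring

/-- The ground state is a multiple of the Gaussian, and the span is stable under multiplication by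
⟨ξ, x⟩ = ∑ ξ_j x_j. These functions are the terms, up to constants, of the power series of
e^{i⟨ξ,x⟩} times a Gaussian. -/
theorem inner_pow_mul_gaussian_mem_span_Phi (ξ : EuclideanSpace ℝ (Fin n)) (k : ℕ) :
    (fun x : EuclideanSpace ℝ (Fin n) => inner ℝ ξ x ^ k * Real.exp (-(1 / 2) * ‖x‖ ^ 2)) ∈
      Submodule.span ℝ (Set.range (Phi (n := n))) := by
  induction k with
  | zero =>
    let c := Real.sqrt (2 ^ 0 * Real.sqrt Real.pi * (Nat.factorial 0 : ℝ))
    have hc : 0 < c := hermiteFun_norm_const_pos 0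
    have h : (fun x : EuclideanSpace ℝ (Fin n) =>
        inner ℝ ξ x ^ 0 * Real.exp (-(1 / 2) * ‖x‖ ^ 2)) = c ^ n • Phi (fun _ => 0) := by
      ext x
      have h2 : ∀ i : Fin n, hermiteFun 0 (x i) = c⁻¹ * Real.exp (-(1 / 2) * x i ^ 2) := by
        intro i
        rw [hermiteFun_eq]
        simp only [hermiteP, Polynomial.eval_one, mul_one]
        congr 2
        ring
      simp only [Pi.smul_apply, Phi, h2, Finset.prod_mul_distrib, smul_eq_mul]
      rw [EuclideanSpace.real_norm_sq_eq, Finset.mul_sum, Real.exp_sum]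
      simp only [Finset.prod_const, Finset.card_univ, Fintype.card_fin, pow_zero, one_mul]
      rw [← mul_assoc, ← mul_pow, mul_inv_cancel₀ hc.ne', one_pow, one_mul]
    rw [h]
    exact Submodule.smul_mem _ _ (Submodule.subset_span ⟨_, rfl⟩)
  | succ k ih =>
    have h : (fun x : EuclideanSpace ℝ (Fin n) =>
        inner ℝ ξ x ^ (k + 1) * Real.exp (-(1 / 2) * ‖x‖ ^ 2)) =
        ∑ j, ξ j • fun x : EuclideanSpace ℝ (Fin n) =>
          x j * (inner ℝ ξ x ^ k * Real.exp (-(1 / 2) * ‖x‖ ^ 2)) := by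
      ext x
      have h3 : inner ℝ ξ x = ∑ j, ξ j * x j := by
        simp [PiLp.inner_apply, mul_comm]
      simp only [Finset.sum_apply, Pi.smul_apply, smul_eq_mul, ← mul_assoc]
      rw [← Finset.sum_mul, ← Finset.sum_mul, ← h3]
      ring
    rw [h]
    exact Submodule.sum_mem _ fun j _ => Submodule.smul_mem _ _ (coord_mul_mem_span_Phi ih j)

end HermiteFunctions

/-! ### An integrable function on 𝕋 × ℝⁿ is determined by its integrals against characters. -/

section Completeness

/-- The positive and negative parts of g are densities of finite measures with equal integrals over
a separating star algebra. Such measures coincide, so g⁺ = g⁻ almost everywhere. -/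
theorem ae_eq_zero_of_integral_mul_eq_zero_real {X : Type*} [MeasurableSpace X]
    [PseudoEMetricSpace X] [BorelSpace X] [CompleteSpace X] [SecondCountableTopology X]
    {μ : Measure X} {A : StarSubalgebra ℂ (BoundedContinuousFunction X ℂ)}
    (hA : (A.map (BoundedContinuousFunction.toContinuousMapStarₐ ℂ)).SeparatesPoints)
    {g : X → ℝ} (hg : Integrable g μ) (h : ∀ φ ∈ A, ∫ x, φ x * (g x : ℂ) ∂μ = 0) :
    g =ᵐ[μ] 0 := by
  have hfin : ∀ f : X → ℝ, Integrable f μ →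
      IsFiniteMeasure (μ.withDensity fun x => ENNReal.ofReal (f x)) :=
    fun f hf => isFiniteMeasure_withDensity_ofReal hf.2
  have h1 := hfin g hg
  have hneg : Integrable (fun x => -g x) μ := hg.neg
  have hmneg : AEMeasurable (fun x => -g x) μ := hg.1.aemeasurable.neg
  have h2 := hfin (fun x => -g x) hneg
  have hint : ∀ (f : X → ℝ), Integrable f μ → ∀ φ : BoundedContinuousFunction X ℂ,
      ∫ x, φ x ∂(μ.withDensity fun x => ENNReal.ofReal (f x)) =
        ∫ x, (max (f x) 0) • φ x ∂μ := by
    intro f hf φ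
    rw [integral_withDensity_eq_integral_toReal_smul₀ hf.1.aemeasurable.ennreal_ofReal
      (ae_of_all _ fun _ => ENNReal.ofReal_lt_top)]
    simp only [ENNReal.toReal_ofReal']
  have hint2 : ∀ (f : X → ℝ), Integrable f μ → ∀ φ : BoundedContinuousFunction X ℂ,
      Integrable (fun x => (max (f x) 0) • φ x) μ := by
    intro f hf φ
    refine (hf.pos_part).smul_bdd ‖φ‖ φ.continuous.aestronglyMeasurable
      (ae_of_all _ fun x => φ.norm_coe_le_norm x)
  have heq : (μ.withDensity fun x => ENNReal.ofReal (g x)) =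
      μ.withDensity fun x => ENNReal.ofReal (-g x) := by
    refine ext_of_forall_mem_subalgebra_integral_eq_of_pseudoEMetric_complete_countable hA ?_
    intro φ hφ
    rw [hint g hg, hint _ hneg, ← sub_eq_zero, ← integral_sub (hint2 g hg φ)
      (hint2 _ hneg φ), ← h φ hφ]
    refine integral_congr_ae (ae_of_all _ fun x => ?_)
    simp only [← sub_smul]
    have : max (g x) 0 - max (-g x) 0 = g x := by
      rcases le_total (g x) 0 with h0 | h0
      · simp [h0]
      · simp [h0]
    rw [this, Complex.real_smul, mul_comm]
  rw [withDensity_eq_iff hg.1.aemeasurable.ennreal_ofReal hmneg.ennreal_ofReal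
    (by
      have := h1.measure_univ_lt_top
      rw [withDensity_apply _ MeasurableSet.univ, Measure.restrict_univ] at this
      exact this.ne)] at heq
  filter_upwards [heq] with x hx
  rcases le_total (g x) 0 with h0 | h0
  · rw [ENNReal.ofReal_of_nonpos h0, eq_comm, ENNReal.ofReal_eq_zero] at hx
    exact le_antisymm h0 (neg_nonpos.1 hx)
  · rw [ENNReal.ofReal_of_nonpos (show -g x ≤ 0 by linarith), ENNReal.ofReal_eq_zero] at hx
    exact le_antisymm hx h0

/-- An integrable function that annihilates a separating star algebra of bounded continuous
functions vanishes. -/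
theorem ae_eq_zero_of_integral_mul_eq_zero {X : Type*} [MeasurableSpace X]
    [PseudoEMetricSpace X] [BorelSpace X] [CompleteSpace X] [SecondCountableTopology X]
    {μ : Measure X} {A : StarSubalgebra ℂ (BoundedContinuousFunction X ℂ)}
    (hA : (A.map (BoundedContinuousFunction.toContinuousMapStarₐ ℂ)).SeparatesPoints)
    {G : X → ℂ} (hG : Integrable G μ) (h : ∀ φ ∈ A, ∫ x, φ x * G x ∂μ = 0) :
    G =ᵐ[μ] 0 := by
  have hint : ∀ φ : BoundedContinuousFunction X ℂ, Integrable (fun x => φ x * G x) μ :=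
    fun φ => hG.bdd_mul φ.continuous.aestronglyMeasurable
      (ae_of_all _ fun x => φ.norm_coe_le_norm x)
  -- As the algebra is closed under conjugation, it annihilates conj G as well, hence the real and
  -- imaginary parts of G.
  have h' : ∀ φ ∈ A, ∫ x, φ x * (starRingEnd ℂ) (G x) ∂μ = 0 := by
    intro φ hφ
    have := congrArg (starRingEnd ℂ) (h (star φ) (star_mem hφ))
    rw [← integral_conj, map_zero] at this
    rw [← this]
    refine integral_congr_ae (ae_of_all _ fun x => ?_)
    simp
  have hint' : ∀ φ : BoundedContinuousFunction X ℂ,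
      Integrable (fun x => φ x * (starRingEnd ℂ) (G x)) μ :=
    fun φ => (Complex.conjCLE.toContinuousLinearMap.integrable_comp hG).bdd_mul
      φ.continuous.aestronglyMeasurable (ae_of_all _ fun x => φ.norm_coe_le_norm x)
  have hre := ae_eq_zero_of_integral_mul_eq_zero_real hA hG.re (fun φ hφ => by
    have h3 : ∀ x, φ x * ((G x).re : ℂ) =
        2⁻¹ * (φ x * G x + φ x * (starRingEnd ℂ) (G x)) := fun x => by
      rw [← mul_add, Complex.add_conj]
      push_cast
      ring
    simp only [RCLike.re_to_complex, h3]
    rw [integral_const_mul, integral_add (hint φ) (hint' φ), h φ hφ, h' φ hφ]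
    simp)
  have him := ae_eq_zero_of_integral_mul_eq_zero_real hA hG.im (fun φ hφ => by
    have h3 : ∀ x, φ x * ((G x).im : ℂ) =
        (2 * Complex.I)⁻¹ * (φ x * G x - φ x * (starRingEnd ℂ) (G x)) := fun x => by
      rw [← mul_sub, Complex.sub_conj]
      field_simp
      push_cast
      ring
    simp only [RCLike.im_to_complex, h3]
    rw [integral_const_mul, integral_sub (hint φ) (hint' φ), h φ hφ, h' φ hφ]
    simp)
  filter_upwards [hre, him] with x h1 h2
  exact Complex.ext h1 h2

variable {n : ℕ}

theorem norm_fourier_apply (m : ℤ) (t : Torus) : ‖fourier m t‖ = 1 := by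
  rw [fourier_apply]
  exact Circle.norm_coe _

/-- The character `(t, x) ↦ e^{i ⟨ξ, x⟩} e^{iνt}` of `𝕋 × ℝⁿ`. -/
def character (ξ : EuclideanSpace ℝ (Fin n)) (ν : ℤ) :
    BoundedContinuousFunction (TX n) ℂ :=
  BoundedContinuousFunction.ofNormedAddCommGroup
    (fun q => Complex.exp ((inner ℝ ξ q.2 : ℝ) * Complex.I) * fourier ν q.1)
    (by
      have : Continuous fun q : TX n => fourier ν q.1 := (fourier ν).continuous.comp continuous_fst
      fun_prop) 1
    (fun q => by rw [norm_mul, Complex.norm_exp_ofReal_mul_I, norm_fourier_apply, one_mul])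

theorem character_apply (ξ : EuclideanSpace ℝ (Fin n)) (ν : ℤ) (q : TX n) :
    character ξ ν q = Complex.exp ((inner ℝ ξ q.2 : ℝ) * Complex.I) * fourier ν q.1 := rfl

theorem character_mul (ξ ξ' : EuclideanSpace ℝ (Fin n)) (ν ν' : ℤ) :
    character ξ ν * character ξ' ν' = character (ξ + ξ') (ν + ν') := by
  ext q
  simp only [BoundedContinuousFunction.mul_apply, character_apply, inner_add_left, fourier_add,
    Complex.ofReal_add, add_mul, Complex.exp_add]
  ring

theorem star_character (ξ : EuclideanSpace ℝ (Fin n)) (ν : ℤ) :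
    star (character ξ ν) = character (-ξ) (-ν) := by
  ext q
  simp only [BoundedContinuousFunction.star_apply, character_apply, inner_neg_left, fourier_neg,
    Complex.ofReal_neg, neg_mul, star_mul', RCLike.star_def, ← Complex.exp_conj, map_mul,
    Complex.conj_ofReal, Complex.conj_I, mul_neg]

/-- The trigonometric polynomials on `𝕋 × ℝⁿ`. -/
def trigPoly (n : ℕ) : StarSubalgebra ℂ (BoundedContinuousFunction (TX n) ℂ) where
  toSubalgebra := Algebra.adjoin ℂ
    (Set.range fun p : EuclideanSpace ℝ (Fin n) × ℤ => character p.1 p.2)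
  star_mem' := by
    intro φ hφ
    induction hφ using Algebra.adjoin_induction with
    | mem φ h =>
      obtain ⟨p, rfl⟩ := h
      exact Algebra.subset_adjoin ⟨(-p.1, -p.2), (star_character _ _).symm⟩
    | algebraMap r => rw [← algebraMap_star_comm]; exact Subalgebra.algebraMap_mem _ _
    | add φ χ _ _ h1 h2 => rw [star_add]; exact Subalgebra.add_mem _ h1 h2
    | mul φ χ _ _ h1 h2 => rw [star_mul']; exact Subalgebra.mul_mem _ h1 h2

theorem character_mem_trigPoly (ξ : EuclideanSpace ℝ (Fin n)) (ν : ℤ) :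
    character ξ ν ∈ trigPoly n := Algebra.subset_adjoin ⟨(ξ, ν), rfl⟩

theorem trigPoly_le_span {φ : BoundedContinuousFunction (TX n) ℂ} (hφ : φ ∈ trigPoly n) :
    φ ∈ Submodule.span ℂ
      (Set.range fun p : EuclideanSpace ℝ (Fin n) × ℤ => character p.1 p.2) := by
  have h : φ ∈ Subalgebra.toSubmodule (Algebra.adjoin ℂ
    (Set.range fun p : EuclideanSpace ℝ (Fin n) × ℤ => character p.1 p.2)) := hφ
  rw [Algebra.adjoin_eq_span] at h
  have hcl : (Submonoid.closure
      (Set.range fun p : EuclideanSpace ℝ (Fin n) × ℤ => character p.1 p.2) :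
        Set (BoundedContinuousFunction (TX n) ℂ)) ⊆
      Set.range fun p : EuclideanSpace ℝ (Fin n) × ℤ => character p.1 p.2 := by
    intro χ hχ
    induction hχ using Submonoid.closure_induction with
    | mem χ h => exact h
    | one => exact ⟨0, by ext q; simp [character_apply]⟩
    | mul χ χ' _ _ h1 h2 =>
      obtain ⟨p, rfl⟩ := h1
      obtain ⟨p', rfl⟩ := h2
      exact ⟨p + p', (character_mul _ _ _ _).symm⟩
  exact Submodule.span_mono hcl h

theorem separatesPoints_trigPoly (n : ℕ) :
    ((trigPoly n).map (BoundedContinuousFunction.toContinuousMapStarₐ ℂ)).SeparatesPoints := by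
  intro q q' hq
  have hmem : ∀ (ξ : EuclideanSpace ℝ (Fin n)) (ν : ℤ), (character ξ ν : TX n → ℂ) ∈
      (fun f : C(TX n, ℂ) => (f : TX n → ℂ)) ''
        ((trigPoly n).map (BoundedContinuousFunction.toContinuousMapStarₐ ℂ) :
          Set C(TX n, ℂ)) :=
    fun ξ ν => ⟨_, ⟨character ξ ν, character_mem_trigPoly ξ ν, rfl⟩, rfl⟩
  by_cases h1 : q.1 = q'.1
  · have h2 : q.2 - q'.2 ≠ 0 := fun h => hq (Prod.ext h1 (sub_eq_zero.1 h))
    -- The frequency is scaled to have inner product π with the difference of the points, so the two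
    -- values differ by the factor -1.
    refine ⟨_, hmem ((Real.pi / ‖q.2 - q'.2‖ ^ 2) • (q.2 - q'.2)) 0, fun h => ?_⟩
    simp only [character_apply, fourier_zero, mul_one] at h
    have h3 : Complex.exp (((inner ℝ ((Real.pi / ‖q.2 - q'.2‖ ^ 2) • (q.2 - q'.2))
        (q.2 - q'.2) : ℝ) : ℂ) * Complex.I) = 1 := by
      rw [inner_sub_right, Complex.ofReal_sub, sub_mul, Complex.exp_sub, h,
        div_self (Complex.exp_ne_zero _)]
    rw [inner_smul_left, real_inner_self_eq_norm_sq] at h3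
    have h4 : ‖q.2 - q'.2‖ ^ 2 ≠ 0 := by simpa using h2
    rw [conj_trivial, div_mul_cancel₀ _ h4, Complex.exp_pi_mul_I] at h3
    norm_num at h3
  · refine ⟨_, hmem 0 1, fun h => h1 ?_⟩
    simp only [character_apply, inner_zero_left, Complex.ofReal_zero, zero_mul, Complex.exp_zero,
      one_mul, fourier_one] at h
    exact AddCircle.injective_toCircle Real.two_pi_pos.ne' (Subtype.ext h)

theorem ae_eq_zero_of_integral_character_mul_eq_zero {G : TX n → ℂ} (hG : Integrable G)
    (h : ∀ ξ ν, ∫ q, character ξ ν q * G q = 0) : G =ᵐ[volume] 0 := by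
  refine ae_eq_zero_of_integral_mul_eq_zero (separatesPoints_trigPoly n) hG fun φ hφ => ?_
  have hint : ∀ φ : BoundedContinuousFunction (TX n) ℂ, Integrable (fun x => φ x * G x) :=
    fun φ => hG.bdd_mul φ.continuous.aestronglyMeasurable
      (ae_of_all _ fun x => φ.norm_coe_le_norm x)
  have hspan := trigPoly_le_span hφ
  clear hφ
  induction hspan using Submodule.span_induction with
  | mem φ h' => obtain ⟨p, rfl⟩ := h'; exact h p.1 p.2
  | zero => simp
  | add φ χ _ _ h1 h2 =>
    simp only [BoundedContinuousFunction.add_apply, add_mul]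
    rw [integral_add (hint φ) (hint χ), h1, h2, add_zero]
  | smul a φ _ h1 =>
    simp only [BoundedContinuousFunction.smul_apply, smul_eq_mul, mul_assoc]
    rw [integral_const_mul, h1, mul_zero]

end Completeness

/-! ### The modes Φ_μ(x) e^{-iνt} and totality of their weighted versions. -/

section Modes

variable {n : ℕ}

theorem integrable_gaussian_TX {a : ℝ} (ha : 0 < a) :
    Integrable (fun q : TX n => Real.exp (-a * ‖q.2‖ ^ 2)) := by
  have h := GaussianFourier.integrable_cexp_neg_mul_sq_norm_add (b := (a : ℂ))
    (V := EuclideanSpace ℝ (Fin n)) (by simpa using ha) 0 0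
  have h2 : Integrable (fun x : EuclideanSpace ℝ (Fin n) => Real.exp (-a * ‖x‖ ^ 2)) := by
    refine h.norm.congr (ae_of_all _ fun x => ?_)
    simp only [zero_mul, add_zero, Complex.norm_exp]
    norm_cast
  exact h2.comp_snd (volume : Measure Torus)

theorem integrable_of_gaussian_bound {f : TX n → ℂ} (hf : AEStronglyMeasurable f volume)
    {a C : ℝ} (ha : 0 < a) (h : ∀ q, ‖f q‖ ≤ C * Real.exp (-a * ‖q.2‖ ^ 2)) : Integrable f :=
  ((integrable_gaussian_TX ha).const_mul C).mono' hf (ae_of_all _ h)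

theorem memLp_two_of_gaussian_bound {f : TX n → ℂ} (hf : AEStronglyMeasurable f volume)
    {a C : ℝ} (ha : 0 < a) (h : ∀ q, ‖f q‖ ≤ C * Real.exp (-a * ‖q.2‖ ^ 2)) :
    MemLp f 2 volume := by
  rw [memLp_two_iff_integrable_sq_norm hf]
  refine ((integrable_gaussian_TX (show 0 < 2 * a by linarith)).const_mul (C ^ 2)).mono'
    (hf.norm.pow 2) (ae_of_all _ fun q => ?_)
  rw [Real.norm_of_nonneg (by positivity)]
  refine (pow_le_pow_left₀ (norm_nonneg _) (h q) 2).trans (le_of_eq ?_)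
  rw [mul_pow, ← Real.exp_nat_mul]
  ring_nf

theorem continuous_mode (s : (Fin n → ℕ) × ℤ) : Continuous (mode s) := by
  have h1 : Continuous fun q : TX n => Phi s.1 q.2 := (continuous_Phi s.1).comp continuous_snd
  have h2 : Continuous fun q : TX n => fourier (-s.2) q.1 :=
    (fourier (-s.2)).continuous.comp continuous_fst
  unfold mode
  fun_prop

theorem norm_mode_le (s : (Fin n → ℕ) × ℤ) :
    ∃ C : ℝ, 0 ≤ C ∧ ∀ q, ‖mode s q‖ ≤ C * Real.exp (-(3 / 8) * ‖q.2‖ ^ 2) := by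
  obtain ⟨C, hC0, hC⟩ := abs_Phi_le s.1
  refine ⟨C, hC0, fun q => ?_⟩
  rw [mode, norm_mul, norm_fourier_apply, mul_one, Complex.norm_real]
  exact hC q.2

theorem memLp_mode (s : (Fin n → ℕ) × ℤ) : MemLp (mode s) 2 volume := by
  obtain ⟨C, -, hC⟩ := norm_mode_le s
  exact memLp_two_of_gaussian_bound (continuous_mode s).aestronglyMeasurable (by norm_num) hC

/-- The function `Φ_μ(x) e^{-iνt}` as an element of `L²(𝕋 × ℝⁿ)`. -/
def modeL2 (s : (Fin n → ℕ) × ℤ) : L2TX n := (memLp_mode s).toLp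

theorem coeFn_modeL2 (s : (Fin n → ℕ) × ℤ) : modeL2 s =ᵐ[volume] mode s :=
  (memLp_mode s).coeFn_toLp

theorem integral_fourier_torus (k : ℤ) :
    ∫ t : Torus, fourier k t = if k = 0 then (2 * Real.pi : ℂ) else 0 := by
  have h : ∫ t : Torus, fourier k t ∂AddCircle.haarAddCircle = if k = 0 then 1 else 0 := by
    have := congrFun (fourierCoeff_fourier (T := 2 * Real.pi) k) 0
    rw [fourierCoeff] at this
    simpa [Pi.single_apply, eq_comm] using this
  rw [AddCircle.volume_eq_smul_haarAddCircle, integral_smul_measure, h,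
    ENNReal.toReal_ofReal Real.two_pi_pos.le]
  split_ifs <;> simp

theorem inner_modeL2 (s s' : (Fin n → ℕ) × ℤ) :
    inner ℂ (modeL2 s) (modeL2 s') = if s = s' then (2 * Real.pi : ℂ) else 0 := by
  rw [L2.inner_def]
  have h1 : ∫ q, inner ℂ ((modeL2 s : TX n → ℂ) q) ((modeL2 s' : TX n → ℂ) q) =
      ∫ q : TX n, fourier (s.2 - s'.2) q.1 * ((Phi s.1 q.2 * Phi s'.1 q.2 : ℝ) : ℂ) := by
    refine integral_congr_ae ?_
    filter_upwards [coeFn_modeL2 s, coeFn_modeL2 s'] with q h1 h2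
    rw [h1, h2, mode, mode, RCLike.inner_apply, map_mul, ← fourier_neg, neg_neg, Complex.conj_ofReal,
      sub_eq_add_neg, fourier_add]
    push_cast
    ring
  rw [h1, Measure.volume_eq_prod, integral_prod_mul (fun t : Torus => fourier (s.2 - s'.2) t)
    (fun x : EuclideanSpace ℝ (Fin n) => ((Phi s.1 x * Phi s'.1 x : ℝ) : ℂ)),
    integral_fourier_torus, integral_complex_ofReal, integral_Phi_mul]
  by_cases h2 : s.2 = s'.2
  · by_cases h3 : s.1 = s'.1
    · simp [h2, h3, Prod.ext_iff]
    · simp [h2, h3, Prod.ext_iff]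
  · simp [h2, Prod.ext_iff, sub_eq_zero]

/-- The weight `e^{|x|²/4}`. -/
def weight (q : TX n) : ℝ := Real.exp (4⁻¹ * ‖q.2‖ ^ 2)

theorem weight_pos (q : TX n) : 0 < weight q := Real.exp_pos _

theorem continuous_weight : Continuous (weight : TX n → ℝ) := by
  unfold weight
  fun_prop

theorem weight_inv_eq (q : TX n) : (weight q)⁻¹ = Real.exp (-4⁻¹ * ‖q.2‖ ^ 2) := by
  rw [weight, ← Real.exp_neg, neg_mul]

theorem continuous_weight_inv : Continuous fun q : TX n => (weight q)⁻¹ :=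
  continuous_weight.inv₀ fun q => (weight_pos q).ne'

theorem weight_inv_le_one (q : TX n) : (weight q)⁻¹ ≤ 1 := by
  rw [weight_inv_eq, Real.exp_le_one_iff]
  have := sq_nonneg ‖q.2‖
  linarith

theorem norm_weight_mul_mode_le (s : (Fin n → ℕ) × ℤ) :
    ∃ C : ℝ, 0 ≤ C ∧
      ∀ q, ‖(weight q : ℂ) * mode s q‖ ≤ C * Real.exp (-(1 / 8) * ‖q.2‖ ^ 2) := by
  obtain ⟨C, hC0, hC⟩ := norm_mode_le s
  refine ⟨C, hC0, fun q => ?_⟩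
  rw [norm_mul, Complex.norm_real, Real.norm_of_nonneg (weight_pos q).le]
  refine (mul_le_mul_of_nonneg_left (hC q) (weight_pos q).le).trans (le_of_eq ?_)
  rw [weight, mul_left_comm, ← Real.exp_add]
  ring_nf

theorem memLp_weight_mul_mode (s : (Fin n → ℕ) × ℤ) :
    MemLp (fun q => (weight q : ℂ) * mode s q) 2 volume := by
  obtain ⟨C, -, hC⟩ := norm_weight_mul_mode_le s
  have := (Complex.continuous_ofReal.comp continuous_weight).mul (continuous_mode s)
  exact memLp_two_of_gaussian_bound this.aestronglyMeasurable (by norm_num) hC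

/-- The weighted mode `e^{|x|²/4} Φ_μ(x) e^{-iνt}`. -/
def weightedMode (s : (Fin n → ℕ) × ℤ) : L2TX n := (memLp_weight_mul_mode s).toLp

theorem coeFn_weightedMode (s : (Fin n → ℕ) × ℤ) :
    weightedMode s =ᵐ[volume] fun q => (weight q : ℂ) * mode s q :=
  (memLp_weight_mul_mode s).coeFn_toLp

theorem exists_gaussian_bound_of_mem_span_Phi {φ : EuclideanSpace ℝ (Fin n) → ℝ}
    (hφ : φ ∈ Submodule.span ℝ (Set.range (Phi (n := n)))) :
    Continuous φ ∧ ∃ C : ℝ, ∀ x, |φ x| ≤ C * Real.exp (-(3 / 8) * ‖x‖ ^ 2) := by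
  induction hφ using Submodule.span_induction with
  | mem φ h =>
    obtain ⟨μ, rfl⟩ := h
    obtain ⟨C, -, hC⟩ := abs_Phi_le μ
    exact ⟨continuous_Phi μ, C, hC⟩
  | zero => exact ⟨continuous_const, 0, fun x => by simp⟩
  | add φ χ _ _ h1 h2 =>
    obtain ⟨hc1, C, hC⟩ := h1
    obtain ⟨hc2, D, hD⟩ := h2
    refine ⟨hc1.add hc2, C + D, fun x => ?_⟩
    rw [add_mul]
    exact (abs_add_le _ _).trans (add_le_add (hC x) (hD x))
  | smul a φ _ h1 =>
    obtain ⟨hc1, C, hC⟩ := h1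
    refine ⟨hc1.const_smul a, |a| * C, fun x => ?_⟩
    rw [Pi.smul_apply, smul_eq_mul, abs_mul, mul_assoc]
    exact mul_le_mul_of_nonneg_left (hC x) (abs_nonneg a)

theorem integrable_weight_mul_span {φ : EuclideanSpace ℝ (Fin n) → ℝ}
    (hφ : φ ∈ Submodule.span ℝ (Set.range (Phi (n := n)))) (ν : ℤ) (g : L2TX n) :
    Integrable fun q : TX n => (weight q : ℂ) * φ q.2 * fourier ν q.1 * g q := by
  obtain ⟨hc, C, hC⟩ := exists_gaussian_bound_of_mem_span_Phi hφ
  have h1 : Continuous fun q : TX n => (weight q : ℂ) * φ q.2 * fourier ν q.1 := by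
    have h2 : Continuous fun q : TX n => fourier ν q.1 :=
      (fourier ν).continuous.comp continuous_fst
    have h3 : Continuous fun q : TX n => (weight q : ℂ) :=
      Complex.continuous_ofReal.comp continuous_weight
    have h4 : Continuous fun q : TX n => φ q.2 := hc.comp continuous_snd
    fun_prop
  have h2 : MemLp (fun q : TX n => (weight q : ℂ) * φ q.2 * fourier ν q.1) 2 volume := by
    refine memLp_two_of_gaussian_bound (a := 1 / 8) (C := C) h1.aestronglyMeasurable (by norm_num)
      fun q => ?_
    rw [norm_mul, norm_mul, norm_fourier_apply, mul_one, Complex.norm_real, Complex.norm_real,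
      Real.norm_of_nonneg (weight_pos q).le]
    refine (mul_le_mul_of_nonneg_left (hC q.2) (weight_pos q).le).trans (le_of_eq ?_)
    rw [weight, mul_left_comm, ← Real.exp_add]
    ring_nf
  exact h2.integrable_mul (Lp.memLp g)

theorem integral_weight_mul_span_eq_zero {g : L2TX n}
    (hg : ∀ s, inner ℂ (weightedMode s) g = 0) {φ : EuclideanSpace ℝ (Fin n) → ℝ}
    (hφ : φ ∈ Submodule.span ℝ (Set.range (Phi (n := n)))) (ν : ℤ) :
    ∫ q : TX n, (weight q : ℂ) * φ q.2 * fourier ν q.1 * g q = 0 := by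
  induction hφ using Submodule.span_induction with
  | mem φ h =>
    obtain ⟨μ, rfl⟩ := h
    rw [← hg (μ, ν), L2.inner_def]
    refine integral_congr_ae ?_
    filter_upwards [coeFn_weightedMode (μ, ν)] with q h1
    rw [h1, mode, RCLike.inner_apply, map_mul, map_mul, ← fourier_neg, neg_neg,
      Complex.conj_ofReal, Complex.conj_ofReal]
    ring
  | zero => simp
  | add φ χ hφ hχ h1 h2 =>
    simp only [Pi.add_apply, Complex.ofReal_add, mul_add, add_mul]
    rw [integral_add (integrable_weight_mul_span hφ ν g) (integrable_weight_mul_span hχ ν g),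
      h1, h2, add_zero]
  | smul a φ _ h1 =>
    have h2 : ∀ q : TX n, (weight q : ℂ) * ((a • φ) q.2 : ℝ) * fourier ν q.1 * g q =
        a * ((weight q : ℂ) * φ q.2 * fourier ν q.1 * g q) := fun q => by
      simp
      ring
    simp only [h2, integral_const_mul, h1, mul_zero]

/-- The function g/w is integrable, where w is the weight. Expanding e^{i⟨ξ,x⟩} in its power series,
each term of its integral against a character is the integral of g against w times an element of the
span of the Φ_μ, hence zero. So all these integrals vanish. -/
theorem eq_zero_of_inner_weightedMode_eq_zero {g : L2TX n}
    (hg : ∀ s, inner ℂ (weightedMode s) g = 0) : g = 0 := by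
  let G : TX n → ℂ := fun q => ((weight q)⁻¹ : ℝ) * g q
  have hgm : AEStronglyMeasurable g volume := Lp.aestronglyMeasurable g
  have hwm : AEStronglyMeasurable (fun q : TX n => (((weight q)⁻¹ : ℝ) : ℂ)) volume :=
    (Complex.continuous_ofReal.comp continuous_weight_inv).aestronglyMeasurable
  have hGm : AEStronglyMeasurable G volume := hwm.mul hgm
  have hgauss : ∀ a : ℝ, 0 < a →
      Integrable fun q : TX n => Real.exp (-a * ‖q.2‖ ^ 2) * ‖g q‖ := by
    intro a ha
    have h1 : MemLp (fun q : TX n => ((Real.exp (-a * ‖q.2‖ ^ 2) : ℝ) : ℂ)) 2 volume := by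
      refine memLp_two_of_gaussian_bound (a := a) (C := 1)
        (Continuous.aestronglyMeasurable (by fun_prop)) ha fun q => ?_
      rw [Complex.norm_real, Real.norm_of_nonneg (Real.exp_pos _).le, one_mul]
    refine (h1.integrable_mul (Lp.memLp g)).norm.congr (ae_of_all _ fun q => ?_)
    simp only [Pi.mul_apply, norm_mul, Complex.norm_real, Real.norm_eq_abs, Real.abs_exp]
  have hG : Integrable G := by
    refine (hgauss 4⁻¹ (by norm_num)).mono' hGm (ae_of_all _ fun q => le_of_eq ?_)
    simp only [G, norm_mul, Complex.norm_real, weight_inv_eq, Real.norm_eq_abs, Real.abs_exp]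
  have hG0 : G =ᵐ[volume] 0 := by
    refine ae_eq_zero_of_integral_character_mul_eq_zero hG fun ξ ν => ?_
    let F : ℕ → TX n → ℂ := fun k q =>
      (k.factorial : ℂ)⁻¹ * ((inner ℝ ξ q.2 : ℝ) * Complex.I) ^ k * fourier ν q.1 * G q
    have hF0 : ∀ k, ∫ q, F k q = 0 := by
      intro k
      have h1 := integral_weight_mul_span_eq_zero hg (inner_pow_mul_gaussian_mem_span_Phi ξ k) ν
      have h2 : ∀ q, F k q = ((k.factorial : ℂ)⁻¹ * Complex.I ^ k) *
          ((weight q : ℂ) * ((inner ℝ ξ q.2 ^ k * Real.exp (-(1 / 2) * ‖q.2‖ ^ 2) : ℝ) : ℂ) *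
            fourier ν q.1 * g q) := by
        intro q
        -- The exponent 1/4 is half of that of the Hermite Gaussian, so dividing by the weight is
        -- multiplying by the weight and by this Gaussian.
        have h3 : (weight q)⁻¹ = weight q * Real.exp (-(1 / 2) * ‖q.2‖ ^ 2) := by
          rw [weight_inv_eq, weight, ← Real.exp_add]
          ring_nf
        simp only [F, G]
        rw [h3]
        push_cast
        ring
      simp only [h2, integral_const_mul, h1, mul_zero]
    have hsum := hasSum_integral_of_dominated_convergence (F := F) (μ := volume)
      (f := fun q => character ξ ν q * G q)
      (fun k q => |inner ℝ ξ q.2| ^ k / k.factorial * (Real.exp (-4⁻¹ * ‖q.2‖ ^ 2) * ‖g q‖))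
      (fun k => ?_) (fun k => ae_of_all _ fun q => le_of_eq ?_) (ae_of_all _ fun q => ?_) ?_
      (ae_of_all _ fun q => ?_)
    · simp only [hF0] at hsum
      exact hsum.unique hasSum_zero
    · refine AEStronglyMeasurable.mul (Continuous.aestronglyMeasurable ?_) hGm
      have h2 : Continuous fun q : TX n => fourier ν q.1 :=
        (fourier ν).continuous.comp continuous_fst
      fun_prop
    · simp only [F, G, norm_mul, norm_fourier_apply, norm_pow, Complex.norm_I, mul_one, norm_inv,
        Complex.norm_real, Real.norm_eq_abs, Complex.norm_natCast, weight_inv_eq, Real.abs_exp]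
      ring
    · exact (Real.summable_pow_div_factorial _).mul_right _
    · have h1 : ∀ q : TX n, ∑' k : ℕ, |inner ℝ ξ q.2| ^ k / k.factorial *
          (Real.exp (-4⁻¹ * ‖q.2‖ ^ 2) * ‖g q‖) =
          Real.exp |inner ℝ ξ q.2| * (Real.exp (-4⁻¹ * ‖q.2‖ ^ 2) * ‖g q‖) := by
        intro q
        rw [tsum_mul_right, Real.exp_eq_exp_ℝ, NormedSpace.exp_eq_tsum_div]
      simp only [h1]
      -- From ‖ξ‖‖x‖ ≤ 2‖ξ‖² + ‖x‖²/8, that is (‖x‖ - 4‖ξ‖)² ≥ 0: half of the Gaussian decay pays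
      -- for the exponential.
      refine ((hgauss 8⁻¹ (by norm_num)).const_mul (Real.exp (2 * ‖ξ‖ ^ 2))).mono' ?_
        (ae_of_all _ fun q => ?_)
      · exact AEStronglyMeasurable.mul (Continuous.aestronglyMeasurable (by fun_prop))
          (AEStronglyMeasurable.mul (Continuous.aestronglyMeasurable (by fun_prop)) hgm.norm)
      · rw [Real.norm_of_nonneg (by positivity), ← mul_assoc, ← mul_assoc, ← Real.exp_add,
          ← Real.exp_add]
        refine mul_le_mul_of_nonneg_right (Real.exp_le_exp.2 ?_) (norm_nonneg _)
        have h2 := abs_real_inner_le_norm ξ q.2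
        nlinarith [sq_nonneg (‖q.2‖ - 4 * ‖ξ‖)]
    · have h1 := (NormedSpace.expSeries_div_hasSum_exp
        ((inner ℝ ξ q.2 : ℝ) * Complex.I)).mul_right (fourier ν q.1 * G q)
      rw [← Complex.exp_eq_exp_ℂ] at h1
      rw [character_apply, mul_assoc]
      have h2 : (fun k => F k q) = fun k : ℕ => ((inner ℝ ξ q.2 : ℝ) * Complex.I) ^ k /
          (k.factorial : ℂ) * (fourier ν q.1 * G q) := by
        ext k
        simp only [F]
        ring
      rw [h2]
      exact h1
  rw [Lp.eq_zero_iff_ae_eq_zero]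
  filter_upwards [hG0] with q hq
  have h1 : (((weight q)⁻¹ : ℝ) : ℂ) ≠ 0 := by exact_mod_cast (inv_pos.2 (weight_pos q)).ne'
  exact (mul_eq_zero.1 hq).resolve_left h1

theorem dense_span_weightedMode :
    (Submodule.span ℂ (Set.range (weightedMode (n := n)))).topologicalClosure = ⊤ := by
  rw [Submodule.topologicalClosure_eq_top_iff, Submodule.eq_bot_iff]
  intro g hg
  exact eq_zero_of_inner_weightedMode_eq_zero fun s =>
    (Submodule.mem_orthogonal _ _).1 hg _ (Submodule.subset_span ⟨s, rfl⟩)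

end Modes

/-! ### Bounded holomorphic functions on the strip and extension of holomorphic forms. -/

section StripFunctions

open Filter Topology

/-- Bounded functions on the closed strip `-lam ≤ Re z ≤ 0`, continuous there and holomorphic in
the interior. -/
def StripBounded (lam : ℝ) (f : ℂ → ℂ) : Prop :=
  DiffContOnCl ℂ f (Complex.re ⁻¹' Set.Ioo (-lam) 0) ∧
    ∃ C : ℝ, ∀ z : ℂ, -lam ≤ z.re → z.re ≤ 0 → ‖f z‖ ≤ C

variable {lam : ℝ}

theorem stripBounded_const (c : ℂ) : StripBounded lam fun _ => c :=
  ⟨diffContOnCl_const, ‖c‖, fun _ _ _ => le_rfl⟩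

theorem StripBounded.add {f g : ℂ → ℂ} (hf : StripBounded lam f) (hg : StripBounded lam g) :
    StripBounded lam fun z => f z + g z := by
  obtain ⟨hf, C, hC⟩ := hf
  obtain ⟨hg, D, hD⟩ := hg
  exact ⟨hf.add hg, C + D, fun z h1 h2 =>
    (norm_add_le _ _).trans (add_le_add (hC z h1 h2) (hD z h1 h2))⟩

theorem StripBounded.mul {f g : ℂ → ℂ} (hf : StripBounded lam f) (hg : StripBounded lam g) :
    StripBounded lam fun z => f z * g z := by
  obtain ⟨hf, C, hC⟩ := hf
  obtain ⟨hg, D, hD⟩ := hg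
  refine ⟨hf.smul hg, C * D, fun z h1 h2 => ?_⟩
  rw [norm_mul]
  exact mul_le_mul (hC z h1 h2) (hD z h1 h2) (norm_nonneg _) ((norm_nonneg _).trans (hC z h1 h2))

theorem StripBounded.sub {f g : ℂ → ℂ} (hf : StripBounded lam f) (hg : StripBounded lam g) :
    StripBounded lam fun z => f z - g z := by
  convert hf.add ((stripBounded_const (-1)).mul hg) using 2
  ring

theorem StripBounded.sum {ι : Type*} (F : Finset ι) {f : ι → ℂ → ℂ}
    (hf : ∀ i ∈ F, StripBounded lam (f i)) : StripBounded lam fun z => ∑ i ∈ F, f i z := by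
  classical
  induction F using Finset.induction_on with
  | empty => simpa using stripBounded_const 0
  | insert i F hi ih =>
    simp only [Finset.sum_insert hi]
    exact (hf i (Finset.mem_insert_self i F)).add
      (ih fun j hj => hf j (Finset.mem_insert_of_mem hj))

theorem StripBounded.norm_le_of_boundary (hlam : 0 < lam) {f : ℂ → ℂ} (hf : StripBounded lam f)
    {C : ℝ} (h0 : ∀ z : ℂ, z.re = 0 → ‖f z‖ ≤ C) (h1 : ∀ z : ℂ, z.re = -lam → ‖f z‖ ≤ C) {z : ℂ}
    (hz1 : -lam ≤ z.re) (hz2 : z.re ≤ 0) : ‖f z‖ ≤ C := by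
  obtain ⟨hf, D, hD⟩ := hf
  refine PhragmenLindelof.vertical_strip hf ⟨0, ?_, 0, ?_⟩ h1 h0 hz1 hz2
  · have := Real.pi_pos
    have : 0 < 0 - -lam := by linarith
    positivity
  · refine Asymptotics.IsBigO.of_bound D ?_
    refine Filter.mem_inf_of_right ?_
    rw [Filter.mem_principal]
    intro w hw
    simpa using hD w hw.1.le hw.2.le

/-- The three lines theorem at the point `-1` of the strip. -/
theorem StripBounded.norm_neg_one_le (hlam : 1 < lam) {f : ℂ → ℂ} (hf : StripBounded lam f)
    {A₀ A₁ : ℝ} (h0 : ∀ z : ℂ, z.re = 0 → ‖f z‖ ≤ A₀) (h1 : ∀ z : ℂ, z.re = -lam → ‖f z‖ ≤ A₁) :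
    ‖f (-1)‖ ≤ A₁ ^ (1 / lam) * A₀ ^ (1 - 1 / lam) := by
  obtain ⟨hf, D, hD⟩ := hf
  have h := Complex.HadamardThreeLines.norm_le_interp_of_mem_verticalClosedStrip'
    (f := f) (z := -1) (l := -lam) (u := 0) (by linarith)
    ⟨by simp; linarith, by simp⟩ hf
    ⟨D, by rintro _ ⟨z, hz, rfl⟩; exact hD z hz.1 hz.2⟩ h1 h0
  have hl : lam ≠ 0 := by linarith
  -- The point -1 lies at the fraction 1 - 1/lam of the way from the left line to the right one, so
  -- the left bound gets the exponent 1/lam.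
  have h2 : ((-1 : ℂ).re - -lam) / (0 - -lam) = 1 - 1 / lam := by
    simp
    field_simp
    ring
  rw [h2] at h
  simpa using h

/-- By the maximum principle, closeness on the two boundary lines makes the sequence uniformly
Cauchy on the closed strip. No regularity of t is used; it only supplies common boundary values. -/
theorem StripBounded.exists_limit (hlam : 0 < lam) {f : ℕ → ℂ → ℂ}
    (hf : ∀ m, StripBounded lam (f m)) {t : ℂ → ℂ} {ε : ℕ → ℝ} (hε : Tendsto ε atTop (𝓝 0))
    (h : ∀ m (z : ℂ), z.re = -lam ∨ z.re = 0 → ‖f m z - t z‖ ≤ ε m) :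
    ∃ g, StripBounded lam g ∧
      ∀ z : ℂ, -lam ≤ z.re → z.re ≤ 0 → Tendsto (fun m => f m z) atTop (𝓝 (g z)) := by
  have hdiff : ∀ m l (z : ℂ), -lam ≤ z.re → z.re ≤ 0 → ‖f m z - f l z‖ ≤ ε m + ε l := by
    intro m l z hz1 hz2
    have hb : ∀ w : ℂ, w.re = -lam ∨ w.re = 0 → ‖f m w - f l w‖ ≤ ε m + ε l := by
      intro w hw
      have h1 : f m w - f l w = (f m w - t w) - (f l w - t w) := by ring
      rw [h1]
      exact (norm_sub_le _ _).trans (add_le_add (h m w hw) (h l w hw))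
    exact ((hf m).sub (hf l)).norm_le_of_boundary hlam (fun w hw => hb w (Or.inr hw))
      (fun w hw => hb w (Or.inl hw)) hz1 hz2
  have hcau : ∀ z : ℂ, -lam ≤ z.re → z.re ≤ 0 →
      ∃ y, Tendsto (fun m => f m z) atTop (𝓝 y) := by
    intro z hz1 hz2
    refine cauchySeq_tendsto_of_complete (Metric.cauchySeq_iff.2 fun δ hδ => ?_)
    obtain ⟨N, hN⟩ := eventually_atTop.1 (hε.eventually_lt_const (half_pos hδ))
    refine ⟨N, fun m hm l hl => ?_⟩
    rw [dist_eq_norm]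
    have := hdiff m l z hz1 hz2
    linarith [hN m hm, hN l hl]
  choose! g hg using hcau
  have hlim : ∀ m (z : ℂ), -lam ≤ z.re → z.re ≤ 0 → ‖f m z - g z‖ ≤ ε m := by
    intro m z hz1 hz2
    have h1 : Tendsto (fun l => ‖f m z - f l z‖) atTop (𝓝 ‖f m z - g z‖) :=
      (tendsto_const_nhds.sub (hg z hz1 hz2)).norm
    have h2 : Tendsto (fun l => ε m + ε l) atTop (𝓝 (ε m + 0)) := tendsto_const_nhds.add hε
    rw [add_zero] at h2
    exact le_of_tendsto_of_tendsto' h1 h2 fun l => hdiff m l z hz1 hz2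
  have hunif : ∀ s : Set ℂ, (∀ z ∈ s, -lam ≤ z.re ∧ z.re ≤ 0) →
      TendstoUniformlyOn f g atTop s := by
    intro s hs
    rw [Metric.tendstoUniformlyOn_iff]
    intro δ hδ
    filter_upwards [hε.eventually_lt_const hδ] with m hm z hz
    rw [dist_comm, dist_eq_norm]
    exact (hlim m z (hs z hz).1 (hs z hz).2).trans_lt hm
  refine ⟨g, ⟨⟨?_, ?_⟩, ?_⟩, hg⟩
  · exact (hunif _ fun z hz => ⟨hz.1.le, hz.2.le⟩).tendstoLocallyUniformlyOn.differentiableOn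
      (Eventually.of_forall fun m => (hf m).1.differentiableOn)
      (isOpen_Ioo.preimage Complex.continuous_re)
  · refine (hunif _ fun z hz => ?_).continuousOn
      (Eventually.of_forall fun m => (hf m).1.continuousOn).frequently
    rw [Complex.closure_preimage_re, closure_Ioo (by linarith)] at hz
    exact hz
  · obtain ⟨-, C, hC⟩ := hf 0
    refine ⟨C + ε 0, fun z hz1 hz2 => ?_⟩
    have h1 : g z = f 0 z - (f 0 z - g z) := by ring
    rw [h1]
    exact (norm_sub_le _ _).trans (add_le_add (hC z hz1 hz2) (hlim 0 z hz1 hz2))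

/-- Sesquilinear forms given on the boundary lines and at `-1`, whose values on a total family
extend to bounded holomorphic functions on the strip, have such extensions on all vectors. -/
theorem exists_stripBounded_extension {H ι : Type*} [NormedAddCommGroup H] [NormedSpace ℂ H]
    (hlam : 1 < lam) {ψ : ι → H}
    (hψ : (Submodule.span ℂ (Set.range ψ)).topologicalClosure = ⊤)
    {D : Set ℂ} (hD : ∀ z : ℂ, z.re = -lam ∨ z.re = 0 → z ∈ D)
    (hD' : ∀ z ∈ D, -lam ≤ z.re ∧ z.re ≤ 0)
    (b : ℂ → H →ₗ⋆[ℂ] H →ₗ[ℂ] ℂ) {M : ℝ}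
    (hb : ∀ z ∈ D, ∀ v u, ‖b z v u‖ ≤ M * ‖v‖ * ‖u‖)
    {q : ι → ι → ℂ → ℂ} (hq : ∀ i j, StripBounded lam (q i j))
    (hbq : ∀ z ∈ D, ∀ i j, b z (ψ i) (ψ j) = q i j z) (v u : H) :
    ∃ f, StripBounded lam f ∧ ∀ z ∈ D, f z = b z v u := by
  have hgen : ∀ v ∈ Submodule.span ℂ (Set.range ψ), ∀ u ∈ Submodule.span ℂ (Set.range ψ),
      ∃ f, StripBounded lam f ∧ ∀ z ∈ D, f z = b z v u := by
    intro v hv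
    induction hv using Submodule.span_induction with
    | mem v hv =>
      obtain ⟨i, rfl⟩ := hv
      intro u hu
      induction hu using Submodule.span_induction with
      | mem u hu =>
        obtain ⟨j, rfl⟩ := hu
        exact ⟨q i j, hq i j, fun z hz => (hbq z hz i j).symm⟩
      | zero => exact ⟨_, stripBounded_const 0, fun z _ => by simp⟩
      | add u u' _ _ h1 h2 =>
        obtain ⟨f, hf, hf'⟩ := h1
        obtain ⟨g, hg, hg'⟩ := h2
        exact ⟨_, hf.add hg, fun z hz => by simp [hf' z hz, hg' z hz]⟩
      | smul a u _ h1 =>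
        obtain ⟨f, hf, hf'⟩ := h1
        exact ⟨_, (stripBounded_const a).mul hf, fun z hz => by simp [hf' z hz]⟩
    | zero => exact fun u _ => ⟨_, stripBounded_const 0, fun z _ => by simp⟩
    | add v v' _ _ h1 h2 =>
      intro u hu
      obtain ⟨f, hf, hf'⟩ := h1 u hu
      obtain ⟨g, hg, hg'⟩ := h2 u hu
      exact ⟨_, hf.add hg, fun z hz => by simp [hf' z hz, hg' z hz]⟩
    | smul a v _ h1 =>
      intro u hu
      obtain ⟨f, hf, hf'⟩ := h1 u hu
      exact ⟨_, (stripBounded_const ((starRingEnd ℂ) a)).mul hf,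
        fun z hz => by simp [hf' z hz]⟩
  -- Approximate both vectors from the span. Since the forms are bounded uniformly on D, the
  -- extensions converge uniformly on the boundary lines, and the limit has the prescribed value at
  -- every point of D.
  have hcl : ∀ w : H, ∃ x : ℕ → H, (∀ m, x m ∈ Submodule.span ℂ (Set.range ψ)) ∧
      Tendsto x atTop (𝓝 w) := by
    intro w
    have hw : w ∈ (Submodule.span ℂ (Set.range ψ)).topologicalClosure := hψ ▸ Submodule.mem_top
    exact mem_closure_iff_seq_limit.1 hw
  obtain ⟨x, hx, hxv⟩ := hcl v
  obtain ⟨y, hy, hyu⟩ := hcl u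
  choose f hf hfb using fun m => hgen (x m) (hx m) (y m) (hy m)
  let ε : ℕ → ℝ := fun m => M * ‖x m - v‖ * ‖y m‖ + M * ‖v‖ * ‖y m - u‖
  have hε : Tendsto ε atTop (𝓝 0) := by
    have h1 : Tendsto (fun m => ‖x m - v‖) atTop (𝓝 0) := by
      simpa using (hxv.sub_const v).norm
    have h2 : Tendsto (fun m => ‖y m - u‖) atTop (𝓝 0) := by
      simpa using (hyu.sub_const u).norm
    simpa using ((h1.const_mul M).mul hyu.norm).add (h2.const_mul (M * ‖v‖))
  have hclose : ∀ m, ∀ z ∈ D, ‖f m z - b z v u‖ ≤ ε m := by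
    intro m z hz
    have h1 : f m z - b z v u = b z (x m - v) (y m) + b z v (y m - u) := by
      rw [hfb m z hz, map_sub, map_sub, LinearMap.sub_apply]
      ring
    rw [h1]
    exact (norm_add_le _ _).trans (add_le_add (hb z hz _ _) (hb z hz _ _))
  obtain ⟨g, hg, hlim⟩ := StripBounded.exists_limit (by linarith) hf hε
    (fun m z hz => hclose m z (hD z hz))
  refine ⟨g, hg, fun z hz => ?_⟩
  refine tendsto_nhds_unique (hlim z (hD' z hz).1 (hD' z hz).2) ?_
  rw [tendsto_iff_norm_sub_tendsto_zero]
  exact squeeze_zero (fun _ => norm_nonneg _) (fun m => hclose m z hz) hε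

end StripFunctions

/-! ### Multiplication operators on L². -/

section Multiplication

variable {X : Type*} [MeasurableSpace X] {μ : Measure X}

/-- Multiplication by a bounded function on `L²`. -/
def mulL2 {φ : X → ℂ} (hφ : MemLp φ ⊤ μ) : Lp ℂ 2 μ →L[ℂ] Lp ℂ 2 μ :=
  (ContinuousLinearMap.mul ℂ ℂ).holderL μ ⊤ 2 2 hφ.toLp

theorem coeFn_mulL2 {φ : X → ℂ} (hφ : MemLp φ ⊤ μ) (f : Lp ℂ 2 μ) :
    mulL2 hφ f =ᵐ[μ] fun x => φ x * f x := by
  have h : mulL2 hφ f =ᵐ[μ] fun x => (ContinuousLinearMap.mul ℂ ℂ) ((hφ.toLp φ : X → ℂ) x) (f x) :=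
    ContinuousLinearMap.coeFn_holder (ContinuousLinearMap.mul ℂ ℂ) hφ.toLp f
  filter_upwards [h, hφ.coeFn_toLp] with x h1 h2
  rw [h1, h2]
  rfl

theorem norm_mulL2_le {φ : X → ℂ} (hφ : MemLp φ ⊤ μ) {C : ℝ} (h : ∀ᵐ x ∂μ, ‖φ x‖ ≤ C)
    (f : Lp ℂ 2 μ) : ‖mulL2 hφ f‖ ≤ C * ‖f‖ := by
  refine Lp.norm_le_mul_norm_of_ae_le_mul ?_
  filter_upwards [coeFn_mulL2 hφ f, h] with x h1 h2
  rw [h1, norm_mul]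
  exact mul_le_mul_of_nonneg_right h2 (norm_nonneg _)

end Multiplication

/-! ### Sesquilinear forms of bounded multipliers and of operators. -/

section DiagonalForm

variable {H ι : Type*} [NormedAddCommGroup H] [InnerProductSpace ℂ H]

/-- Cauchy-Schwarz, then Bessel's inequality for v and for u. -/
theorem sum_norm_diagonal_le {e : ι → H} (he : Orthonormal ℂ e) {g : ι → ℂ} {M : ℝ} (hM : 0 ≤ M)
    (hg : ∀ s, ‖g s‖ ≤ M) (v u : H) (F : Finset ι) :
    ∑ s ∈ F, ‖g s * (inner ℂ v (e s) * inner ℂ (e s) u)‖ ≤ M * ‖v‖ * ‖u‖ := by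
  calc ∑ s ∈ F, ‖g s * (inner ℂ v (e s) * inner ℂ (e s) u)‖
      ≤ ∑ s ∈ F, M * (‖inner ℂ (e s) v‖ * ‖inner ℂ (e s) u‖) := by
        refine Finset.sum_le_sum fun s _ => ?_
        rw [norm_mul, norm_mul, norm_inner_symm v]
        exact mul_le_mul_of_nonneg_right (hg s) (by positivity)
    _ = M * ∑ s ∈ F, ‖inner ℂ (e s) v‖ * ‖inner ℂ (e s) u‖ := by rw [Finset.mul_sum]
    _ ≤ M * (‖v‖ * ‖u‖) := by
        refine mul_le_mul_of_nonneg_left ?_ hM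
        refine (Real.sum_mul_le_sqrt_mul_sqrt _ _ _).trans ?_
        refine mul_le_mul ?_ ?_ (Real.sqrt_nonneg _) (norm_nonneg _)
        · exact Real.sqrt_le_iff.2 ⟨norm_nonneg _, he.sum_inner_products_le v⟩
        · exact Real.sqrt_le_iff.2 ⟨norm_nonneg _, he.sum_inner_products_le u⟩
    _ = M * ‖v‖ * ‖u‖ := by ring

theorem summable_diagonal {e : ι → H} (he : Orthonormal ℂ e) {g : ι → ℂ} {M : ℝ} (hM : 0 ≤ M)
    (hg : ∀ s, ‖g s‖ ≤ M) (v u : H) :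
    Summable fun s => g s * (inner ℂ v (e s) * inner ℂ (e s) u) :=
  Summable.of_norm (summable_of_sum_le (fun _ => norm_nonneg _)
    (sum_norm_diagonal_le he hM hg v u))

/-- The form `∑ g_s ⟨v, e_s⟩ ⟨e_s, u⟩` of a bounded multiplier `g` for the orthonormal system `e`. -/
def diagonalForm {e : ι → H} (he : Orthonormal ℂ e) {g : ι → ℂ} {M : ℝ} (hM : 0 ≤ M)
    (hg : ∀ s, ‖g s‖ ≤ M) : H →ₗ⋆[ℂ] H →ₗ[ℂ] ℂ :=
  LinearMap.mk₂'ₛₗ (starRingEnd ℂ) (RingHom.id ℂ)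
    (fun v u => ∑' s, g s * (inner ℂ v (e s) * inner ℂ (e s) u))
    (fun v v' u => by
      rw [← (summable_diagonal he hM hg v u).tsum_add (summable_diagonal he hM hg v' u)]
      refine tsum_congr fun s => ?_
      rw [inner_add_left]
      ring)
    (fun c v u => by
      rw [smul_eq_mul, ← tsum_mul_left]
      refine tsum_congr fun s => ?_
      rw [inner_smul_left]
      ring)
    (fun v u u' => by
      rw [← (summable_diagonal he hM hg v u).tsum_add (summable_diagonal he hM hg v u')]
      refine tsum_congr fun s => ?_
      rw [inner_add_right]
      ring)
    (fun c v u => by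
      rw [RingHom.id_apply, smul_eq_mul, ← tsum_mul_left]
      refine tsum_congr fun s => ?_
      rw [inner_smul_right]
      ring)

theorem norm_diagonalForm_le {e : ι → H} (he : Orthonormal ℂ e) {g : ι → ℂ} {M : ℝ} (hM : 0 ≤ M)
    (hg : ∀ s, ‖g s‖ ≤ M) (v u : H) : ‖diagonalForm he hM hg v u‖ ≤ M * ‖v‖ * ‖u‖ := by
  have h : HasSum (fun s => g s * (inner ℂ v (e s) * inner ℂ (e s) u))
      (diagonalForm he hM hg v u) := (summable_diagonal he hM hg v u).hasSum
  exact le_of_tendsto h.norm (Filter.Eventually.of_forall fun F =>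
    (norm_sum_le _ _).trans (sum_norm_diagonal_le he hM hg v u F))

theorem diagonalForm_apply_self [DecidableEq ι] {e : ι → H} (he : Orthonormal ℂ e) {g : ι → ℂ}
    {M : ℝ} (hM : 0 ≤ M) (hg : ∀ s, ‖g s‖ ≤ M) (i j : ι) :
    diagonalForm he hM hg (e i) (e j) = if i = j then g i else 0 := by
  change ∑' s, g s * (inner ℂ (e i) (e s) * inner ℂ (e s) (e j)) = _
  rw [tsum_eq_single i]
  · rw [orthonormal_iff_ite.1 he, orthonormal_iff_ite.1 he]
    simp
  · intro s hs
    rw [orthonormal_iff_ite.1 he i s, if_neg hs.symm]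
    simp

/-- The form `(v, u) ↦ B(D v, D u)`. -/
def pullbackForm (B : H →ₗ⋆[ℂ] H →ₗ[ℂ] ℂ) (D : H →L[ℂ] H) : H →ₗ⋆[ℂ] H →ₗ[ℂ] ℂ :=
  LinearMap.mk₂'ₛₗ (starRingEnd ℂ) (RingHom.id ℂ) (fun v u => B (D v) (D u))
    (by simp) (by simp) (by simp) (by simp)

theorem pullbackForm_apply (B : H →ₗ⋆[ℂ] H →ₗ[ℂ] ℂ) (D : H →L[ℂ] H) (v u : H) :
    pullbackForm B D v u = B (D v) (D u) := rfl

/-- The form `(v, u) ↦ ⟨v, T u⟩`. -/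
def operatorForm (T : H →L[ℂ] H) : H →ₗ⋆[ℂ] H →ₗ[ℂ] ℂ :=
  LinearMap.mk₂'ₛₗ (starRingEnd ℂ) (RingHom.id ℂ) (fun v u => inner ℂ v (T u))
    (by simp) (by simp [mul_comm]) (by simp) (by simp)

theorem operatorForm_apply (T : H →L[ℂ] H) (v u : H) : operatorForm T v u = inner ℂ v (T u) := rfl

end DiagonalForm

/-! ### Tensors in L²(X × X) and Hilbert-Schmidt forms. -/

section Tensor

variable {X : Type*} [MeasurableSpace X] {μ : Measure X}

theorem memLp_two_prod_mul {v u : X → ℂ} (hv : MemLp v 2 μ) (hu : MemLp u 2 μ) :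
    MemLp (fun p : X × X => v p.1 * u p.2) 2 (μ.prod μ) := by
  have hm : AEStronglyMeasurable (fun p : X × X => v p.1 * u p.2) (μ.prod μ) :=
    (hv.1.comp_fst).mul (hu.1.comp_snd)
  rw [memLp_two_iff_integrable_sq_norm hm]
  have h := ((memLp_two_iff_integrable_sq_norm hv.1).1 hv).mul_prod
    ((memLp_two_iff_integrable_sq_norm hu.1).1 hu)
  refine h.congr (ae_of_all _ fun p => ?_)
  simp only [norm_mul, mul_pow]

/-- The function `v(q) conj(u(q'))` in `L²(X × X)`. -/
def tensor (v u : Lp ℂ 2 μ) : Lp ℂ 2 (μ.prod μ) :=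
  (memLp_two_prod_mul (Lp.memLp v) (Lp.memLp u).star).toLp

theorem coeFn_tensor (v u : Lp ℂ 2 μ) :
    tensor v u =ᵐ[μ.prod μ] fun p => v p.1 * (starRingEnd ℂ) (u p.2) :=
  (memLp_two_prod_mul (Lp.memLp v) (Lp.memLp u).star).coeFn_toLp

theorem ae_prod_fst {p : X → Prop} (h : ∀ᵐ x ∂μ, p x) : ∀ᵐ z ∂μ.prod μ, p z.1 :=
  Measure.quasiMeasurePreserving_fst.ae h

theorem ae_prod_snd {p : X → Prop} (h : ∀ᵐ x ∂μ, p x) : ∀ᵐ z ∂μ.prod μ, p z.2 :=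
  Measure.quasiMeasurePreserving_snd.ae h

theorem inner_tensor [SFinite μ] (v u v' u' : Lp ℂ 2 μ) :
    inner ℂ (tensor v u) (tensor v' u') = inner ℂ v v' * inner ℂ u' u := by
  rw [L2.inner_def, L2.inner_def, L2.inner_def, ← integral_prod_mul]
  refine integral_congr_ae ?_
  filter_upwards [coeFn_tensor v u, coeFn_tensor v' u'] with p h1 h2
  simp only [h1, h2, RCLike.inner_apply, map_mul, Complex.conj_conj]
  ring

theorem norm_tensor [SFinite μ] (v u : Lp ℂ 2 μ) : ‖tensor v u‖ = ‖v‖ * ‖u‖ := by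
  have h := inner_tensor v u v u
  rw [inner_self_eq_norm_sq_to_K, inner_self_eq_norm_sq_to_K, inner_self_eq_norm_sq_to_K] at h
  have h2 : ‖tensor v u‖ ^ 2 = (‖v‖ * ‖u‖) ^ 2 := by
    rw [mul_pow]
    exact_mod_cast h
  exact (sq_eq_sq₀ (norm_nonneg _) (by positivity)).1 h2

/-- With this, the sum of |⟨f_k, A e_k⟩|² for an integral operator A is a Bessel sum for its kernel.
-/
theorem orthonormal_tensor [SFinite μ] {ι : Type*} {e f : ι → Lp ℂ 2 μ} (he : Orthonormal ℂ e)
    (hf : Orthonormal ℂ f) : Orthonormal ℂ fun k => tensor (f k) (e k) := by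
  classical
  rw [orthonormal_iff_ite] at he hf ⊢
  intro i j
  rw [inner_tensor, hf, he]
  by_cases h : i = j
  · simp [h]
  · simp [h]

theorem tensor_add_left (v v' u : Lp ℂ 2 μ) : tensor (v + v') u = tensor v u + tensor v' u := by
  refine Lp.ext ?_
  filter_upwards [coeFn_tensor (v + v') u, Lp.coeFn_add (tensor v u) (tensor v' u),
    coeFn_tensor v u, coeFn_tensor v' u, ae_prod_fst (Lp.coeFn_add v v')] with p h1 h2 h3 h4 h5
  rw [h1, h2, Pi.add_apply, h3, h4, h5, Pi.add_apply, add_mul]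

theorem tensor_add_right (v u u' : Lp ℂ 2 μ) : tensor v (u + u') = tensor v u + tensor v u' := by
  refine Lp.ext ?_
  filter_upwards [coeFn_tensor v (u + u'), Lp.coeFn_add (tensor v u) (tensor v u'),
    coeFn_tensor v u, coeFn_tensor v u', ae_prod_snd (Lp.coeFn_add u u')] with p h1 h2 h3 h4 h5
  rw [h1, h2, Pi.add_apply, h3, h4, h5, Pi.add_apply, map_add, mul_add]

theorem tensor_smul_left (c : ℂ) (v u : Lp ℂ 2 μ) : tensor (c • v) u = c • tensor v u := by
  refine Lp.ext ?_
  filter_upwards [coeFn_tensor (c • v) u, Lp.coeFn_smul c (tensor v u),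
    coeFn_tensor v u, ae_prod_fst (Lp.coeFn_smul c v)] with p h1 h2 h3 h4
  rw [h1, h2, Pi.smul_apply, h3, h4, Pi.smul_apply, smul_eq_mul, smul_eq_mul, mul_assoc]

theorem tensor_smul_right (c : ℂ) (v u : Lp ℂ 2 μ) :
    tensor v (c • u) = (starRingEnd ℂ) c • tensor v u := by
  refine Lp.ext ?_
  filter_upwards [coeFn_tensor v (c • u), Lp.coeFn_smul ((starRingEnd ℂ) c) (tensor v u),
    coeFn_tensor v u, ae_prod_snd (Lp.coeFn_smul c u)] with p h1 h2 h3 h4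
  rw [h1, h2, Pi.smul_apply, h3, h4, Pi.smul_apply, smul_eq_mul, smul_eq_mul, map_mul]
  ring

/-- The Hilbert-Schmidt form `∫∫ conj(v(q)) κ(q, q') u(q')`. -/
def kernelForm (κ : Lp ℂ 2 (μ.prod μ)) : Lp ℂ 2 μ →ₗ⋆[ℂ] Lp ℂ 2 μ →ₗ[ℂ] ℂ :=
  LinearMap.mk₂'ₛₗ (starRingEnd ℂ) (RingHom.id ℂ) (fun v u => inner ℂ (tensor v u) κ)
    (fun v v' u => by rw [tensor_add_left, inner_add_left])
    (fun c v u => by rw [tensor_smul_left, inner_smul_left, smul_eq_mul])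
    (fun v u u' => by rw [tensor_add_right, inner_add_left])
    (fun c v u => by
      rw [tensor_smul_right, inner_smul_left, Complex.conj_conj, RingHom.id_apply, smul_eq_mul])

theorem kernelForm_apply (κ : Lp ℂ 2 (μ.prod μ)) (v u : Lp ℂ 2 μ) :
    kernelForm κ v u = inner ℂ (tensor v u) κ := rfl

theorem norm_kernelForm_le [SFinite μ] (κ : Lp ℂ 2 (μ.prod μ)) (v u : Lp ℂ 2 μ) :
    ‖kernelForm κ v u‖ ≤ ‖κ‖ * ‖v‖ * ‖u‖ := by
  rw [kernelForm_apply]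
  refine (norm_inner_le_norm _ _).trans (le_of_eq ?_)
  rw [norm_tensor]
  ring

theorem kernelForm_eq_integral (κ : Lp ℂ 2 (μ.prod μ)) (v u : Lp ℂ 2 μ) :
    kernelForm κ v u = ∫ p, (starRingEnd ℂ) (v p.1) * κ p * u p.2 ∂(μ.prod μ) := by
  rw [kernelForm_apply, L2.inner_def]
  refine integral_congr_ae ?_
  filter_upwards [coeFn_tensor v u] with p h
  rw [h, RCLike.inner_apply, map_mul, Complex.conj_conj]
  ring

end Tensor

/-! ### Kernels of convolution type in t. -/

section ConvolutionKernel

variable {n : ℕ}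

/-- The kernel `(q, q') = ((t, x), (t', y)) ↦ K(x, y, t - t')`. -/
def convKernel (K : EuclideanSpace ℝ (Fin n) × EuclideanSpace ℝ (Fin n) × Torus → ℂ)
    (p : TX n × TX n) : ℂ := K (p.1.2, p.2.2, p.1.1 - p.2.1)

/-- The change of variables `((t, x), (t', y)) ↦ ((x, y, t - t'), t')`. -/
def shear (p : TX n × TX n) :
    (EuclideanSpace ℝ (Fin n) × EuclideanSpace ℝ (Fin n) × Torus) × Torus :=
  ((p.1.2, p.2.2, p.1.1 - p.2.1), p.2.1)

/-- A swap, a translation of the circle variable by a parameter, and reassociations; each step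
preserves the product measure. -/
theorem measurePreserving_shear :
    MeasurePreserving (shear (n := n)) (volume.prod volume) (volume.prod volume) := by
  have h1 : MeasurePreserving (Prod.swap : TX n × TX n → TX n × TX n)
      (volume.prod volume) (volume.prod volume) := Measure.measurePreserving_swap
  have h2 : MeasurePreserving (fun p : TX n × TX n => (p.1, (p.2.1 - p.1.1, p.2.2)))
      (volume.prod volume) (volume.prod volume) := by
    refine MeasurePreserving.skew_product (f := id) (g := fun (a b : TX n) => (b.1 - a.1, b.2))
      (MeasurePreserving.id _) (by fun_prop) (ae_of_all _ fun a => ?_)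
    exact ((measurePreserving_sub_right (volume : Measure Torus) a.1).prod
      (MeasurePreserving.id (volume : Measure (EuclideanSpace ℝ (Fin n))))).map_eq
  have h3 : MeasurePreserving
      (fun p : EuclideanSpace ℝ (Fin n) × Torus × EuclideanSpace ℝ (Fin n) =>
        (p.2.2, p.1, p.2.1)) (volume.prod (volume.prod volume))
        (volume.prod (volume.prod volume)) := by
    have h4 := (measurePreserving_prodAssoc (volume : Measure (EuclideanSpace ℝ (Fin n)))
      (volume : Measure Torus) (volume : Measure (EuclideanSpace ℝ (Fin n)))).symm
    exact Measure.measurePreserving_swap.comp h4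
  have h5 := measurePreserving_prodAssoc (volume : Measure Torus)
    (volume : Measure (EuclideanSpace ℝ (Fin n))) (volume : Measure (TX n))
  have h6 : MeasurePreserving (fun p : Torus × (EuclideanSpace ℝ (Fin n) × TX n) =>
      ((p.2.2.2, p.2.1, p.2.2.1), p.1)) (volume.prod (volume.prod (volume.prod volume)))
      ((volume.prod (volume.prod volume)).prod volume) :=
    Measure.measurePreserving_swap.comp ((MeasurePreserving.id _).prod h3)
  exact (h6.comp h5).comp (h2.comp h1)

theorem aestronglyMeasurable_convKernel
    {K : EuclideanSpace ℝ (Fin n) × EuclideanSpace ℝ (Fin n) × Torus → ℂ}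
    (hK : AEStronglyMeasurable K volume) :
    AEStronglyMeasurable (convKernel K) (volume.prod volume) :=
  (hK.comp_fst (ν := (volume : Measure Torus))).comp_measurePreserving measurePreserving_shear

theorem ae_norm_convKernel_le
    {K : EuclideanSpace ℝ (Fin n) × EuclideanSpace ℝ (Fin n) × Torus → ℂ} {M : ℝ}
    (hK : ∀ᵐ w, ‖K w‖ ≤ M) : ∀ᵐ p ∂(volume.prod volume : Measure (TX n × TX n)),
      ‖convKernel K p‖ ≤ M := by
  have h1 : ∀ᵐ w ∂(volume : Measure (EuclideanSpace ℝ (Fin n) ×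
      EuclideanSpace ℝ (Fin n) × Torus)).prod (volume : Measure Torus), ‖K w.1‖ ≤ M :=
    Measure.quasiMeasurePreserving_fst.ae hK
  exact measurePreserving_shear.quasiMeasurePreserving.ae h1

/-- In the variables (x, y, t - t') and t' the integral factors. The first factor is the coefficient
of K, with its 2π; the second is ∫ e^{i(ν-ν')t'} dt', which gives the other 2π and forces ν = ν'. -/
theorem integral_convKernel_mul_mode
    {K : EuclideanSpace ℝ (Fin n) × EuclideanSpace ℝ (Fin n) × Torus → ℂ}
    {m : (Fin n → ℕ) × ℤ → ℂ} {M : ℝ} (hK : IsBoundedKernel m M K) (i j : (Fin n → ℕ) × ℤ) :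
    ∫ p : TX n × TX n, (starRingEnd ℂ) (mode i p.1) * convKernel K p * mode j p.2
        ∂(volume.prod volume) =
      if i = j then (2 * Real.pi : ℂ) ^ 2 * m i else 0 := by
  obtain ⟨hK1, hK2, hK3⟩ := hK
  let F : EuclideanSpace ℝ (Fin n) × EuclideanSpace ℝ (Fin n) × Torus → ℂ := fun w =>
    K w * ((Phi i.1 w.1 : ℂ) * (Phi j.1 w.2.1 : ℂ) * fourier i.2 w.2.2)
  let F' : Torus → ℂ := fun t => fourier (i.2 - j.2) t
  have h1 : ∀ p : TX n × TX n, (starRingEnd ℂ) (mode i p.1) * convKernel K p * mode j p.2 =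
      F (shear p).1 * F' (shear p).2 := by
    intro p
    have h2 : fourier i.2 p.1.1 * fourier (-j.2) p.2.1 =
        fourier i.2 (p.1.1 - p.2.1) * fourier (i.2 - j.2) p.2.1 := by
      rw [sub_eq_add_neg i.2, fourier_add, ← mul_assoc]
      congr 1
      have h3 : p.1.1 = (p.1.1 - p.2.1) + p.2.1 := by abel
      conv_lhs => rw [h3]
      simp only [fourier_apply, smul_add, AddCircle.toCircle_add, Circle.coe_mul]
    simp only [F, F', shear, convKernel, mode, map_mul, ← fourier_neg, neg_neg,
      Complex.conj_ofReal]
    linear_combination (Phi i.1 p.1.2 : ℂ) * K (p.1.2, p.2.2, p.1.1 - p.2.1) *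
      (Phi j.1 p.2.2 : ℂ) * h2
  have hF : AEStronglyMeasurable F volume := by
    refine hK1.mul (Continuous.aestronglyMeasurable ?_)
    have ha : Continuous fun w : EuclideanSpace ℝ (Fin n) × EuclideanSpace ℝ (Fin n) × Torus =>
      Phi i.1 w.1 := (continuous_Phi _).comp continuous_fst
    have hb : Continuous fun w : EuclideanSpace ℝ (Fin n) × EuclideanSpace ℝ (Fin n) × Torus =>
      Phi j.1 w.2.1 := (continuous_Phi _).comp (continuous_fst.comp continuous_snd)
    have hc : Continuous fun w : EuclideanSpace ℝ (Fin n) × EuclideanSpace ℝ (Fin n) × Torus =>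
      fourier i.2 w.2.2 := (fourier i.2).continuous.comp (continuous_snd.comp continuous_snd)
    fun_prop
  have hFF : AEStronglyMeasurable
      (fun w : (EuclideanSpace ℝ (Fin n) × EuclideanSpace ℝ (Fin n) × Torus) × Torus =>
        F w.1 * F' w.2) (volume.prod volume) :=
    hF.comp_fst.mul ((fourier (i.2 - j.2)).continuous.aestronglyMeasurable.comp_snd)
  simp only [h1]
  have h4 := integral_map (μ := (volume.prod volume : Measure (TX n × TX n)))
    measurePreserving_shear.measurable.aemeasurable
    (f := fun w => F w.1 * F' w.2) (by rw [measurePreserving_shear.map_eq]; exact hFF)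
  rw [← h4, measurePreserving_shear.map_eq, integral_prod_mul F F']
  have h5 : ∫ w, F w = if i.1 = j.1 then 2 * (Real.pi : ℂ) * m (i.1, i.2) else 0 := hK3 _ _ _
  rw [h5, show ∫ t, F' t = if i.2 - j.2 = 0 then (2 * Real.pi : ℂ) else 0 from
    integral_fourier_torus _]
  by_cases h6 : i.1 = j.1
  · by_cases h7 : i.2 = j.2
    · rw [if_pos h6, if_pos (sub_eq_zero.2 h7), if_pos (Prod.ext h6 h7)]
      ring
    · rw [if_neg (fun h => h7 (sub_eq_zero.1 h)), if_neg (fun h => h7 (congrArg Prod.snd h)),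
        mul_zero]
  · rw [if_neg h6, if_neg (fun h => h6 (congrArg Prod.fst h)), zero_mul]

end ConvolutionKernel

variable {n : ℕ}

/-! ### The extension operator and the matrix of T_S in the modes. -/

section ExtensionOperator

theorem norm_sqrt_two_pi_sq : ((Real.sqrt (2 * Real.pi) : ℝ) : ℂ) ^ 2 = 2 * Real.pi := by
  rw [← Complex.ofReal_pow, Real.sq_sqrt Real.two_pi_pos.le]
  push_cast
  rfl

theorem sqrt_two_pi_ne_zero : ((Real.sqrt (2 * Real.pi) : ℝ) : ℂ) ≠ 0 := by
  exact_mod_cast (Real.sqrt_pos.2 Real.two_pi_pos).ne'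

/-- The normalized modes. -/
def unitMode (s : (Fin n → ℕ) × ℤ) : L2TX n :=
  ((Real.sqrt (2 * Real.pi) : ℝ) : ℂ)⁻¹ • modeL2 s

theorem modeL2_eq_smul (s : (Fin n → ℕ) × ℤ) :
    modeL2 s = ((Real.sqrt (2 * Real.pi) : ℝ) : ℂ) • unitMode s := by
  rw [unitMode, smul_smul, mul_inv_cancel₀ sqrt_two_pi_ne_zero, one_smul]

theorem orthonormal_unitMode : Orthonormal ℂ (unitMode (n := n)) := by
  classical
  rw [orthonormal_iff_ite]
  intro i j
  rw [unitMode, unitMode, inner_smul_left, inner_smul_right, inner_modeL2]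
  split_ifs
  · rw [map_inv₀, Complex.conj_ofReal, ← norm_sqrt_two_pi_sq]
    field_simp [sqrt_two_pi_ne_zero]
  · simp

/-- The modes are orthogonal with norm √(2π), so the operator is √(2π) times an isometry. -/
theorem exists_isExtensionOperator (S : Set ((Fin n → ℕ) × ℤ)) :
    ∃ E : lp (fun _ : S => ℂ) 2 →L[ℂ] L2TX n, IsExtensionOperator S E ∧
      ∀ s : S, E (lp.single 2 s (1 : ℂ)) = modeL2 (s : (Fin n → ℕ) × ℤ) := by
  have ho : Orthonormal ℂ fun s : S => unitMode (s : (Fin n → ℕ) × ℤ) :=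
    orthonormal_unitMode.comp _ Subtype.val_injective
  let V := ho.orthogonalFamily.linearIsometry
  let E : lp (fun _ : S => ℂ) 2 →L[ℂ] L2TX n :=
    ((Real.sqrt (2 * Real.pi) : ℝ) : ℂ) • V.toContinuousLinearMap
  have hE : ∀ s : S, E (lp.single 2 s (1 : ℂ)) = modeL2 (s : (Fin n → ℕ) × ℤ) := by
    intro s
    have h : V (lp.single 2 s (1 : ℂ)) = unitMode (s : (Fin n → ℕ) × ℤ) := by
      rw [ho.orthogonalFamily.linearIsometry_apply_single]
      simp
    rw [modeL2_eq_smul, ← h]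
    rfl
  exact ⟨E, fun s => by rw [hE]; exact coeFn_modeL2 _, hE⟩

/-- One factor 2π comes from the adjoint, which sends a mode in S to 2π times a unit sequence; the
other is the squared norm of the mode. -/
theorem inner_modeL2_extension_adjoint {S : Set ((Fin n → ℕ) × ℤ)}
    {E : lp (fun _ : S => ℂ) 2 →L[ℂ] L2TX n}
    (hE : ∀ s : S, E (lp.single 2 s (1 : ℂ)) = modeL2 (s : (Fin n → ℕ) × ℤ))
    (i j : (Fin n → ℕ) × ℤ) :
    inner ℂ (modeL2 i) ((E ∘L ContinuousLinearMap.adjoint E) (modeL2 j)) =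
      if i = j then (2 * Real.pi : ℂ) ^ 2 * S.indicator (fun _ => (1 : ℂ)) i else 0 := by
  have hcoef : ∀ s : S, (ContinuousLinearMap.adjoint E (modeL2 j) : S → ℂ) s =
      if (s : (Fin n → ℕ) × ℤ) = j then (2 * Real.pi : ℂ) else 0 := by
    intro s
    rw [← inner_modeL2, ← hE s, ← ContinuousLinearMap.adjoint_inner_right,
      lp.inner_single_left]
    simp
  rw [ContinuousLinearMap.comp_apply]
  by_cases hj : j ∈ S
  · have h1 : ContinuousLinearMap.adjoint E (modeL2 j) =
        (2 * Real.pi : ℂ) • lp.single 2 (⟨j, hj⟩ : S) (1 : ℂ) := by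
      ext s
      rw [hcoef, lp.coeFn_smul, Pi.smul_apply, lp.single_apply]
      by_cases h : (s : (Fin n → ℕ) × ℤ) = j
      · have h2 : s = ⟨j, hj⟩ := Subtype.ext h
        subst h2
        simp
      · have h2 : s ≠ ⟨j, hj⟩ := fun h3 => h (congrArg Subtype.val h3)
        simp [h, h2]
    rw [h1, map_smul, hE, inner_smul_right, inner_modeL2]
    split_ifs with h
    · subst h
      rw [Set.indicator_of_mem hj]
      ring
    · simp
  · have h1 : ContinuousLinearMap.adjoint E (modeL2 j) = 0 := by
      ext s
      rw [hcoef, if_neg fun h : (s : (Fin n → ℕ) × ℤ) = j => hj (h ▸ s.2)]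
      simp
    rw [h1, map_zero, inner_zero_right]
    split_ifs with h
    · subst h
      rw [Set.indicator_of_notMem hj, mul_zero]
    · rfl

end ExtensionOperator

/-! ### Removing the growth of the analytic family. -/

section RegularFamily

/-- An analytic family of multipliers that is bounded on the strip for every frequency, and bounded
on the line `Re z = 0`, with kernels bounded on the line `Re z = -lam`. -/
structure IsRegularFamily (S : Set ((Fin n → ℕ) × ℤ)) (lam M : ℝ)
    (g : ℂ → (Fin n → ℕ) × ℤ → ℂ) : Prop where
  nonneg : 0 ≤ M
  strip : ∀ s, StripBounded lam fun z => g z s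
  neg_one : ∀ s, g (-1) s = S.indicator (fun _ => (1 : ℂ)) s
  right : ∀ z : ℂ, z.re = 0 → ∀ s, ‖g z s‖ ≤ M
  left : ∀ z : ℂ, z.re = -lam → ∃ K, IsBoundedKernel (g z) M K

theorem norm_exp_add_one_sq (z : ℂ) :
    ‖Complex.exp ((z + 1) ^ 2)‖ = Real.exp ((z.re + 1) ^ 2 - z.im ^ 2) := by
  rw [Complex.norm_exp]
  congr 1
  simp [sq]

theorem exp_abs_mul_norm_exp_le (b : ℝ) (z : ℂ) :
    Real.exp (b * |z.im|) * ‖Complex.exp ((z + 1) ^ 2)‖ ≤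
      Real.exp ((z.re + 1) ^ 2 + b ^ 2) := by
  rw [norm_exp_add_one_sq, ← Real.exp_add, Real.exp_le_exp]
  nlinarith [sq_nonneg (b - |z.im|), sq_abs z.im, sq_nonneg (b + |z.im|), sq_nonneg b,
    sq_nonneg z.im]

/-- A coefficient of a bounded function is controlled by the L¹ norm of Φ_μ ⊗ Φ_μ. The constant
depends on the frequency; it serves only to bound each multiplier on the left line. -/
theorem exists_norm_multiplier_le (s : (Fin n → ℕ) × ℤ) :
    ∃ L : ℝ, 0 ≤ L ∧ ∀ (m : (Fin n → ℕ) × ℤ → ℂ) (M : ℝ)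
      (K : EuclideanSpace ℝ (Fin n) × EuclideanSpace ℝ (Fin n) × Torus → ℂ),
      IsBoundedKernel m M K → ‖m s‖ ≤ M * L := by
  let Φ : EuclideanSpace ℝ (Fin n) × EuclideanSpace ℝ (Fin n) × Torus → ℂ := fun w =>
    (Phi s.1 w.1 : ℂ) * (Phi s.1 w.2.1 : ℂ) * fourier s.2 w.2.2
  have hPhi : Integrable fun x : EuclideanSpace ℝ (Fin n) => (Phi s.1 x : ℂ) := by
    obtain ⟨C, -, hC⟩ := norm_mode_le (n := n) (s.1, 0)
    have h1 := integrable_of_gaussian_bound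
      (continuous_mode (n := n) (s.1, 0)).aestronglyMeasurable (by norm_num) hC
    have h2 : (fun q : TX n => (Phi s.1 q.2 : ℂ)) = mode (s.1, 0) := by
      ext q
      simp [mode]
    rw [← h2] at h1
    exact (Integrable.comp_snd_iff (f := fun x : EuclideanSpace ℝ (Fin n) => (Phi s.1 x : ℂ))
      (NeZero.ne (volume : Measure Torus))).1 h1
  have hf : Integrable fun t : Torus => fourier s.2 t :=
    ((fourier s.2).continuous.integrable_of_hasCompactSupport
      (HasCompactSupport.of_compactSpace _))
  have hΦ : Integrable Φ := by
    refine (hPhi.mul_prod (hPhi.mul_prod hf)).congr (ae_of_all _ fun w => ?_)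
    simp only [Φ]
    ring
  refine ⟨(2 * Real.pi)⁻¹ * ∫ w, ‖Φ w‖, by positivity, fun m M K hK => ?_⟩
  obtain ⟨hK1, hK2, hK3⟩ := hK
  have h1 := hK3 s.1 s.1 s.2
  rw [if_pos rfl] at h1
  have h2 : ‖∫ w, K w * Φ w‖ ≤ ∫ w, M * ‖Φ w‖ := by
    refine norm_integral_le_of_norm_le (hΦ.norm.const_mul M) ?_
    filter_upwards [hK2] with w hw
    rw [norm_mul]
    exact mul_le_mul_of_nonneg_right hw (norm_nonneg _)
  rw [show ∫ w, K w * Φ w = 2 * (Real.pi : ℂ) * m (s.1, s.2) from h1, integral_const_mul,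
    norm_mul, norm_mul, Complex.norm_real, Real.norm_of_nonneg Real.pi_pos.le,
    Complex.norm_ofNat] at h2
  have h3 : 0 < 2 * Real.pi := Real.two_pi_pos
  rw [mul_left_comm, ← div_eq_inv_mul, le_div_iff₀ h3]
  linarith

theorem IsBoundedKernel.const_mul {m : (Fin n → ℕ) × ℤ → ℂ} {M : ℝ}
    {K : EuclideanSpace ℝ (Fin n) × EuclideanSpace ℝ (Fin n) × Torus → ℂ}
    (hK : IsBoundedKernel m M K) (c : ℂ) {M' : ℝ} (hc : ‖c‖ * M ≤ M') :
    IsBoundedKernel (fun s => m s * c) M' (fun w => c * K w) := by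
  obtain ⟨hK1, hK2, hK3⟩ := hK
  refine ⟨hK1.const_mul c, ?_, fun μ μ' ν => ?_⟩
  · filter_upwards [hK2] with w hw
    rw [norm_mul]
    exact (mul_le_mul_of_nonneg_left hw (norm_nonneg c)).trans hc
  · simp only [mul_assoc c]
    rw [integral_const_mul, hK3]
    split_ifs
    · ring
    · simp

/-- The Gaussian factor `e^{(z+1)²}` turns an analytic family with exponential growth on the
boundary lines into a regular one. -/
theorem exists_isRegularFamily {S : Set ((Fin n → ℕ) × ℤ)} {lam : ℝ} (hlam : 1 < lam)
    {G : ℂ → (Fin n → ℕ) × ℤ → ℂ} (hG : IsAnalyticFamily lam G)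
    (hS : ∀ s, G (-1) s = S.indicator (fun _ => (1 : ℂ)) s)
    (hG0 : ∃ M a : ℝ, ∀ (τ : ℝ) (s : (Fin n → ℕ) × ℤ),
      ‖G (τ * Complex.I) s‖ ≤ M * Real.exp (a * |τ|))
    (hK : ∃ M b : ℝ, ∀ τ : ℝ,
      ∃ K : EuclideanSpace ℝ (Fin n) × EuclideanSpace ℝ (Fin n) × Torus → ℂ,
        IsBoundedKernel (G (-lam + τ * Complex.I)) (M * Real.exp (b * |τ|)) K) :
    ∃ (M : ℝ) (g : ℂ → (Fin n → ℕ) × ℤ → ℂ), IsRegularFamily S lam M g := by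
  obtain ⟨M₀, a, hG0⟩ := hG0
  obtain ⟨M₁, b, hK⟩ := hK
  let E : ℂ → ℂ := fun z => Complex.exp ((z + 1) ^ 2)
  let g : ℂ → (Fin n → ℕ) × ℤ → ℂ := fun z s => G z s * E z
  let N₀ : ℝ := |M₀| * Real.exp (1 + a ^ 2)
  let N₁ : ℝ := |M₁| * Real.exp ((-lam + 1) ^ 2 + b ^ 2)
  have hright : ∀ z : ℂ, z.re = 0 → ∀ s, ‖g z s‖ ≤ N₀ := by
    intro z hz s
    have hz' : z = (z.im : ℂ) * Complex.I := by
      apply Complex.ext <;> simp [hz]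
    have h1 : ‖G z s‖ ≤ |M₀| * Real.exp (a * |z.im|) := by
      have := hG0 z.im s
      rw [← hz'] at this
      exact this.trans (mul_le_mul_of_nonneg_right (le_abs_self _) (Real.exp_pos _).le)
    have h2 := exp_abs_mul_norm_exp_le a z
    rw [hz, zero_add, one_pow] at h2
    calc ‖g z s‖ = ‖G z s‖ * ‖E z‖ := norm_mul _ _
      _ ≤ |M₀| * Real.exp (a * |z.im|) * ‖E z‖ := mul_le_mul_of_nonneg_right h1 (norm_nonneg _)
      _ = |M₀| * (Real.exp (a * |z.im|) * ‖E z‖) := mul_assoc _ _ _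
      _ ≤ N₀ := mul_le_mul_of_nonneg_left h2 (abs_nonneg _)
  have hleft : ∀ z : ℂ, z.re = -lam → ∃ K, IsBoundedKernel (g z) N₁ K := by
    intro z hz
    have hz' : z = -lam + (z.im : ℂ) * Complex.I := by
      apply Complex.ext <;> simp [hz]
    obtain ⟨K, hKz⟩ := hK z.im
    rw [← hz'] at hKz
    refine ⟨_, hKz.const_mul (E z) ?_⟩
    have h2 := exp_abs_mul_norm_exp_le b z
    rw [hz] at h2
    calc ‖E z‖ * (M₁ * Real.exp (b * |z.im|))
        ≤ ‖E z‖ * (|M₁| * Real.exp (b * |z.im|)) := by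
          gcongr
          exact le_abs_self _
      _ = |M₁| * (Real.exp (b * |z.im|) * ‖E z‖) := by ring
      _ ≤ N₁ := mul_le_mul_of_nonneg_left h2 (abs_nonneg _)
  -- Phragmén-Lindelöf with the admissible growth: bounds on the two lines bound each multiplier on
  -- the strip, not uniformly in the frequency.
  have hstrip : ∀ s, StripBounded lam fun z => g z s := by
    intro s
    obtain ⟨hd, c, hc, B, hB⟩ := hG s
    obtain ⟨L, hL0, hL⟩ := exists_norm_multiplier_le s
    have hE : Differentiable ℂ E := by fun_prop
    have hdiff : DiffContOnCl ℂ (fun z => g z s) (Complex.re ⁻¹' Set.Ioo (-lam) 0) :=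
      hd.smul hE.diffContOnCl
    have hN₀ : 0 ≤ N₀ := by positivity
    have hN₁ : 0 ≤ N₁ := by positivity
    refine ⟨hdiff, N₀ + N₁ * L, fun z hz1 hz2 => ?_⟩
    refine PhragmenLindelof.vertical_strip (f := fun z => g z s) hdiff
      ⟨c, by simpa using hc, B, ?_⟩ (fun w hw => ?_) (fun w hw => ?_) hz1 hz2
    · refine Asymptotics.IsBigO.of_bound (Real.exp ((lam + 1) ^ 2)) ?_
      refine Filter.mem_inf_of_right ?_
      rw [Filter.mem_principal]
      intro w hw
      have h1 := hB w hw.1.le hw.2.le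
      have h2 : ‖E w‖ ≤ Real.exp ((lam + 1) ^ 2) := by
        rw [norm_exp_add_one_sq, Real.exp_le_exp]
        have h3 : -lam < w.re := hw.1
        have h4 : w.re < 0 := hw.2
        nlinarith [sq_nonneg w.im]
      change ‖G w s * E w‖ ≤ _
      rw [norm_mul, Real.norm_of_nonneg (Real.exp_pos _).le, mul_comm]
      exact mul_le_mul h2 h1 (norm_nonneg _) (Real.exp_pos _).le
    · obtain ⟨K, hKw⟩ := hleft w hw
      exact (hL _ _ _ hKw).trans (by linarith)
    · exact (hright w hw s).trans (by nlinarith)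
  have hN₀ : 0 ≤ N₀ := by positivity
  have hN₁ : 0 ≤ N₁ := by positivity
  refine ⟨N₀ + N₁, g, by positivity, hstrip, fun s => ?_, fun z hz s => ?_, fun z hz => ?_⟩
  · simp [g, E, hS]
  · exact (hright z hz s).trans (by linarith)
  · obtain ⟨K, h1, h2, h3⟩ := hleft z hz
    refine ⟨K, h1, ?_, h3⟩
    filter_upwards [h2] with w hw
    linarith

end RegularFamily

/-! ### The weighted forms on the boundary lines and at -1. -/

section BoundaryForms

theorem memLp_top_weight_inv : MemLp (fun q : TX n => (((weight q)⁻¹ : ℝ) : ℂ)) ⊤ volume := by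
  refine memLp_top_of_bound
    (Complex.continuous_ofReal.comp continuous_weight_inv).aestronglyMeasurable 1
    (ae_of_all _ fun q => ?_)
  rw [Complex.norm_real, Real.norm_of_nonneg (inv_pos.2 (weight_pos q)).le]
  exact weight_inv_le_one q

/-- Division by the weight. -/
def divWeight : L2TX n →L[ℂ] L2TX n := mulL2 memLp_top_weight_inv

theorem coeFn_divWeight (u : L2TX n) :
    divWeight u =ᵐ[volume] fun q => (((weight q)⁻¹ : ℝ) : ℂ) * u q := coeFn_mulL2 _ u

theorem norm_divWeight_le (u : L2TX n) : ‖divWeight u‖ ≤ ‖u‖ := by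
  have h := norm_mulL2_le memLp_top_weight_inv (C := 1) (ae_of_all _ fun q : TX n => by
    rw [Complex.norm_real, Real.norm_of_nonneg (inv_pos.2 (weight_pos q)).le]
    exact weight_inv_le_one q) u
  rwa [one_mul] at h

theorem weight_inv_mul_weight (q : TX n) :
    (((weight q)⁻¹ : ℝ) : ℂ) * (weight q : ℂ) = 1 := by
  rw [← Complex.ofReal_mul, inv_mul_cancel₀ (weight_pos q).ne', Complex.ofReal_one]

theorem divWeight_weightedMode (s : (Fin n → ℕ) × ℤ) : divWeight (weightedMode s) = modeL2 s := by
  refine Lp.ext ?_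
  filter_upwards [coeFn_divWeight (weightedMode s), coeFn_weightedMode s, coeFn_modeL2 s]
    with q h1 h2 h3
  rw [h1, h2, h3, ← mul_assoc, weight_inv_mul_weight, one_mul]

/-- The forms on the boundary lines, and at `-1`, extend the diagonal form with entries
`(2π)² g_s` in the weighted modes. -/
def ExtendsDiagonal (g : (Fin n → ℕ) × ℤ → ℂ) (b : L2TX n →ₗ⋆[ℂ] L2TX n →ₗ[ℂ] ℂ) : Prop :=
  ∀ i j, b (weightedMode i) (weightedMode j) = if i = j then (2 * Real.pi : ℂ) ^ 2 * g i else 0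

/-- The squared norm 2π of a mode gives the constant. The norms after division by the weight are
kept in the bound because the vectors inserted later carry the weight. -/
theorem exists_form_of_bounded {g : (Fin n → ℕ) × ℤ → ℂ} {M : ℝ} (hM : 0 ≤ M)
    (hg : ∀ s, ‖g s‖ ≤ M) : ∃ b : L2TX n →ₗ⋆[ℂ] L2TX n →ₗ[ℂ] ℂ, ExtendsDiagonal g b ∧
      ∀ v u, ‖b v u‖ ≤ 2 * Real.pi * M * ‖divWeight v‖ * ‖divWeight u‖ := by
  have hg' : ∀ s, ‖(2 * Real.pi : ℂ) * g s‖ ≤ 2 * Real.pi * M := by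
    intro s
    rw [norm_mul, norm_mul, Complex.norm_real, Real.norm_of_nonneg Real.pi_pos.le,
      Complex.norm_ofNat]
    exact mul_le_mul_of_nonneg_left (hg s) Real.two_pi_pos.le
  have hM' : 0 ≤ 2 * Real.pi * M := mul_nonneg Real.two_pi_pos.le hM
  refine ⟨pullbackForm (diagonalForm orthonormal_unitMode hM' hg') divWeight, fun i j => ?_,
    fun v u => ?_⟩
  · rw [pullbackForm_apply, divWeight_weightedMode, divWeight_weightedMode, modeL2_eq_smul,
      modeL2_eq_smul, map_smul, LinearMap.map_smulₛₗ₂, diagonalForm_apply_self]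
    split_ifs
    · rw [Complex.conj_ofReal, smul_eq_mul, smul_eq_mul, ← mul_assoc, ← sq, norm_sqrt_two_pi_sq]
      ring
    · simp
  · rw [pullbackForm_apply]
    exact norm_diagonalForm_le _ hM' hg' _ _

theorem exists_form_of_operator {g : (Fin n → ℕ) × ℤ → ℂ} (T : L2TX n →L[ℂ] L2TX n)
    (hT : ∀ i j, inner ℂ (modeL2 i) (T (modeL2 j)) =
      if i = j then (2 * Real.pi : ℂ) ^ 2 * g i else 0) :
    ∃ b : L2TX n →ₗ⋆[ℂ] L2TX n →ₗ[ℂ] ℂ, ExtendsDiagonal g b ∧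
      ∀ v u, b v u = inner ℂ (divWeight v) (T (divWeight u)) := by
  refine ⟨pullbackForm (operatorForm T) divWeight, fun i j => ?_, fun v u => ?_⟩
  · rw [pullbackForm_apply, operatorForm_apply, divWeight_weightedMode, divWeight_weightedMode, hT]
  · rw [pullbackForm_apply, operatorForm_apply]

theorem memLp_two_weight_inv : MemLp (fun q : TX n => (((weight q)⁻¹ : ℝ) : ℂ)) 2 volume := by
  refine memLp_two_of_gaussian_bound (a := 4⁻¹) (C := 1)
    (Complex.continuous_ofReal.comp continuous_weight_inv).aestronglyMeasurable (by norm_num)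
    fun q => ?_
  rw [Complex.norm_real, Real.norm_of_nonneg (inv_pos.2 (weight_pos q)).le, one_mul,
    weight_inv_eq]

theorem extendsDiagonal_kernelForm {g : (Fin n → ℕ) × ℤ → ℂ} {M : ℝ}
    {K : EuclideanSpace ℝ (Fin n) × EuclideanSpace ℝ (Fin n) × Torus → ℂ}
    (hK : IsBoundedKernel g M K) {κ : Lp ℂ 2 ((volume : Measure (TX n)).prod volume)}
    (hκ : κ =ᵐ[(volume : Measure (TX n)).prod volume] fun p =>
      convKernel K p * ((((weight p.1)⁻¹ : ℝ) : ℂ) * (((weight p.2)⁻¹ : ℝ) : ℂ))) :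
    ExtendsDiagonal g (kernelForm κ) := by
  intro i j
  rw [kernelForm_eq_integral, ← integral_convKernel_mul_mode hK i j]
  refine integral_congr_ae ?_
  filter_upwards [hκ, ae_prod_fst (coeFn_weightedMode i), ae_prod_snd (coeFn_weightedMode j)]
    with p h1 h2 h3
  rw [h1, h2, h3, map_mul, Complex.conj_ofReal]
  have h7 := weight_inv_mul_weight p.1
  have h8 := weight_inv_mul_weight p.2
  calc _ = ((((weight p.1)⁻¹ : ℝ) : ℂ) * (weight p.1 : ℂ)) *
        ((((weight p.2)⁻¹ : ℝ) : ℂ) * (weight p.2 : ℂ)) *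
        ((starRingEnd ℂ) (mode i p.1) * convKernel K p * mode j p.2) := by ring
    _ = _ := by rw [h7, h8, one_mul, one_mul]

/-- The weights in v and u cancel those in κ, so the entries are inner products of the orthonormal
tensors with κ', and Bessel's inequality applies. -/
theorem sum_norm_sq_kernelForm_le {k₀ : TX n × TX n → ℂ}
    {κ κ' : Lp ℂ 2 ((volume : Measure (TX n)).prod volume)}
    (hκ : κ =ᵐ[(volume : Measure (TX n)).prod volume] fun p =>
      k₀ p * ((((weight p.1)⁻¹ : ℝ) : ℂ) * (((weight p.2)⁻¹ : ℝ) : ℂ)))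
    {φ χ : TX n → ℂ}
    (hκ' : κ' =ᵐ[(volume : Measure (TX n)).prod volume] fun p => k₀ p * (φ p.1 * χ p.2))
    {N : ℕ} {e f v u : Fin N → L2TX n} (he : Orthonormal ℂ e) (hf : Orthonormal ℂ f)
    (hv : ∀ k, (v k : TX n → ℂ) =ᵐ[volume]
      fun q => (weight q : ℂ) * (starRingEnd ℂ) (φ q) * f k q)
    (hu : ∀ k, (u k : TX n → ℂ) =ᵐ[volume] fun q => (weight q : ℂ) * χ q * e k q) :
    ∑ k, ‖kernelForm κ (v k) (u k)‖ ^ 2 ≤ ‖κ'‖ ^ 2 := by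
  have h2 : ∀ k, kernelForm κ (v k) (u k) = inner ℂ (tensor (f k) (e k)) κ' := by
    intro k
    rw [← kernelForm_apply, kernelForm_eq_integral, kernelForm_eq_integral]
    refine integral_congr_ae ?_
    filter_upwards [hκ, hκ', ae_prod_fst (hv k), ae_prod_snd (hu k)] with p h1 h2 h3 h4
    rw [h1, h2, h3, h4, map_mul, map_mul, Complex.conj_ofReal, Complex.conj_conj]
    have h7 := weight_inv_mul_weight p.1
    have h8 := weight_inv_mul_weight p.2
    calc _ = ((((weight p.1)⁻¹ : ℝ) : ℂ) * (weight p.1 : ℂ)) *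
          ((((weight p.2)⁻¹ : ℝ) : ℂ) * (weight p.2 : ℂ)) *
          ((starRingEnd ℂ) (f k p.1) * (k₀ p * (φ p.1 * χ p.2)) * e k p.2) := by ring
      _ = _ := by rw [h7, h8, one_mul, one_mul]
  simp only [h2]
  exact (orthonormal_tensor he hf).sum_inner_products_le κ'

theorem exists_toLp_mul_prod {k₀ : TX n × TX n → ℂ} {M : ℝ}
    (hm : AEStronglyMeasurable k₀ ((volume : Measure (TX n)).prod volume))
    (hb : ∀ᵐ p ∂(volume : Measure (TX n)).prod volume, ‖k₀ p‖ ≤ M) {φ χ : TX n → ℂ}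
    (hφ : MemLp φ 2 volume) (hχ : MemLp χ 2 volume) :
    ∃ κ : Lp ℂ 2 ((volume : Measure (TX n)).prod volume),
      κ =ᵐ[(volume : Measure (TX n)).prod volume] (fun p => k₀ p * (φ p.1 * χ p.2)) ∧
      ‖κ‖ ≤ M * ((eLpNorm φ 2 volume).toReal * (eLpNorm χ 2 volume).toReal) := by
  let w := tensor (μ := volume) hφ.toLp hχ.star.toLp
  have hk : MemLp k₀ ⊤ ((volume : Measure (TX n)).prod volume) := memLp_top_of_bound hm M hb
  refine ⟨mulL2 hk w, ?_, (norm_mulL2_le hk hb w).trans (le_of_eq ?_)⟩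
  · filter_upwards [coeFn_mulL2 hk w, coeFn_tensor (μ := volume) hφ.toLp hχ.star.toLp,
      ae_prod_fst hφ.coeFn_toLp, ae_prod_snd hχ.star.coeFn_toLp] with p h1 h2 h3 h4
    rw [h1, h2, h3, h4]
    simp
  · rw [norm_tensor, Lp.norm_toLp, Lp.norm_toLp]
    congr 3
    exact eLpNorm_congr_norm_ae (ae_of_all _ fun q => by simp)

/-- The Hilbert-Schmidt bound of a form with kernel `e^{-|x|²/4} K e^{-|y|²/4}`, `|K| ≤ M`, after
multiplication by the weights and by square integrable functions on both sides. -/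
def HilbertSchmidtBound (M : ℝ) (b : L2TX n →ₗ⋆[ℂ] L2TX n →ₗ[ℂ] ℂ) : Prop :=
  ∀ (φ χ : TX n → ℂ), MemLp φ 2 volume → MemLp χ 2 volume →
    ∀ (N : ℕ) (e f v u : Fin N → L2TX n), Orthonormal ℂ e → Orthonormal ℂ f →
      (∀ k, (v k : TX n → ℂ) =ᵐ[volume]
        fun q => (weight q : ℂ) * (starRingEnd ℂ) (φ q) * f k q) →
      (∀ k, (u k : TX n → ℂ) =ᵐ[volume] fun q => (weight q : ℂ) * χ q * e k q) →
      ∑ k, ‖b (v k) (u k)‖ ^ 2 ≤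
        (M * ((eLpNorm φ 2 volume).toReal * (eLpNorm χ 2 volume).toReal)) ^ 2

/-- A bounded kernel need not define an operator on L². Divided by the weight in both variables it
is square integrable, which yields a bounded form; the Hilbert-Schmidt estimate no longer involves
the weight. -/
theorem exists_form_of_kernel {g : (Fin n → ℕ) × ℤ → ℂ} {M : ℝ}
    {K : EuclideanSpace ℝ (Fin n) × EuclideanSpace ℝ (Fin n) × Torus → ℂ}
    (hK : IsBoundedKernel g M K) :
    ∃ b : L2TX n →ₗ⋆[ℂ] L2TX n →ₗ[ℂ] ℂ, ExtendsDiagonal g b ∧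
      (∀ v u, ‖b v u‖ ≤ M * (eLpNorm (fun q : TX n => (((weight q)⁻¹ : ℝ) : ℂ)) 2 volume).toReal ^ 2
        * ‖v‖ * ‖u‖) ∧
      HilbertSchmidtBound M b := by
  have hm := aestronglyMeasurable_convKernel hK.1
  have hb := ae_norm_convKernel_le hK.2.1
  obtain ⟨κ, hκ, hκn⟩ := exists_toLp_mul_prod hm hb memLp_two_weight_inv memLp_two_weight_inv
  refine ⟨kernelForm κ, extendsDiagonal_kernelForm hK hκ, fun v u => ?_, ?_⟩
  · refine (norm_kernelForm_le κ v u).trans ?_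
    rw [sq]
    gcongr
  · intro φ χ hφ hχ N e f v u he hf hv hu
    obtain ⟨κ', hκ', hκ'n⟩ := exists_toLp_mul_prod hm hb hφ hχ
    exact (sum_norm_sq_kernelForm_le hκ hκ' he hf hv hu).trans
      (pow_le_pow_left₀ (norm_nonneg _) hκ'n 2)

end BoundaryForms

variable {n : ℕ}

/-! ### Complex powers of modulus that keep the phase. -/

section SignedPowers

/-- The signed power `a |a|^E`. -/
def signedPow (a E : ℂ) : ℂ := a * (‖a‖ : ℂ) ^ E

theorem norm_signedPow_of_ne_zero {a : ℂ} (ha : a ≠ 0) (E : ℂ) :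
    ‖signedPow a E‖ = ‖a‖ ^ (1 + E.re) := by
  have h : 0 < ‖a‖ := norm_pos_iff.2 ha
  rw [signedPow, norm_mul, Complex.norm_cpow_eq_rpow_re_of_pos h, Real.rpow_add h, Real.rpow_one]

theorem norm_signedPow {a E : ℂ} {x : ℝ} (hx : 1 + E.re = x) (hx0 : x ≠ 0) :
    ‖signedPow a E‖ = ‖a‖ ^ x := by
  by_cases ha : a = 0
  · subst ha
    rw [norm_zero, Real.zero_rpow hx0]
    simp [signedPow]
  · rw [norm_signedPow_of_ne_zero ha, hx]

/-- Only an inequality: the value at a = 0 is 0, while the modulus is 1 elsewhere. -/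
theorem norm_signedPow_le_one {a E : ℂ} (hE : 1 + E.re = 0) : ‖signedPow a E‖ ≤ 1 := by
  by_cases ha : a = 0
  · subst ha
    simp [signedPow]
  · rw [norm_signedPow_of_ne_zero ha, hE, Real.rpow_zero]

theorem signedPow_zero_right (a : ℂ) : signedPow a 0 = a := by
  simp [signedPow]

theorem stripBounded_signedPow (lam : ℝ) (a : ℂ) (σ c : ℝ) :
    StripBounded lam fun z => signedPow a (σ * z + c) := by
  by_cases ha : a = 0
  · subst ha
    simpa [signedPow] using stripBounded_const (lam := lam) 0
  have h : 0 < ‖a‖ := norm_pos_iff.2 ha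
  have hd : Differentiable ℂ fun z : ℂ => signedPow a (σ * z + c) := by
    intro z
    refine DifferentiableAt.const_mul (DifferentiableAt.const_cpow (by fun_prop) (Or.inl ?_)) _
    exact_mod_cast h.ne'
  refine ⟨hd.diffContOnCl, Real.exp (|Real.log ‖a‖| * (1 + |σ| * lam + |c|)),
    fun z hz1 hz2 => ?_⟩
  rw [norm_signedPow_of_ne_zero ha, Real.rpow_def_of_pos h, Real.exp_le_exp]
  refine (le_abs_self _).trans ?_
  rw [abs_mul]
  refine mul_le_mul_of_nonneg_left ?_ (abs_nonneg _)
  have h1 : ((σ : ℂ) * z + c).re = σ * z.re + c := by simp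
  rw [h1]
  have h2 : |z.re| ≤ lam := abs_le.2 ⟨hz1, by linarith⟩
  calc |1 + (σ * z.re + c)| ≤ |1| + |σ * z.re + c| := abs_add_le _ _
    _ ≤ |1| + (|σ * z.re| + |c|) := by gcongr; exact abs_add_le _ _
    _ = 1 + (|σ| * |z.re| + |c|) := by rw [abs_one, abs_mul]
    _ ≤ 1 + |σ| * lam + |c| := by
      have := mul_le_mul_of_nonneg_left h2 (abs_nonneg σ)
      linarith

end SignedPowers

/-! ### Multiplication by functions of a simple function, cut off to a cylinder. -/

section LocalizedMultipliers

/-- The bounded cylinder `{(t, x) : |x| ≤ R}`. -/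
def cylinder (n : ℕ) (R : ℝ) : Set (TX n) := {q | ‖q.2‖ ≤ R}

theorem measurableSet_cylinder (R : ℝ) : MeasurableSet (cylinder n R) :=
  (isClosed_le (by fun_prop) continuous_const).measurableSet

theorem volume_cylinder_lt_top (R : ℝ) : volume (cylinder n R) < ⊤ := by
  have h : cylinder n R = Set.univ ×ˢ Metric.closedBall 0 R := by
    ext q
    simp [cylinder]
  rw [h, Measure.volume_eq_prod, Measure.prod_prod]
  exact ENNReal.mul_lt_top (measure_lt_top _ _) Metric.isBounded_closedBall.measure_lt_top

theorem exists_norm_comp_simpleFunc_le (W : SimpleFunc (TX n) ℂ) (P : ℂ → ℂ) :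
    ∃ C, ∀ q, ‖P (W q)‖ ≤ C := by
  obtain ⟨C, hC⟩ := (W.map P).exists_forall_norm_le
  exact ⟨C, hC⟩

theorem memLp_indicator_cylinder {P : ℂ → ℂ} (W : SimpleFunc (TX n) ℂ) (R : ℝ) (p : ENNReal) :
    MemLp ((cylinder n R).indicator fun q => P (W q)) p volume := by
  obtain ⟨C, hC⟩ := exists_norm_comp_simpleFunc_le W P
  rw [memLp_indicator_iff_restrict (measurableSet_cylinder R)]
  have : IsFiniteMeasure (volume.restrict (cylinder n R)) :=
    isFiniteMeasure_restrict.2 (volume_cylinder_lt_top R).ne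
  exact MemLp.of_bound (W.map P).aestronglyMeasurable C (ae_of_all _ hC)

theorem memLp_top_weighted (W : SimpleFunc (TX n) ℂ) (R : ℝ) (P : ℂ → ℂ) :
    MemLp ((cylinder n R).indicator fun q => (weight q : ℂ) * P (W q)) ⊤ volume := by
  obtain ⟨C, hC⟩ := exists_norm_comp_simpleFunc_le W P
  refine memLp_top_of_bound (AEStronglyMeasurable.indicator ?_ (measurableSet_cylinder R))
    (Real.exp (4⁻¹ * R ^ 2) * C) (ae_of_all _ fun q => ?_)
  · exact (Complex.continuous_ofReal.comp continuous_weight).aestronglyMeasurable.mul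
      (W.map P).aestronglyMeasurable
  · have hC0 : 0 ≤ C := (norm_nonneg _).trans (hC q)
    by_cases hq : q ∈ cylinder n R
    · rw [Set.indicator_of_mem hq, norm_mul, Complex.norm_real,
        Real.norm_of_nonneg (weight_pos q).le]
      refine mul_le_mul (Real.exp_le_exp.2 ?_) (hC q) (norm_nonneg _) (Real.exp_pos _).le
      exact mul_le_mul_of_nonneg_left (pow_le_pow_left₀ (norm_nonneg _) hq 2) (by norm_num)
    · rw [Set.indicator_of_notMem hq, norm_zero]
      positivity

/-- Multiplication by `1_{|x| ≤ R} e^{|x|²/4} P(W)`, for a simple function `W`. -/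
def weightedMul (W : SimpleFunc (TX n) ℂ) (R : ℝ) (P : ℂ → ℂ) : L2TX n →L[ℂ] L2TX n :=
  mulL2 (memLp_top_weighted W R P)

theorem coeFn_weightedMul (W : SimpleFunc (TX n) ℂ) (R : ℝ) (P : ℂ → ℂ) (e : L2TX n) :
    weightedMul W R P e =ᵐ[volume]
      fun q => (weight q : ℂ) * (cylinder n R).indicator (fun q => P (W q)) q * e q := by
  filter_upwards [coeFn_mulL2 (memLp_top_weighted W R P) e] with q h
  rw [weightedMul, h]
  by_cases hq : q ∈ cylinder n R
  · simp [Set.indicator_of_mem hq]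
  · simp [Set.indicator_of_notMem hq]

theorem coeFn_divWeight_weightedMul (W : SimpleFunc (TX n) ℂ) (R : ℝ) (P : ℂ → ℂ) (e : L2TX n) :
    divWeight (weightedMul W R P e) =ᵐ[volume]
      fun q => (cylinder n R).indicator (fun q => P (W q)) q * e q := by
  filter_upwards [coeFn_divWeight (weightedMul W R P e), coeFn_weightedMul W R P e] with q h1 h2
  rw [h1, h2, ← mul_assoc, ← mul_assoc, weight_inv_mul_weight, one_mul]

theorem norm_divWeight_weightedMul_le (W : SimpleFunc (TX n) ℂ) (R : ℝ) {P : ℂ → ℂ}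
    (hP : ∀ w, ‖P w‖ ≤ 1) (e : L2TX n) : ‖divWeight (weightedMul W R P e)‖ ≤ ‖e‖ := by
  refine Lp.norm_le_norm_of_ae_le ?_
  filter_upwards [coeFn_divWeight_weightedMul W R P e] with q h
  rw [h, norm_mul]
  refine mul_le_of_le_one_left (norm_nonneg _) ?_
  by_cases hq : q ∈ cylinder n R
  · rw [Set.indicator_of_mem hq]
    exact hP _
  · rw [Set.indicator_of_notMem hq, norm_zero]
    exact zero_le_one

/-- A simple function has finite range. This moves the dependence on z, carried by P, from the
vectors into scalar coefficients of finitely many fixed vectors. -/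
theorem sum_smul_weightedMul (W : SimpleFunc (TX n) ℂ) (R : ℝ) (P : ℂ → ℂ) (e : L2TX n) :
    ∑ w ∈ W.range, P w • weightedMul W R (Pi.single w 1) e = weightedMul W R P e := by
  have h : ∀ F : Finset ℂ, ∑ w ∈ F, P w • weightedMul W R (Pi.single w 1) e =
      weightedMul W R (fun x => if x ∈ F then P x else 0) e := by
    intro F
    induction F using Finset.induction_on with
    | empty =>
      refine Lp.ext ?_
      filter_upwards [coeFn_weightedMul W R (fun x => if x ∈ (∅ : Finset ℂ) then P x else 0) e,
        Lp.coeFn_zero ℂ 2 (volume : Measure (TX n))] with q h1 h2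
      rw [h1, Finset.sum_empty, h2]
      simp
    | insert w F hw ih =>
      rw [Finset.sum_insert hw, ih]
      refine Lp.ext ?_
      filter_upwards [coeFn_weightedMul W R (fun x => if x ∈ insert w F then P x else 0) e,
        coeFn_weightedMul W R (fun x => if x ∈ F then P x else 0) e,
        coeFn_weightedMul W R (Pi.single w 1) e,
        Lp.coeFn_add (P w • weightedMul W R (Pi.single w 1) e)
          (weightedMul W R (fun x => if x ∈ F then P x else 0) e),
        Lp.coeFn_smul (P w) (weightedMul W R (Pi.single w 1) e)] with q h1 h2 h3 h4 h5
      rw [h1, h4, Pi.add_apply, h5, Pi.smul_apply, h2, h3]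
      by_cases hq : q ∈ cylinder n R
      · simp only [Set.indicator_of_mem hq, Finset.mem_insert, Pi.single_apply, smul_eq_mul]
        by_cases h6 : W q = w
        · rw [h6]
          simp [hw]
          ring
        · simp [h6]
      · simp [Set.indicator_of_notMem hq]
  rw [h]
  refine Lp.ext ?_
  filter_upwards [coeFn_weightedMul W R (fun x => if x ∈ W.range then P x else 0) e,
    coeFn_weightedMul W R P e] with q h1 h2
  rw [h1, h2]
  simp

theorem eLpNorm_two_indicator_signedPow (W : SimpleFunc (TX n) ℂ) (R : ℝ) {lam : ℝ}
    (hlam : 0 < lam) {E : ℂ} (hE : 1 + E.re = lam) :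
    (eLpNorm ((cylinder n R).indicator fun q => signedPow (W q) E) 2 volume).toReal =
      (eLpNorm ((cylinder n R).indicator W) (ENNReal.ofReal (2 * lam)) volume).toReal ^ lam := by
  have h1 : eLpNorm ((cylinder n R).indicator fun q => signedPow (W q) E) 2 volume =
      eLpNorm (fun q => ‖(cylinder n R).indicator W q‖ ^ lam) 2 volume := by
    refine eLpNorm_congr_norm_ae (ae_of_all _ fun q => ?_)
    rw [Real.norm_of_nonneg (by positivity)]
    by_cases hq : q ∈ cylinder n R
    · rw [Set.indicator_of_mem hq, Set.indicator_of_mem hq, norm_signedPow hE hlam.ne']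
    · rw [Set.indicator_of_notMem hq, Set.indicator_of_notMem hq, norm_zero,
        Real.zero_rpow hlam.ne']
  rw [h1, eLpNorm_norm_rpow _ hlam, ENNReal.toReal_rpow]
  congr 3
  rw [ENNReal.ofReal_mul (by norm_num)]
  simp

end LocalizedMultipliers

variable {n : ℕ}

/-! ### The interpolation argument. -/

section Interpolation

/-- The domain on which the forms are given: the two boundary lines and the point `-1`. -/
def boundaryAndNegOne (lam : ℝ) : Set ℂ := {z | z.re = -lam ∨ z.re = 0 ∨ z = -1}

/-- The form is chosen separately at each point of the lines and at -1, and is zero elsewhere. Forms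
at different z are related only through their entries in the weighted modes, and there holomorphy
enters. -/
theorem exists_boundary_forms {S : Set ((Fin n → ℕ) × ℤ)} {lam M : ℝ} (hlam : 1 < lam)
    {g : ℂ → (Fin n → ℕ) × ℤ → ℂ} (hg : IsRegularFamily S lam M g) {T : L2TX n →L[ℂ] L2TX n}
    (hT : ∀ i j, inner ℂ (modeL2 i) (T (modeL2 j)) =
      if i = j then (2 * Real.pi : ℂ) ^ 2 * S.indicator (fun _ => (1 : ℂ)) i else 0) :
    ∃ (b : ℂ → L2TX n →ₗ⋆[ℂ] L2TX n →ₗ[ℂ] ℂ) (C : ℝ),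
      (∀ z ∈ boundaryAndNegOne lam, ExtendsDiagonal (g z) (b z)) ∧
      (∀ z ∈ boundaryAndNegOne lam, ∀ v u, ‖b z v u‖ ≤ C * ‖v‖ * ‖u‖) ∧
      (∀ z : ℂ, z.re = 0 →
        ∀ v u, ‖b z v u‖ ≤ 2 * Real.pi * M * ‖divWeight v‖ * ‖divWeight u‖) ∧
      (∀ z : ℂ, z.re = -lam → HilbertSchmidtBound M (b z)) ∧
      ∀ v u, b (-1) v u = inner ℂ (divWeight v) (T (divWeight u)) := by
  have hM := hg.nonneg
  have hpi := Real.pi_pos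
  let c := (eLpNorm (fun q : TX n => (((weight q)⁻¹ : ℝ) : ℂ)) 2 volume).toReal
  let C : ℝ := 2 * Real.pi * M + M * c ^ 2 + ‖T‖
  have hC1 : 2 * Real.pi * M ≤ C := by
    have : 0 ≤ M * c ^ 2 + ‖T‖ := by positivity
    linarith
  have hC2 : M * c ^ 2 ≤ C := by
    have : 0 ≤ 2 * Real.pi * M + ‖T‖ := by positivity
    linarith
  have hC3 : ‖T‖ ≤ C := by
    have : 0 ≤ 2 * Real.pi * M + M * c ^ 2 := by positivity
    linarith
  have hC0 : 0 ≤ C := (norm_nonneg _).trans hC3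
  have hdiv : ∀ (a : ℝ), 0 ≤ a → ∀ v u : L2TX n,
      a * ‖divWeight v‖ * ‖divWeight u‖ ≤ a * ‖v‖ * ‖u‖ := by
    intro a ha v u
    have := norm_divWeight_le v
    have := norm_divWeight_le u
    gcongr
  have h : ∀ z : ℂ, ∃ b : L2TX n →ₗ⋆[ℂ] L2TX n →ₗ[ℂ] ℂ, (z ∈ boundaryAndNegOne lam →
      ExtendsDiagonal (g z) b ∧ ∀ v u, ‖b v u‖ ≤ C * ‖v‖ * ‖u‖) ∧
      (z.re = 0 → ∀ v u, ‖b v u‖ ≤ 2 * Real.pi * M * ‖divWeight v‖ * ‖divWeight u‖) ∧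
      (z.re = -lam → HilbertSchmidtBound M b) ∧
      (z = -1 → ∀ v u, b v u = inner ℂ (divWeight v) (T (divWeight u))) := by
    intro z
    by_cases h0 : z.re = 0
    · obtain ⟨b, hb1, hb2⟩ := exists_form_of_bounded hM (hg.right z h0)
      refine ⟨b, fun _ => ⟨hb1, fun v u => ?_⟩, fun _ => hb2, fun h1 => ?_, fun h1 => ?_⟩
      · refine (hb2 v u).trans ((hdiv _ (by positivity) v u).trans ?_)
        gcongr
      · linarith
      · simp [h1] at h0
    by_cases h1 : z.re = -lam
    · obtain ⟨K, hK⟩ := hg.left z h1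
      obtain ⟨b, hb1, hb2, hb3⟩ := exists_form_of_kernel hK
      refine ⟨b, fun _ => ⟨hb1, fun v u => (hb2 v u).trans ?_⟩, fun h => absurd h h0, fun _ => hb3,
        fun h2 => ?_⟩
      · gcongr
      · rw [h2] at h1
        simp at h1
        linarith
    by_cases h2 : z = -1
    · obtain ⟨b, hb1, hb2⟩ := exists_form_of_operator (g := g z) T (fun i j => by
        rw [hT, h2, hg.neg_one])
      refine ⟨b, fun _ => ⟨hb1, fun v u => ?_⟩, fun h => absurd h h0, fun h => absurd h h1,
        fun _ => hb2⟩
      rw [hb2]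
      calc ‖inner ℂ (divWeight v) (T (divWeight u))‖
          ≤ ‖divWeight v‖ * ‖T (divWeight u)‖ := norm_inner_le_norm _ _
        _ ≤ ‖divWeight v‖ * (‖T‖ * ‖divWeight u‖) := by
          gcongr
          exact T.le_opNorm _
        _ = ‖T‖ * ‖divWeight v‖ * ‖divWeight u‖ := by ring
        _ ≤ ‖T‖ * ‖v‖ * ‖u‖ := hdiv _ (norm_nonneg _) v u
        _ ≤ C * ‖v‖ * ‖u‖ := by gcongr
    · refine ⟨0, fun h => ?_, fun h => absurd h h0, fun h => absurd h h1, fun h => absurd h h2⟩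
      rcases h with h | h | h
      · exact absurd h h1
      · exact absurd h h0
      · exact absurd h h2
  choose b hb using h
  exact ⟨b, C, fun z hz => ((hb z).1 hz).1, fun z hz => ((hb z).1 hz).2, fun z => (hb z).2.1,
    fun z => (hb z).2.2.1, (hb (-1)).2.2.2 rfl⟩

/-- The interpolating function for the powers of two simple functions. -/
theorem exists_interpolating_function {S : Set ((Fin n → ℕ) × ℤ)} {lam M C : ℝ} (hlam : 1 < lam)
    {g : ℂ → (Fin n → ℕ) × ℤ → ℂ} (hg : IsRegularFamily S lam M g)
    {b : ℂ → L2TX n →ₗ⋆[ℂ] L2TX n →ₗ[ℂ] ℂ}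
    (hb1 : ∀ z ∈ boundaryAndNegOne lam, ExtendsDiagonal (g z) (b z))
    (hb2 : ∀ z ∈ boundaryAndNegOne lam, ∀ v u, ‖b z v u‖ ≤ C * ‖v‖ * ‖u‖)
    (W₁ W₂ : SimpleFunc (TX n) ℂ) (R : ℝ) {N : ℕ} (e f : Fin N → L2TX n) (a : Fin N → ℂ) :
    ∃ F : ℂ → ℂ, StripBounded lam F ∧ ∀ z ∈ boundaryAndNegOne lam,
      F z = ∑ k, signedPow ((starRingEnd ℂ) (a k)) (z + (2 * lam - 1 : ℝ)) *
        b z (weightedMul W₁ R (fun w => (starRingEnd ℂ) (signedPow w (-(z + 1)))) (f k))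
          (weightedMul W₂ R (fun w => signedPow w (-(z + 1))) (e k)) := by
  have hext : ∀ v u, ∃ f, StripBounded lam f ∧ ∀ z ∈ boundaryAndNegOne lam, f z = b z v u := by
    classical
    refine exists_stripBounded_extension hlam dense_span_weightedMode
      (fun z hz => ?_) (fun z hz => ?_) b hb2
      (q := fun i j z => if i = j then (2 * Real.pi : ℂ) ^ 2 * g z i else 0) (fun i j => ?_)
      (fun z hz i j => hb1 z hz i j)
    · rcases hz with hz | hz
      · exact Or.inl hz
      · exact Or.inr (Or.inl hz)
    · rcases hz with hz | hz | hz
      · rw [hz]; constructor <;> linarith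
      · rw [hz]; constructor <;> linarith
      · rw [hz]; constructor <;> simp; linarith
    · by_cases h : i = j
      · simp only [if_pos h]
        exact (stripBounded_const _).mul (hg.strip i)
      · simp only [if_neg h]
        exact stripBounded_const 0
  choose Q hQ hQb using hext
  have hpow : ∀ w : ℂ, StripBounded lam fun z => signedPow w (-(z + 1)) := by
    intro w
    convert stripBounded_signedPow lam w (-1) (-1) using 3
    push_cast
    ring
  have hcoef : ∀ w : ℂ, StripBounded lam fun z => signedPow w (z + (2 * lam - 1 : ℝ)) := by
    intro w
    convert stripBounded_signedPow lam w 1 (2 * lam - 1) using 3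
    push_cast
    ring
  refine ⟨fun z => ∑ k, signedPow ((starRingEnd ℂ) (a k)) (z + (2 * lam - 1 : ℝ)) *
    ∑ w ∈ W₁.range, ∑ w' ∈ W₂.range, signedPow w (-(z + 1)) * (signedPow w' (-(z + 1)) *
      Q (weightedMul W₁ R (Pi.single w 1) (f k)) (weightedMul W₂ R (Pi.single w' 1) (e k)) z),
    StripBounded.sum _ fun k _ => (hcoef _).mul (StripBounded.sum _ fun w _ =>
      StripBounded.sum _ fun w' _ => (hpow w).mul ((hpow w').mul (hQ _ _))), fun z hz => ?_⟩
  refine Finset.sum_congr rfl fun k _ => ?_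
  congr 1
  rw [← sum_smul_weightedMul W₁, ← sum_smul_weightedMul W₂]
  simp only [map_sum, LinearMap.sum_apply]
  rw [Finset.sum_comm]
  refine Finset.sum_congr rfl fun w' _ => Finset.sum_congr rfl fun w _ => ?_
  -- The form is conjugate linear in its first argument, so the conjugated power comes out
  -- unconjugated, and holomorphic in z.
  rw [hQb _ _ z hz, map_smul, LinearMap.map_smulₛₗ₂, Complex.conj_conj, smul_eq_mul, smul_eq_mul]
  ring

/-- The powers of x on the right add up to 1/(2 lam) + 1 - 1/lam = 1 - 1/(2 lam) < 1, so for x > 0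
they can be divided out. -/
theorem le_rpow_of_le_interpolation {lam x c₀ c₁ r : ℝ} (hlam : 1 < lam) (hx : 0 ≤ x)
    (hc₀ : 0 ≤ c₀) (hc₁ : 0 ≤ c₁) (hr : 0 ≤ r)
    (h : x ≤ (Real.sqrt x * (c₁ * r ^ lam)) ^ (1 / lam) * (x * c₀) ^ (1 - 1 / lam)) :
    x ≤ (c₁ ^ (1 / lam) * c₀ ^ (1 - 1 / lam) * r) ^ (2 * lam) := by
  have hl : 0 < lam := by linarith
  rcases hx.eq_or_lt with h0 | h0
  · rw [← h0]
    positivity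
  have h1 : 0 ≤ 1 - 1 / lam := by
    rw [sub_nonneg, div_le_one hl]
    exact hlam.le
  have h2 : (Real.sqrt x * (c₁ * r ^ lam)) ^ (1 / lam) * (x * c₀) ^ (1 - 1 / lam) =
      x ^ (1 - 1 / (2 * lam)) * (c₁ ^ (1 / lam) * c₀ ^ (1 - 1 / lam) * r) := by
    rw [Real.mul_rpow (Real.sqrt_nonneg _) (by positivity), Real.mul_rpow hc₁ (by positivity),
      Real.mul_rpow hx hc₀, Real.sqrt_eq_rpow, ← Real.rpow_mul hx, ← Real.rpow_mul hr,
      mul_one_div_cancel hl.ne', Real.rpow_one]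
    have h3 : x ^ (1 - 1 / (2 * lam)) = x ^ (1 / 2 * (1 / lam)) * x ^ (1 - 1 / lam) := by
      rw [← Real.rpow_add h0]
      congr 1
      field_simp
      ring
    rw [h3]
    ring
  rw [h2] at h
  have h3 : x ^ (1 - 1 / (2 * lam)) * x ^ (1 / (2 * lam)) = x := by
    rw [← Real.rpow_add h0]
    simp
  have h4 : x ^ (1 / (2 * lam)) ≤ c₁ ^ (1 / lam) * c₀ ^ (1 - 1 / lam) * r := by
    have h5 : 0 < x ^ (1 - 1 / (2 * lam)) := Real.rpow_pos_of_pos h0 _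
    nth_rewrite 1 [← h3] at h
    exact le_of_mul_le_mul_left h h5
  calc x = (x ^ (1 / (2 * lam))) ^ (2 * lam) := by
        rw [← Real.rpow_mul hx, one_div_mul_cancel (by positivity), Real.rpow_one]
    _ ≤ _ := Real.rpow_le_rpow (by positivity) h4 (by positivity)

/-- The constant of the interpolated inequality. -/
def interpolationConst (lam M : ℝ) : ℝ := M ^ (1 / lam) * (2 * Real.pi * M) ^ (1 - 1 / lam)

theorem interpolationConst_nonneg {lam M : ℝ} (hM : 0 ≤ M) : 0 ≤ interpolationConst lam M := by
  have := Real.pi_pos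
  unfold interpolationConst
  positivity

/-- The interpolated Schatten inequality for simple functions supported in a cylinder. -/
theorem sum_norm_inner_rpow_le {S : Set ((Fin n → ℕ) × ℤ)} {lam M : ℝ} (hlam : 1 < lam)
    {g : ℂ → (Fin n → ℕ) × ℤ → ℂ} (hg : IsRegularFamily S lam M g) {T : L2TX n →L[ℂ] L2TX n}
    (hT : ∀ i j, inner ℂ (modeL2 i) (T (modeL2 j)) =
      if i = j then (2 * Real.pi : ℂ) ^ 2 * S.indicator (fun _ => (1 : ℂ)) i else 0)
    (W₁ W₂ : SimpleFunc (TX n) ℂ) (R : ℝ) {N : ℕ} {e f v u : Fin N → L2TX n}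
    (he : Orthonormal ℂ e) (hf : Orthonormal ℂ f)
    (hv : ∀ k, (v k : TX n → ℂ) =ᵐ[volume]
      fun q => (starRingEnd ℂ) ((cylinder n R).indicator W₁ q) * f k q)
    (hu : ∀ k, (u k : TX n → ℂ) =ᵐ[volume] fun q => (cylinder n R).indicator W₂ q * e k q) :
    ∑ k, ‖inner ℂ (v k) (T (u k))‖ ^ (2 * lam) ≤ (interpolationConst lam M *
      ((eLpNorm ((cylinder n R).indicator W₁) (ENNReal.ofReal (2 * lam)) volume).toReal *
        (eLpNorm ((cylinder n R).indicator W₂) (ENNReal.ofReal (2 * lam)) volume).toReal)) ^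
          (2 * lam) := by
  have hM := hg.nonneg
  have hpi := Real.pi_pos
  have hl : 0 < lam := by linarith
  obtain ⟨b, C, hb1, hb2, hb3, hb4, hb5⟩ := exists_boundary_forms hlam hg hT
  let a : Fin N → ℂ := fun k => inner ℂ (v k) (T (u k))
  obtain ⟨F, hF, hFb⟩ := exists_interpolating_function hlam hg hb1 hb2 W₁ W₂ R e f a
  let x : ℝ := ∑ k, ‖a k‖ ^ (2 * lam)
  have hx : 0 ≤ x := Finset.sum_nonneg fun k _ => by positivity
  let r₁ := (eLpNorm ((cylinder n R).indicator W₁) (ENNReal.ofReal (2 * lam)) volume).toReal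
  let r₂ := (eLpNorm ((cylinder n R).indicator W₂) (ENNReal.ofReal (2 * lam)) volume).toReal
  -- At -1 the weights are W₁ and W₂ themselves, and each coefficient is conj(a_k) |a_k|^{2 lam -
  -- 2}, which multiplied by a_k gives |a_k|^{2 lam}.
  have hF1 : F (-1) = (x : ℂ) := by
    rw [hFb (-1) (Or.inr (Or.inr rfl))]
    simp only [x, Complex.ofReal_sum]
    refine Finset.sum_congr rfl fun k _ => ?_
    have hz : -((-1 : ℂ) + 1) = 0 := by ring
    rw [hb5]
    simp only [hz, signedPow_zero_right]
    have h1 : divWeight (weightedMul W₁ R (fun w => (starRingEnd ℂ) w) (f k)) = v k := by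
      refine Lp.ext ?_
      filter_upwards [coeFn_divWeight_weightedMul W₁ R (fun w => (starRingEnd ℂ) w) (f k), hv k]
        with q h1 h2
      rw [h1, h2]
      by_cases hq : q ∈ cylinder n R
      · simp [Set.indicator_of_mem hq]
      · simp [Set.indicator_of_notMem hq]
    have h2 : divWeight (weightedMul W₂ R (fun w => w) (e k)) = u k := by
      refine Lp.ext ?_
      filter_upwards [coeFn_divWeight_weightedMul W₂ R (fun w => w) (e k), hu k] with q h1 h2
      rw [h1, h2]
    rw [h1, h2]
    change _ * a k = _
    by_cases ha : a k = 0
    · rw [ha, mul_zero, norm_zero, Real.zero_rpow (by positivity), Complex.ofReal_zero]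
    · have hpos : 0 < ‖a k‖ := norm_pos_iff.2 ha
      rw [signedPow, mul_right_comm, Complex.conj_mul', RCLike.norm_conj]
      rw [show (-1 + ((2 * lam - 1 : ℝ) : ℂ)) = ((2 * lam - 2 : ℝ) : ℂ) by push_cast; ring,
        ← Complex.ofReal_cpow hpos.le, ← Complex.ofReal_pow, ← Complex.ofReal_mul,
        ← Real.rpow_natCast, ← Real.rpow_add hpos]
      congr 2
      push_cast
      ring
  -- On this line the coefficients have modulus |a_k|^{2 lam}, the weights modulus at most 1, and
  -- the vectors e_k, f_k norm 1.
  have hF0 : ∀ z : ℂ, z.re = 0 → ‖F z‖ ≤ x * (2 * Real.pi * M) := by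
    intro z hz
    rw [hFb z (Or.inr (Or.inl hz)), Finset.sum_mul]
    refine (norm_sum_le _ _).trans (Finset.sum_le_sum fun k _ => ?_)
    rw [norm_mul, norm_signedPow (x := 2 * lam) (by simp [hz]) (by positivity), RCLike.norm_conj]
    refine mul_le_mul_of_nonneg_left ((hb3 z hz _ _).trans ?_) (by positivity)
    have hexp : 1 + (-(z + 1)).re = 0 := by simp [hz]
    have h1 : ‖divWeight (weightedMul W₁ R
        (fun w => (starRingEnd ℂ) (signedPow w (-(z + 1)))) (f k))‖ ≤ 1 := by
      refine (norm_divWeight_weightedMul_le W₁ R (fun w => ?_) _).trans (hf.1 k).le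
      rw [RCLike.norm_conj]
      exact norm_signedPow_le_one hexp
    have h2 : ‖divWeight (weightedMul W₂ R (fun w => signedPow w (-(z + 1))) (e k))‖ ≤ 1 :=
      (norm_divWeight_weightedMul_le W₂ R (fun w => norm_signedPow_le_one hexp) _).trans
        (he.1 k).le
    calc 2 * Real.pi * M * _ * _ ≤ 2 * Real.pi * M * 1 * 1 := by gcongr
      _ = 2 * Real.pi * M := by ring
  -- On this line the coefficients have modulus |a_k|^lam, so Cauchy-Schwarz splits off √x and
  -- leaves the Hilbert-Schmidt sum with weights |W_i|^lam.
  have hFl : ∀ z : ℂ, z.re = -lam → ‖F z‖ ≤ Real.sqrt x * (M * (r₁ * r₂) ^ lam) := by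
    intro z hz
    have hexp : 1 + (-(z + 1)).re = lam := by simp [hz]
    rw [hFb z (Or.inl hz)]
    refine (norm_sum_le _ _).trans ?_
    simp only [norm_mul]
    refine (Real.sum_mul_le_sqrt_mul_sqrt _ _ _).trans ?_
    have h1 : ∀ k, ‖signedPow ((starRingEnd ℂ) (a k)) (z + (2 * lam - 1 : ℝ))‖ ^ 2 =
        ‖a k‖ ^ (2 * lam) := by
      intro k
      rw [norm_signedPow (x := lam) (by simp [hz]; ring) hl.ne', RCLike.norm_conj,
        ← Real.rpow_natCast, ← Real.rpow_mul (norm_nonneg _)]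
      congr 1
      push_cast
      ring
    simp only [h1]
    refine mul_le_mul_of_nonneg_left ?_ (Real.sqrt_nonneg _)
    refine Real.sqrt_le_iff.2 ⟨by positivity, ?_⟩
    have h2 := hb4 z hz _ _
      (memLp_indicator_cylinder (P := fun w => signedPow w (-(z + 1))) W₁ R 2)
      (memLp_indicator_cylinder (P := fun w => signedPow w (-(z + 1))) W₂ R 2) N e f
      (fun k => weightedMul W₁ R (fun w => (starRingEnd ℂ) (signedPow w (-(z + 1)))) (f k))
      (fun k => weightedMul W₂ R (fun w => signedPow w (-(z + 1))) (e k)) he hf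
      (fun k => by
        filter_upwards [coeFn_weightedMul W₁ R
          (fun w => (starRingEnd ℂ) (signedPow w (-(z + 1)))) (f k)] with q h
        rw [h]
        by_cases hq : q ∈ cylinder n R
        · simp [Set.indicator_of_mem hq]
        · simp [Set.indicator_of_notMem hq])
      (fun k => coeFn_weightedMul W₂ R (fun w => signedPow w (-(z + 1))) (e k))
    rw [eLpNorm_two_indicator_signedPow W₁ R hl hexp,
      eLpNorm_two_indicator_signedPow W₂ R hl hexp] at h2
    rwa [Real.mul_rpow ENNReal.toReal_nonneg ENNReal.toReal_nonneg]
  have h := hF.norm_neg_one_le hlam hF0 hFl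
  rw [hF1, Complex.norm_real, Real.norm_of_nonneg hx] at h
  exact le_rpow_of_le_interpolation hlam hx (by positivity) hM (by positivity) h

end Interpolation

/-! ### Dominated convergence in L^p. -/

section DominatedConvergence

open Filter Topology

variable {X : Type*} [MeasurableSpace X] {μ : Measure X}

theorem tendsto_eLpNorm_sub_of_norm_le {p : ENNReal} (hp0 : p ≠ 0) (hp : p ≠ ⊤) {F : ℕ → X → ℂ}
    {f : X → ℂ} {C : NNReal} (hF : ∀ m, AEStronglyMeasurable (F m) μ) (hf : MemLp f p μ)
    (hFf : ∀ m, ∀ᵐ x ∂μ, ‖F m x‖ₑ ≤ C * ‖f x‖ₑ)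
    (hlim : ∀ᵐ x ∂μ, Tendsto (fun m => F m x) atTop (𝓝 (f x))) :
    Tendsto (fun m => eLpNorm (F m - f) p μ) atTop (𝓝 0) := by
  have hpos : 0 < p.toReal := ENNReal.toReal_pos hp0 hp
  have h : Tendsto (fun m => ∫⁻ x, ‖(F m - f) x‖ₑ ^ p.toReal ∂μ) atTop (𝓝 (∫⁻ _, 0 ∂μ)) := by
    refine tendsto_lintegral_of_dominated_convergence'
      (fun x => ((C + 1) * ‖f x‖ₑ) ^ p.toReal) (fun m => ?_) (fun m => ?_) ?_ ?_
    · exact (((hF m).sub hf.1).enorm).pow_const _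
    · filter_upwards [hFf m] with x hx
      refine ENNReal.rpow_le_rpow ?_ hpos.le
      calc ‖(F m - f) x‖ₑ ≤ ‖F m x‖ₑ + ‖f x‖ₑ := enorm_sub_le
        _ ≤ C * ‖f x‖ₑ + ‖f x‖ₑ := by gcongr
        _ = (C + 1) * ‖f x‖ₑ := by rw [add_mul, one_mul]
    · simp_rw [ENNReal.mul_rpow_of_nonneg _ _ hpos.le]
      rw [lintegral_const_mul' _ _ (by finiteness)]
      exact ENNReal.mul_ne_top (by finiteness)
        (lintegral_rpow_enorm_lt_top_of_eLpNorm_lt_top hp0 hp hf.2).ne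
    · filter_upwards [hlim] with x hx
      have h1 : Tendsto (fun m => ‖(F m - f) x‖ₑ) atTop (𝓝 0) := by
        have := (hx.sub_const (f x)).enorm
        simpa using this
      have h2 := ((ENNReal.continuous_rpow_const (y := p.toReal)).tendsto 0).comp h1
      rwa [ENNReal.zero_rpow_of_pos hpos] at h2
  rw [lintegral_zero] at h
  have h2 := ((ENNReal.continuous_rpow_const (y := 1 / p.toReal)).tendsto 0).comp h
  rw [ENNReal.zero_rpow_of_pos (by positivity)] at h2
  refine h2.congr fun m => ?_
  rw [eLpNorm_eq_lintegral_rpow_enorm_toReal hp0 hp]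
  rfl

end DominatedConvergence

/-! ### The estimate for simple weights, and approximation by them. -/

section SimpleMultiplication

variable {n : ℕ}

/-- Multiplication by a simple function. -/
def simpleMul (W : SimpleFunc (TX n) ℂ) : L2TX n →L[ℂ] L2TX n := mulL2 (W.memLp_top volume)

theorem coeFn_simpleMul (W : SimpleFunc (TX n) ℂ) (f : L2TX n) :
    simpleMul W f =ᵐ[volume] fun q => W q * f q :=
  coeFn_mulL2 _ f

theorem simpleMul_sub (W V : SimpleFunc (TX n) ℂ) :
    simpleMul (W - V) = simpleMul W - simpleMul V := by
  refine ContinuousLinearMap.ext fun f => Lp.ext ?_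
  filter_upwards [coeFn_simpleMul (W - V) f, coeFn_simpleMul W f, coeFn_simpleMul V f,
    Lp.coeFn_sub (simpleMul W f) (simpleMul V f)] with q h1 h2 h3 h4
  change _ = (simpleMul W f - simpleMul V f : L2TX n) q
  rw [h1, h4, Pi.sub_apply, h2, h3, SimpleFunc.coe_sub, Pi.sub_apply, sub_mul]

theorem inner_simpleMul (W : SimpleFunc (TX n) ℂ) (f g : L2TX n) :
    inner ℂ f (simpleMul W g) = inner ℂ (simpleMul (W.map (starRingEnd ℂ)) f) g := by
  rw [L2.inner_def, L2.inner_def]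
  refine integral_congr_ae ?_
  filter_upwards [coeFn_simpleMul W g, coeFn_simpleMul (W.map (starRingEnd ℂ)) f] with q h1 h2
  rw [h1, h2]
  simp only [RCLike.inner_apply, SimpleFunc.map_apply, map_mul, Complex.conj_conj]
  ring

/-- The simple function `W` vanishes off some cylinder. -/
def CylinderSupported (W : SimpleFunc (TX n) ℂ) : Prop :=
  ∃ R₀, ∀ R, R₀ ≤ R → (cylinder n R).indicator W = W

theorem CylinderSupported.sub {W V : SimpleFunc (TX n) ℂ} (hW : CylinderSupported W)
    (hV : CylinderSupported V) : CylinderSupported (W - V) := by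
  obtain ⟨R₁, h1⟩ := hW
  obtain ⟨R₂, h2⟩ := hV
  refine ⟨max R₁ R₂, fun R hR => ?_⟩
  rw [SimpleFunc.coe_sub, Set.indicator_sub', h1 R ((le_max_left _ _).trans hR),
    h2 R ((le_max_right _ _).trans hR)]

theorem CylinderSupported.memLp {W : SimpleFunc (TX n) ℂ} (hW : CylinderSupported W)
    (p : ENNReal) : MemLp W p volume := by
  obtain ⟨R, h⟩ := hW
  rw [← h R le_rfl]
  exact memLp_indicator_cylinder (P := id) W R p

theorem orthonormalSumBound_simple {S : Set ((Fin n → ℕ) × ℤ)} {lam M : ℝ} (hlam : 1 < lam)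
    {g : ℂ → (Fin n → ℕ) × ℤ → ℂ} (hg : IsRegularFamily S lam M g) {T : L2TX n →L[ℂ] L2TX n}
    (hT : ∀ i j, inner ℂ (modeL2 i) (T (modeL2 j)) =
      if i = j then (2 * Real.pi : ℂ) ^ 2 * S.indicator (fun _ => (1 : ℂ)) i else 0)
    (W₁ W₂ : SimpleFunc (TX n) ℂ) (h₁ : CylinderSupported W₁) (h₂ : CylinderSupported W₂) :
    OrthonormalSumBound (2 * lam) (interpolationConst lam M *
      ((eLpNorm W₁ (ENNReal.ofReal (2 * lam)) volume).toReal *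
        (eLpNorm W₂ (ENNReal.ofReal (2 * lam)) volume).toReal))
      (simpleMul W₁ ∘L T ∘L simpleMul W₂) := by
  intro N e f he hf
  obtain ⟨R₁, h1⟩ := h₁
  obtain ⟨R₂, h2⟩ := h₂
  have h := sum_norm_inner_rpow_le hlam hg hT W₁ W₂ (max R₁ R₂) he hf
    (v := fun k => simpleMul (W₁.map (starRingEnd ℂ)) (f k)) (u := fun k => simpleMul W₂ (e k))
    (fun k => by
      rw [h1 _ (le_max_left _ _)]
      exact coeFn_simpleMul _ _)
    (fun k => by
      rw [h2 _ (le_max_right _ _)]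
      exact coeFn_simpleMul _ _)
  rw [h1 _ (le_max_left _ _), h2 _ (le_max_right _ _)] at h
  simpa only [ContinuousLinearMap.comp_apply, inner_simpleMul] using h

/-- A measurable function is the limit of dominated simple functions supported in cylinders. -/
theorem exists_simple_approximation {W : TX n → ℂ} (hW : AEStronglyMeasurable W volume) :
    ∃ V : ℕ → SimpleFunc (TX n) ℂ, (∀ m, CylinderSupported (V m)) ∧
      (∀ᵐ q, ∀ m, ‖V m q‖ₑ ≤ (2 : NNReal) * ‖W q‖ₑ) ∧
      ∀ᵐ q, Filter.Tendsto (fun m => V m q) Filter.atTop (nhds (W q)) := by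
  obtain ⟨W', hW', hWW'⟩ := hW
  -- Approximating with base value 0 gives ‖U m‖ ≤ 2‖W'‖ pointwise; cutting off to the cylinder of
  -- radius m keeps this and the pointwise limit.
  let U : ℕ → SimpleFunc (TX n) ℂ :=
    SimpleFunc.approxOn W' hW'.measurable Set.univ 0 (Set.mem_univ _)
  have hV : ∀ (m : ℕ) q, ((U m).restrict (cylinder n m)) q = (cylinder n m).indicator (U m) q :=
    fun m q => by rw [SimpleFunc.restrict_apply _ (measurableSet_cylinder _)]
  refine ⟨fun m => (U m).restrict (cylinder n m), fun m => ⟨m, fun R hR => ?_⟩, ?_, ?_⟩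
  · refine Set.indicator_eq_self.2 fun q hq => ?_
    by_contra h
    refine hq ?_
    have h3 : q ∉ cylinder n m := fun h4 => h (le_trans (by exact h4) hR)
    rw [hV, Set.indicator_of_notMem h3]
  · filter_upwards [hWW'] with q hq m
    rw [hV, hq]
    refine (enorm_indicator_le_enorm_self _ _).trans ?_
    have := SimpleFunc.norm_approxOn_zero_le hW'.measurable (Set.mem_univ (0 : ℂ)) q m
    rw [← ofReal_norm, ← ofReal_norm]
    refine (ENNReal.ofReal_le_ofReal this).trans ?_
    rw [ENNReal.ofReal_add (norm_nonneg _) (norm_nonneg _), ← two_mul]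
    rfl
  · filter_upwards [hWW'] with q hq
    rw [hq]
    have h1 : Filter.Tendsto (fun m => U m q) Filter.atTop (nhds (W' q)) :=
      SimpleFunc.tendsto_approxOn hW'.measurable (Set.mem_univ _) (by simp)
    refine h1.congr' ?_
    obtain ⟨m₀, hm₀⟩ := exists_nat_ge ‖q.2‖
    filter_upwards [Filter.eventually_ge_atTop m₀] with m hm
    rw [hV, Set.indicator_of_mem]
    exact hm₀.trans (by exact_mod_cast hm)

end SimpleMultiplication

/-! ### Operator norm and limits under bounds on orthonormal sums. -/

section OperatorNorm

variable {H : Type*} [NormedAddCommGroup H] [InnerProductSpace ℂ H]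

/-- Systems of length one suffice: test on x/‖x‖ and A x/‖A x‖. -/
theorem OrthonormalSumBound.norm_le {r Q : ℝ} (hr : 0 < r) (hQ : 0 ≤ Q) {A : H →L[ℂ] H}
    (hA : OrthonormalSumBound r Q A) : ‖A‖ ≤ Q := by
  refine A.opNorm_le_bound hQ fun x => ?_
  by_cases hx : x = 0
  · simp [hx]
  by_cases hy : A x = 0
  · rw [hy, norm_zero]
    positivity
  have hx' := norm_pos_iff.2 hx
  have hy' := norm_pos_iff.2 hy
  have hon : ∀ z : H, z ≠ 0 → Orthonormal ℂ fun _ : Fin 1 => ((‖z‖⁻¹ : ℝ) : ℂ) • z := by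
    intro z hz
    refine ⟨fun _ => ?_, fun i j hij => absurd (Subsingleton.elim i j) hij⟩
    rw [norm_smul, Complex.norm_real, norm_inv, norm_norm, inv_mul_cancel₀ (norm_ne_zero_iff.2 hz)]
  have h := hA 1 _ _ (hon x hx) (hon _ hy)
  rw [Fin.sum_univ_one, Real.rpow_le_rpow_iff (norm_nonneg _) hQ hr] at h
  rw [map_smul, inner_smul_left, inner_smul_right, inner_self_eq_norm_sq_to_K] at h
  simp only [norm_mul, Complex.conj_ofReal, Complex.norm_real, norm_inv, norm_norm, norm_pow,
    RCLike.norm_ofReal, abs_norm] at h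
  have h2 : ‖A x‖⁻¹ * (‖x‖⁻¹ * ‖A x‖ ^ 2) = ‖A x‖ / ‖x‖ := by field_simp
  rwa [h2, div_le_iff₀ hx'] at h

theorem OrthonormalSumBound.of_tendsto {r : ℝ} (hr : 0 < r) {Q : ℕ → ℝ} {Q₀ : ℝ}
    {A : ℕ → H →L[ℂ] H} {A₀ : H →L[ℂ] H} (hA : ∀ m, OrthonormalSumBound r (Q m) (A m))
    (hlim : Filter.Tendsto A Filter.atTop (nhds A₀))
    (hQ : Filter.Tendsto Q Filter.atTop (nhds Q₀)) : OrthonormalSumBound r Q₀ A₀ := by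
  intro N e f he hf
  refine le_of_tendsto_of_tendsto' (tendsto_finsetSum _ fun k _ => ?_)
    (hQ.rpow_const (Or.inr hr.le)) fun m => hA m N e f he hf
  refine Filter.Tendsto.rpow_const (Filter.Tendsto.norm ?_) (Or.inr hr.le)
  exact Filter.Tendsto.inner tendsto_const_nhds
    ((ContinuousLinearMap.apply ℂ H (e k)).continuous.continuousAt.tendsto.comp hlim)

end OperatorNorm

/-! ### From simple to general weights. -/

section Sandwich

open Filter Topology

variable {n : ℕ}

/-- For f with W₂ f in L², domination by 2|W₂ f| gives V₂ f → W₂ f in L². Both T(V₂ f) and the full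
products then converge almost everywhere along a common subsequence, which identifies the limit. -/
theorem isSandwich_of_tendsto {T A₀ : L2TX n →L[ℂ] L2TX n} {W₁ W₂ : TX n → ℂ}
    {V₁ V₂ : ℕ → SimpleFunc (TX n) ℂ}
    (h₁ : ∀ᵐ q, Tendsto (fun m => V₁ m q) atTop (𝓝 (W₁ q)))
    (h₂ : ∀ᵐ q, Tendsto (fun m => V₂ m q) atTop (𝓝 (W₂ q)))
    (hV : ∀ᵐ q, ∀ m, ‖V₂ m q‖ₑ ≤ (2 : NNReal) * ‖W₂ q‖ₑ)
    (hA : Tendsto (fun m => simpleMul (V₁ m) ∘L T ∘L simpleMul (V₂ m)) atTop (𝓝 A₀)) :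
    IsSandwich W₁ T W₂ A₀ := by
  intro f g hfg
  have hu : Tendsto (fun m => simpleMul (V₂ m) f) atTop (𝓝 g) := by
    rw [Lp.tendsto_Lp_iff_tendsto_eLpNorm']
    have := tendsto_eLpNorm_sub_of_norm_le (p := 2) (μ := (volume : Measure (TX n))) (by norm_num)
      (by norm_num) (F := fun m => simpleMul (V₂ m) f) (f := g) (C := 2)
      (fun m => Lp.aestronglyMeasurable _) (Lp.memLp g) (fun m => ?_) ?_
    · exact this
    · filter_upwards [coeFn_simpleMul (V₂ m) f, hfg, hV] with q h1 h2 h3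
      rw [h1, h2, enorm_mul, enorm_mul, ← mul_assoc]
      gcongr
      exact h3 m
    · filter_upwards [ae_all_iff.2 fun m => coeFn_simpleMul (V₂ m) f, hfg, h₂] with q h1 h2 h3
      simp_rw [h1, h2]
      exact h3.mul_const _
  have hTu : Tendsto (fun m => T (simpleMul (V₂ m) f)) atTop (𝓝 (T g)) :=
    (T.continuous.tendsto g).comp hu
  have hAf : Tendsto (fun m => simpleMul (V₁ m) (T (simpleMul (V₂ m) f))) atTop (𝓝 (A₀ f)) :=
    ((ContinuousLinearMap.apply ℂ (L2TX n) f).continuous.tendsto A₀).comp hA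
  obtain ⟨φ, hφ, hφ'⟩ := (tendstoInMeasure_of_tendsto_Lp hTu).exists_seq_tendsto_ae
  obtain ⟨ψ, hψ, hψ'⟩ := (tendstoInMeasure_of_tendsto_Lp
    (hAf.comp hφ.tendsto_atTop)).exists_seq_tendsto_ae
  filter_upwards [hφ', hψ', h₁,
    ae_all_iff.2 fun m => coeFn_simpleMul (V₁ m) (T (simpleMul (V₂ m) f))] with q h1 h2 h3 h4
  simp only [Function.comp_apply, h4] at h2
  exact tendsto_nhds_unique h2 ((h3.comp (hφ.tendsto_atTop.comp hψ.tendsto_atTop)).mul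
    (h1.comp hψ.tendsto_atTop))

/-- The sandwich is bilinear in the weights and its operator norm is controlled by their L^p norms,
so approximating simple weights give a Cauchy sequence of operators. -/
theorem exists_isSandwich_orthonormalSumBound {p : ENNReal} [Fact (1 ≤ p)] (hp : p ≠ ⊤) {r C : ℝ}
    (hr : 0 < r) (hC : 0 ≤ C) {T : L2TX n →L[ℂ] L2TX n}
    (hT : ∀ V₁ V₂ : SimpleFunc (TX n) ℂ, CylinderSupported V₁ → CylinderSupported V₂ →
      OrthonormalSumBound r (C * ((eLpNorm V₁ p volume).toReal * (eLpNorm V₂ p volume).toReal))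
        (simpleMul V₁ ∘L T ∘L simpleMul V₂))
    {W₁ W₂ : TX n → ℂ} (hW₁ : MemLp W₁ p volume) (hW₂ : MemLp W₂ p volume) :
    ∃ A, IsSandwich W₁ T W₂ A ∧ OrthonormalSumBound r
      (C * ((eLpNorm W₁ p volume).toReal * (eLpNorm W₂ p volume).toReal)) A := by
  have hp0 : p ≠ 0 := (zero_lt_one.trans_le Fact.out).ne'
  obtain ⟨V₁, hc₁, hd₁, hl₁⟩ := exists_simple_approximation hW₁.1
  obtain ⟨V₂, hc₂, hd₂, hl₂⟩ := exists_simple_approximation hW₂.1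
  have hlim : ∀ {W : TX n → ℂ} (hW : MemLp W p volume) {V : ℕ → SimpleFunc (TX n) ℂ}
      (hc : ∀ m, CylinderSupported (V m)),
      (∀ᵐ q, ∀ m, ‖V m q‖ₑ ≤ (2 : NNReal) * ‖W q‖ₑ) →
      (∀ᵐ q, Tendsto (fun m => V m q) atTop (𝓝 (W q))) →
      Tendsto (fun m => ((hc m).memLp p).toLp (V m)) atTop (𝓝 (hW.toLp W)) := by
    intro W hW V hc hd hl
    rw [Lp.tendsto_Lp_iff_tendsto_eLpNorm'']
    exact tendsto_eLpNorm_sub_of_norm_le hp0 hp (fun m => (V m).aestronglyMeasurable) hW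
      (fun m => hd.mono fun q hq => hq m) hl
  have hx := hlim hW₁ hc₁ hd₁ hl₁
  have hy := hlim hW₂ hc₂ hd₂ hl₂
  let x := fun m => ((hc₁ m).memLp p).toLp (V₁ m)
  let y := fun m => ((hc₂ m).memLp p).toLp (V₂ m)
  let A := fun m => simpleMul (V₁ m) ∘L T ∘L simpleMul (V₂ m)
  have hnorm : ∀ U V : SimpleFunc (TX n) ℂ, CylinderSupported U → CylinderSupported V →
      ‖simpleMul U ∘L T ∘L simpleMul V‖ ≤
        C * ((eLpNorm U p volume).toReal * (eLpNorm V p volume).toReal) :=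
    fun U V hU hV => (hT U V hU hV).norm_le hr (by positivity)
  have hdist : ∀ m l, dist (A m) (A l) ≤
      C * (dist (x m) (x l) * ‖y m‖ + ‖x l‖ * dist (y m) (y l)) := by
    intro m l
    have h1 : A m - A l = simpleMul (V₁ m - V₁ l) ∘L T ∘L simpleMul (V₂ m) +
        simpleMul (V₁ l) ∘L T ∘L simpleMul (V₂ m - V₂ l) := by
      rw [simpleMul_sub, simpleMul_sub]
      ext1 f
      simp [A]
    have h2 : ∀ {V : ℕ → SimpleFunc (TX n) ℂ} (hc : ∀ m, CylinderSupported (V m)),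
        dist (((hc m).memLp p).toLp (V m)) (((hc l).memLp p).toLp (V l)) =
          (eLpNorm (V m - V l : SimpleFunc (TX n) ℂ) p volume).toReal := by
      intro V hc
      rw [dist_eq_norm, ← MemLp.toLp_sub, Lp.norm_toLp, SimpleFunc.coe_sub]
    rw [dist_eq_norm, h1, mul_add]
    refine (norm_add_le _ _).trans (add_le_add ?_ ?_)
    · refine (hnorm _ _ ((hc₁ m).sub (hc₁ l)) (hc₂ m)).trans_eq ?_
      rw [h2 hc₁, Lp.norm_toLp]
    · refine (hnorm _ _ (hc₁ l) ((hc₂ m).sub (hc₂ l))).trans_eq ?_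
      rw [h2 hc₂, Lp.norm_toLp]
  have hcauchy : CauchySeq A := by
    rw [cauchySeq_iff_tendsto_dist_atTop_0]
    refine squeeze_zero (fun _ => dist_nonneg) (fun ml => hdist ml.1 ml.2) ?_
    have hx' := cauchySeq_iff_tendsto_dist_atTop_0.1 hx.cauchySeq
    have hy' := cauchySeq_iff_tendsto_dist_atTop_0.1 hy.cauchySeq
    have hfst : Tendsto (Prod.fst : ℕ × ℕ → ℕ) atTop atTop := by
      rw [← prod_atTop_atTop_eq]; exact tendsto_fst
    have hsnd : Tendsto (Prod.snd : ℕ × ℕ → ℕ) atTop atTop := by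
      rw [← prod_atTop_atTop_eq]; exact tendsto_snd
    have := ((hx'.mul (hy.norm.comp hfst)).add ((hx.norm.comp hsnd).mul hy')).const_mul C
    simp only [mul_zero, zero_mul, add_zero] at this
    exact this
  obtain ⟨A₀, hA₀⟩ := cauchySeq_tendsto_of_complete hcauchy
  refine ⟨A₀, isSandwich_of_tendsto hl₁ hl₂ hd₂ hA₀,
    OrthonormalSumBound.of_tendsto hr (fun m => hT _ _ (hc₁ m) (hc₂ m)) hA₀ ?_⟩
  have := (hx.norm.mul hy.norm).const_mul C
  simpa only [Lp.norm_toLp] using this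

end Sandwich

/-! ### Norms of powers of a function. -/

section PowerWeights

variable {X : Type*} [MeasurableSpace X] {μ : Measure X}

theorem eLpNorm_of_norm_eq_rpow {f W : X → ℂ} {p q : ENNReal} {a : ℝ} (ha : 0 < a)
    (hq : p * ENNReal.ofReal a = q) (h : ∀ x, ‖W x‖ = ‖f x‖ ^ a) :
    eLpNorm W p μ = eLpNorm f q μ ^ a := by
  rw [← hq, ← eLpNorm_norm_rpow f ha]
  exact eLpNorm_congr_norm_ae (ae_of_all _ fun x => by
    rw [h, Real.norm_of_nonneg (Real.rpow_nonneg (norm_nonneg _) _)])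

theorem memLp_of_norm_eq_rpow {f W : X → ℂ} {p q : ENNReal} {a : ℝ} (ha : 0 < a)
    (hq : p * ENNReal.ofReal a = q) (h : ∀ x, ‖W x‖ = ‖f x‖ ^ a)
    (hW : AEStronglyMeasurable W μ) (hf : MemLp f q μ) : MemLp W p μ := by
  refine ⟨hW, ?_⟩
  rw [eLpNorm_of_norm_eq_rpow ha hq h]
  exact ENNReal.rpow_lt_top_of_nonneg ha.le hf.2.ne

theorem norm_norm_rpow (z : ℂ) (a : ℝ) : ‖((‖z‖ ^ a : ℝ) : ℂ)‖ = ‖z‖ ^ a := by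
  rw [Complex.norm_real, Real.norm_of_nonneg (Real.rpow_nonneg (norm_nonneg _) _)]

theorem aestronglyMeasurable_norm_rpow {f : X → ℂ} (hf : AEStronglyMeasurable f μ) (a : ℝ) :
    AEStronglyMeasurable (fun x => ((‖f x‖ ^ a : ℝ) : ℂ)) μ :=
  (Complex.measurable_ofReal.comp_aemeasurable
    (hf.norm.aemeasurable.pow_const a)).aestronglyMeasurable

theorem norm_mul_norm_rpow {z : ℂ} {a b : ℝ} (hab : 1 + a = b) (hb : b ≠ 0) :
    ‖z * ((‖z‖ ^ a : ℝ) : ℂ)‖ = ‖z‖ ^ b := by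
  by_cases hz : z = 0
  · subst hz
    rw [zero_mul, norm_zero, Real.zero_rpow hb]
  · rw [norm_mul, norm_norm_rpow, ← hab, Real.rpow_add (norm_pos_iff.2 hz), Real.rpow_one]

end PowerWeights

/-! ### From sandwich bounds to the L^p bound. -/

section LebesgueBound

open Filter Topology

variable {n : ℕ}

/-- Truncation of a function to a cylinder and to the set where it is bounded. -/
theorem exists_truncation (g : L2TX n) (q : ENNReal) :
    ∃ h : ℕ → TX n → ℂ, (∀ m, MemLp (h m) q volume) ∧ (∀ m x, h m x = g x ∨ h m x = 0) ∧
      ∀ x, Tendsto (fun m => h m x) atTop (𝓝 (g x)) := by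
  have hg : StronglyMeasurable g := Lp.stronglyMeasurable g
  let E : ℕ → Set (TX n) := fun m => cylinder n m ∩ {x | ‖g x‖ ≤ m}
  have hE : ∀ m, MeasurableSet (E m) := fun m =>
    (measurableSet_cylinder _).inter (hg.norm.measurable measurableSet_Iic)
  refine ⟨fun m => (E m).indicator g, fun m => ?_, fun m x => ?_, fun x => ?_⟩
  · rw [memLp_indicator_iff_restrict (hE m)]
    have : IsFiniteMeasure (volume.restrict (E m)) := isFiniteMeasure_restrict.2
      ((measure_mono Set.inter_subset_left).trans_lt (volume_cylinder_lt_top (m : ℝ))).ne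
    exact MemLp.of_bound hg.aestronglyMeasurable m
      ((ae_restrict_iff' (hE m)).2 (ae_of_all _ fun x hx => hx.2))
  · by_cases hx : x ∈ E m
    · exact Or.inl (Set.indicator_of_mem hx _)
    · exact Or.inr (Set.indicator_of_notMem hx _)
  · refine tendsto_const_nhds.congr' ?_
    obtain ⟨m₀, hm₀⟩ := exists_nat_ge (max ‖x.2‖ ‖g x‖)
    filter_upwards [eventually_ge_atTop m₀] with m hm
    have h1 : max ‖x.2‖ ‖g x‖ ≤ m := hm₀.trans (by exact_mod_cast hm)
    rw [Set.indicator_of_mem]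
    exact ⟨(le_max_left _ _).trans h1, (le_max_right _ _).trans h1⟩

/-- An operator on `L²` whose sandwiches are bounded by the `L^{2λ}` norms of the weights is
bounded from `L^p` to its dual. -/
theorem isBoundedLpLq_of_sandwich {lam : ℝ} (hlam : 1 < lam) {T : L2TX n →L[ℂ] L2TX n}
    {C : NNReal}
    (h : ∀ W₁ W₂ : TX n → ℂ, MemLp W₁ (ENNReal.ofReal (2 * lam)) volume →
      MemLp W₂ (ENNReal.ofReal (2 * lam)) volume →
      ∃ A, IsSandwich W₁ T W₂ A ∧ ∀ e : L2TX n, eLpNorm (A e) 2 volume ≤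
        C * eLpNorm W₁ (ENNReal.ofReal (2 * lam)) volume *
          eLpNorm W₂ (ENNReal.ofReal (2 * lam)) volume * eLpNorm e 2 volume) :
    IsBoundedLpLq T (ENNReal.ofReal (2 * lam / (1 + lam)))
      (ENNReal.ofReal (Real.conjExponent (2 * lam / (1 + lam)))) := by
  have hl : 0 < lam := by linarith
  have hl1 : 0 < lam - 1 := by linarith
  have hconj : Real.conjExponent (2 * lam / (1 + lam)) = 2 * lam / (lam - 1) := by
    have h1 : 2 * lam / (1 + lam) - 1 = (lam - 1) / (1 + lam) := by field_simp; ring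
    rw [Real.conjExponent, h1]
    field_simp
  rw [hconj]
  have hexp : ∀ {x a y : ℝ}, 0 ≤ x → x * a = y →
      ENNReal.ofReal x * ENNReal.ofReal a = ENNReal.ofReal y := by
    intro x a y hx hxy
    rw [← ENNReal.ofReal_mul hx, hxy]
  refine ⟨C, fun f hf => ?_⟩
  -- Factor f = W₂ e₀ with |W₂| = |f|^{1/(1+lam)} in L^{2 lam} and |e₀| = |f|^{lam/(1+lam)} in L²;
  -- the product of these two norms is ‖f‖_p.
  let W₂ : TX n → ℂ := fun q => ((‖f q‖ ^ (1 / (1 + lam)) : ℝ) : ℂ)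
  let e₀ : TX n → ℂ := fun q => f q * ((‖f q‖ ^ (-(1 / (1 + lam))) : ℝ) : ℂ)
  have hfm : AEStronglyMeasurable f (volume : Measure (TX n)) := Lp.aestronglyMeasurable f
  have hW₂exp : ENNReal.ofReal (2 * lam) * ENNReal.ofReal (1 / (1 + lam)) =
      ENNReal.ofReal (2 * lam / (1 + lam)) := hexp (by positivity) (by ring)
  have he₀exp : 2 * ENNReal.ofReal (lam / (1 + lam)) = ENNReal.ofReal (2 * lam / (1 + lam)) := by
    rw [← ENNReal.ofReal_ofNat 2]
    exact hexp (by positivity) (by ring)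
  have hW₂n : ∀ q, ‖W₂ q‖ = ‖f q‖ ^ (1 / (1 + lam)) := fun q => norm_norm_rpow _ _
  have he₀n : ∀ q, ‖e₀ q‖ = ‖f q‖ ^ (lam / (1 + lam)) := fun q =>
    norm_mul_norm_rpow (by field_simp; ring) (by positivity)
  have hW₂ : MemLp W₂ (ENNReal.ofReal (2 * lam)) volume :=
    memLp_of_norm_eq_rpow (by positivity) hW₂exp hW₂n (aestronglyMeasurable_norm_rpow hfm _) hf
  have he₀ : MemLp e₀ 2 volume :=
    memLp_of_norm_eq_rpow (by positivity) he₀exp he₀n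
      (hfm.mul (aestronglyMeasurable_norm_rpow hfm _)) hf
  have hfe : f =ᵐ[volume] fun q => W₂ q * he₀.toLp e₀ q := by
    filter_upwards [he₀.coeFn_toLp] with q hq
    rw [hq]
    by_cases h0 : f q = 0
    · simp [e₀, h0]
    · have hpos : 0 < ‖f q‖ := norm_pos_iff.2 h0
      simp only [W₂, e₀]
      rw [mul_left_comm, ← Complex.ofReal_mul, ← Real.rpow_add hpos, add_neg_cancel,
        Real.rpow_zero, Complex.ofReal_one, mul_one]
  have hprod : eLpNorm W₂ (ENNReal.ofReal (2 * lam)) volume * eLpNorm (he₀.toLp e₀) 2 volume =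
      eLpNorm f (ENNReal.ofReal (2 * lam / (1 + lam))) volume := by
    rw [eLpNorm_congr_ae he₀.coeFn_toLp,
      eLpNorm_of_norm_eq_rpow (by positivity) hW₂exp hW₂n,
      eLpNorm_of_norm_eq_rpow (by positivity) he₀exp he₀n,
      ← ENNReal.rpow_add_of_nonneg _ _ (by positivity) (by positivity)]
    have : 1 / (1 + lam) + lam / (1 + lam) = 1 := by field_simp
    rw [this, ENNReal.rpow_one]
  -- It is not yet known that T f lies in the target space; a truncation has finite norm, which can
  -- be divided out at the end.
  obtain ⟨t, ht, htg, htlim⟩ := exists_truncation (T f) (ENNReal.ofReal (2 * lam / (lam - 1)))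
  refine Lp.eLpNorm_le_of_ae_tendsto (u := atTop) (f := t) (Eventually.of_forall fun m => ?_)
    (fun m => (ht m).1) (ae_of_all _ htlim)
  let W₁ : TX n → ℂ := fun q => ((‖t m q‖ ^ (1 / (lam - 1)) : ℝ) : ℂ)
  have hW₁n : ∀ q, ‖W₁ q‖ = ‖t m q‖ ^ (1 / (lam - 1)) := fun q => norm_norm_rpow _ _
  have hW₁exp : ENNReal.ofReal (2 * lam) * ENNReal.ofReal (1 / (lam - 1)) =
      ENNReal.ofReal (2 * lam / (lam - 1)) := hexp (by positivity) (by ring)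
  have hW₁ : MemLp W₁ (ENNReal.ofReal (2 * lam)) volume :=
    memLp_of_norm_eq_rpow (by positivity) hW₁exp hW₁n
      (aestronglyMeasurable_norm_rpow (ht m).1 _) (ht m)
  obtain ⟨A, hA, hAb⟩ := h W₁ W₂ hW₁ hW₂
  -- Since t m is either T f or 0, |W₁ T f| = |t m|^{lam/(lam-1)}. The estimate thus reads ‖t
  -- m‖^{1+1/(lam-1)} ≤ C ‖t m‖^{1/(lam-1)} ‖f‖_p.
  have hAe : eLpNorm (A (he₀.toLp e₀)) 2 volume =
      eLpNorm (t m) (ENNReal.ofReal (2 * lam / (lam - 1))) volume ^ (lam / (lam - 1)) := by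
    rw [eLpNorm_congr_ae (hA _ f hfe)]
    refine eLpNorm_of_norm_eq_rpow (by positivity) ?_ fun q => ?_
    · rw [← ENNReal.ofReal_ofNat 2]
      exact hexp (by positivity) (by ring)
    · rcases htg m q with h1 | h1
      · simp only [W₁]
        rw [← h1, mul_comm]
        exact norm_mul_norm_rpow (by field_simp; ring) (by positivity)
      · rw [norm_mul, hW₁n, h1, norm_zero, Real.zero_rpow (by positivity),
          Real.zero_rpow (by positivity), zero_mul]
  have hmain := hAb (he₀.toLp e₀)
  rw [hAe, mul_assoc, hprod, eLpNorm_of_norm_eq_rpow (by positivity) hW₁exp hW₁n] at hmain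
  generalize hx : eLpNorm (t m) (ENNReal.ofReal (2 * lam / (lam - 1))) volume = x at hmain ⊢
  have hxtop : x ≠ ⊤ := hx ▸ (ht m).2.ne
  rcases eq_or_ne x 0 with hx0 | hx0
  · rw [hx0]
    exact zero_le
  have h1 : lam / (lam - 1) = 1 + 1 / (lam - 1) := by field_simp; ring
  rw [h1, ENNReal.rpow_add _ _ hx0 hxtop, ENNReal.rpow_one, mul_right_comm] at hmain
  exact (ENNReal.mul_le_mul_iff_left (by simp [hx0, hxtop])
    (ENNReal.rpow_ne_top_of_nonneg (by positivity) hxtop)).1 hmain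

end LebesgueBound

end FourierHermite

end

/-! ### The theorem. -/

open FourierHermite in
theorem theorem3p3 (n : ℕ) (hn : 1 ≤ n) (S : Set ((Fin n → ℕ) × ℤ))
    (lam : ℝ) (hlam : 1 < lam)
    (G : ℂ → (Fin n → ℕ) × ℤ → ℂ)
    (hG : IsAnalyticFamily lam G)
    (hS : ∀ s, G (-1) s = S.indicator (fun _ => (1 : ℂ)) s)
    (hG0 : ∃ M a : ℝ, ∀ (τ : ℝ) (s : (Fin n → ℕ) × ℤ),
      ‖G (τ * Complex.I) s‖ ≤ M * Real.exp (a * |τ|))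
    (hK : ∃ M b : ℝ, ∀ τ : ℝ,
      ∃ K : EuclideanSpace ℝ (Fin n) × EuclideanSpace ℝ (Fin n) × Torus → ℂ,
        IsBoundedKernel (G (-lam + τ * Complex.I)) (M * Real.exp (b * |τ|)) K) :
    ∃ E : lp (fun _ : S => ℂ) 2 →L[ℂ] L2TX n, IsExtensionOperator S E ∧
      IsBoundedLpLq (E ∘L ContinuousLinearMap.adjoint E)
        (ENNReal.ofReal (2 * lam / (1 + lam)))
        (ENNReal.ofReal (Real.conjExponent (2 * lam / (1 + lam)))) ∧
      ∃ C : NNReal, ∀ W₁ W₂ : TX n → ℂ,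
        MemLp W₁ (ENNReal.ofReal (2 * lam)) volume →
        MemLp W₂ (ENNReal.ofReal (2 * lam)) volume →
        ∃ A : L2TX n →L[ℂ] L2TX n,
          IsSandwich W₁ (E ∘L ContinuousLinearMap.adjoint E) W₂ A ∧
          IsSchatten (2 * lam) A ∧
          schattenNorm (2 * lam) A ≤
            C * eLpNorm W₁ (ENNReal.ofReal (2 * lam)) volume *
              eLpNorm W₂ (ENNReal.ofReal (2 * lam)) volume := by
  obtain ⟨E, hE, hEs⟩ := exists_isExtensionOperator S
  obtain ⟨M, g, hg⟩ := exists_isRegularFamily hlam hG hS hG0 hK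
  have hT := inner_modeL2_extension_adjoint hEs
  have hr : 0 < 2 * lam := by linarith
  have hC := interpolationConst_nonneg (lam := lam) hg.nonneg
  have : Fact (1 ≤ ENNReal.ofReal (2 * lam)) :=
    ⟨by rw [← ENNReal.ofReal_one]; exact ENNReal.ofReal_le_ofReal (by linarith)⟩
  have key := fun (W₁ W₂ : TX n → ℂ) (hW₁ : MemLp W₁ (ENNReal.ofReal (2 * lam)) volume)
      (hW₂ : MemLp W₂ (ENNReal.ofReal (2 * lam)) volume) =>
    exists_isSandwich_orthonormalSumBound ENNReal.ofReal_ne_top hr hC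
      (orthonormalSumBound_simple hlam hg hT) hW₁ hW₂
  have hconst : ∀ {W₁ W₂ : TX n → ℂ}, MemLp W₁ (ENNReal.ofReal (2 * lam)) volume →
      MemLp W₂ (ENNReal.ofReal (2 * lam)) volume →
      ENNReal.ofReal (interpolationConst lam M *
        ((eLpNorm W₁ (ENNReal.ofReal (2 * lam)) volume).toReal *
          (eLpNorm W₂ (ENNReal.ofReal (2 * lam)) volume).toReal)) =
      (interpolationConst lam M).toNNReal * eLpNorm W₁ (ENNReal.ofReal (2 * lam)) volume *
        eLpNorm W₂ (ENNReal.ofReal (2 * lam)) volume := by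
    intro W₁ W₂ hW₁ hW₂
    rw [ENNReal.ofReal_mul hC, ENNReal.ofReal_mul ENNReal.toReal_nonneg,
      ENNReal.ofReal_toReal hW₁.2.ne, ENNReal.ofReal_toReal hW₂.2.ne, ← mul_assoc]
    rfl
  refine ⟨E, hE, isBoundedLpLq_of_sandwich (C := (interpolationConst lam M).toNNReal) hlam
    fun W₁ W₂ hW₁ hW₂ => ?_, (interpolationConst lam M).toNNReal, fun W₁ W₂ hW₁ hW₂ => ?_⟩
  · obtain ⟨A, hA, hAb⟩ := key W₁ W₂ hW₁ hW₂
    refine ⟨A, hA, fun e => ?_⟩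
    have h1 := (A.le_opNorm e).trans
      (mul_le_mul_of_nonneg_right (hAb.norm_le hr (by positivity)) (norm_nonneg e))
    rw [← hconst hW₁ hW₂, ← Lp.enorm_def, ← Lp.enorm_def, ← ofReal_norm (A e), ← ofReal_norm e,
      ← ENNReal.ofReal_mul (by positivity)]
    exact ENNReal.ofReal_le_ofReal h1
  · obtain ⟨A, hA, hAb⟩ := key W₁ W₂ hW₁ hW₂
    exact ⟨A, hA, hAb.isSchatten hr, (hAb.schattenNorm_le hr (by positivity)).trans_eq
      (hconst hW₁ hW₂)⟩
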